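/- Let $d\ge 1$. Let $\langle x,y\rangle_-=x_1y_1+\dots+x_dy_d-x_{d+1}y_{d+1}$ on $\mathbb R^{d+1}$, let $\mathcal F=\{x:\langle x,x\rangle_-<0,\ x_{d+1}>0\}$, write $\|x\|_-=\sqrt{-\langle x,x\rangle_-}$ for causal $x$, and let $\mathbb H^d=\{x\in\mathcal F:\langle x,x\rangle_-=-1\}$ be hyperbolic space, with Laplacian $\Delta$, distance $d_{\mathbb H^d}$ and volume $\mathrm d\mathbb H^d$. Let $\Gamma_0$ be a group of linear isometries of $\langle\cdot,\cdot\rangle_-$ preserving $\mathcal F$ that acts freely and properly discontinuously on $\mathbb H^d$ with compact quotient, and let $P:\mathbb H^d\to\mathbb H^d/\Gamma_0$ be the projection. (1) For each finite positive Radon measure $\bar\mu$ on $\mathbb H^d/\Gamma_0$, the equation $\frac1d\Delta\bar h-\bar h=\bar\mu$ has exactly one solution $\bar h$ in $\mathcal D'(\mathbb H^d/\Gamma_0)$. It is given explicitly as follows. Let $\mu=P^*\bar\mu$ be the measure on $\mathbb H^d$ with $\mu(A)=\bar\mu(P(A))$ for each Borel set $A$ on which $P$ is injective, let $$G(x,y)=k(d_{\mathbb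 H^d}(x,y)),\qquad k(\rho)=\frac{\cosh\rho}{v_{d-1}}\int_{+\infty}^{\rho}\frac{\mathrm dt}{\sinh^{d-1}(t)\cosh^2(t)},$$ where $v_{d-1}$ is the area of the unit sphere of $\mathbb R^d$, and for $f\in C_c^\infty(\mathbb H^d)$ let $h_f(x)=d\int_{\mathbb H^d}G(x,y)f(y)\,\mathrm d\mathbb H^d(y)$ and $(h_\mu,f)=\int_{\mathbb H^d}h_f\,\mathrm d\mu$ (these integrals converge absolutely). Then $\bar h=P_*h_\mu$: for all $f\in C_c^\infty(\mathbb H^d)$, if $\bar f\in C^\infty(\mathbb H^d/\Gamma_0)$ is the function with $\bar f(P(x))=\sum_{\gamma\in\Gamma_0}f(\gamma x)$, then $(\bar h,\bar f)=(h_\mu,f)$. (2) Let $\tau:\Gamma_0\to\mathbb R^{d+1}$ be a cocycle, i.e. $\tau_{\gamma\delta}=\tau_\gamma+\gamma\tau_\delta$. A function $h:\mathbb H^d\to\mathbb R$ is $\tau$-equivariant if its $1$-homogeneous extension $H(\eta)=\|\eta\|_-h(\eta/\|\eta\|_-)$ to $\mathcal F$ satisfies $H(\gamma\eta)=H(\eta)+\langle\gamma^{-1}\tau_\gamma,\eta\rangle_-$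 for all $\gamma\in\Gamma_0$, $\eta\in\mathcal F$. For continuous $h$, let $S_1(h)=\frac1d\Delta h-h$ in the sense of distributions on $\mathbb H^d$. If $h,h'$ are continuous $\tau$-equivariant functions with $S_1(h)=S_1(h')$, then $h=h'$. (3) An F-convex set is a proper closed convex set $K\subset\mathbb R^{d+1}$ that is an intersection of half-spaces $\{x:\langle x,\eta\rangle_-\le\alpha\}$ with $\eta\in\mathcal F$, $\alpha\in\mathbb R$, and such that for each $\eta\in\mathcal F$ the function $\langle\cdot,\eta\rangle_-$ attains a maximum on $K$; it is $\tau$-F-convex if it is setwise invariant under the maps $x\mapsto\gamma x+\tau_\gamma$, $\gamma\in\Gamma_0$. For $k$ in the interior of $K$, let $r(k)$ be the point of $\partial K$ in the closed past cone of $k$ that maximizes the Lorentzian distance $T(k)=\|k-r(k)\|_-$ to $k$. The area measures $S_0(K,\cdot),\dots,S_d(K,\cdot)$ of $K$ are the Radon measures on $\mathbb H^d$ such that for all $\varepsilon>0$ and all Borel sets $\omega\subset\mathbb H^d$ the Lebesgue measure of $\{k: 0<T(k)\le\varepsilon,\ (k-r(k))/T(k)\in\omega\}$ is $\frac1{d+1}\sum_{i=0}^d\varepsilon^{d+1-i}\binom{d+1}{i}S_i(K,\omega)$;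 $S_1(K,\cdot)$ is the first area measure. If two $\tau$-F-convex sets have the same first area measure, they are equal. -/

import Mathlib

open Set MeasureTheory Topology
open scoped ENNReal ContDiff

noncomputable section

/-! ## Minkowski space and hyperbolic space -/

/-- `ℝ^{d+1} = ℝ^d × ℝ`; the last coordinate `x_{d+1}` is the time coordinate `x.2`. -/
abbrev Mink (d : ℕ) : Type := EuclideanSpace ℝ (Fin d) × ℝ

/-- The Minkowski bilinear form `⟨x, y⟩₋ = x₁y₁ + ⋯ + x_d y_d - x_{d+1} y_{d+1}`. -/
def mink {d : ℕ} (x y : Mink d) : ℝ := inner ℝ x.1 y.1 - x.2 * y.2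

/-- `‖x‖₋ = √(-⟨x, x⟩₋)`, for a causal vector `x`. -/
def mnorm {d : ℕ} (x : Mink d) : ℝ := Real.sqrt (-mink x x)

/-- The set `𝓕` of future time-like vectors. -/
def futureCone (d : ℕ) : Set (Mink d) := {x | mink x x < 0 ∧ 0 < x.2}

/-- The hyperbolic space `ℍ^d`, as the upper sheet of the hyperboloid. -/
abbrev Hyp (d : ℕ) : Type := {x : Mink d // mink x x = -1 ∧ 0 < x.2}

/-- The global parametrisation `u ↦ (u, √(1 + |u|²))` of `ℍ^d`. -/
def hypGraph {d : ℕ} (u : EuclideanSpace ℝ (Fin d)) : Hyp d :=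
  ⟨(u, Real.sqrt (1 + ‖u‖ ^ 2)), by
    have h : (0 : ℝ) < 1 + ‖u‖ ^ 2 := by positivity
    refine ⟨?_, Real.sqrt_pos.2 h⟩
    simp only [mink, real_inner_self_eq_norm_sq]
    rw [Real.mul_self_sqrt h.le]
    ring⟩

/-- The Riemannian volume `dℍ^d`.  In the parametrisation `hypGraph` the metric is
`g_ij = δ_ij - u_i u_j / (1 + |u|²)`, with `√(det g) = 1 / √(1 + |u|²)`. -/
def hypVol (d : ℕ) : Measure (Hyp d) :=
  ((volume : Measure (EuclideanSpace ℝ (Fin d))).withDensity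
    fun u => ENNReal.ofReal (1 / Real.sqrt (1 + ‖u‖ ^ 2))).map hypGraph

/-- The hyperbolic distance: `cosh d(x, y) = -⟨x, y⟩₋`. -/
def hypDist {d : ℕ} (x y : Hyp d) : ℝ := Real.arcosh (-mink (x : Mink d) y)

lemma mink_smul_smul {d : ℕ} (a b : ℝ) (x y : Mink d) :
    mink (a • x) (b • y) = a * b * mink x y := by
  simp only [mink, Prod.smul_fst, Prod.smul_snd, real_inner_smul_left, real_inner_smul_right,
    smul_eq_mul]
  ring

lemma mnorm_pos {d : ℕ} {x : Mink d} (hx : x ∈ futureCone d) : 0 < mnorm x :=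
  Real.sqrt_pos.2 (by have := hx.1; linarith)

lemma normalize_mem {d : ℕ} {x : Mink d} (hx : x ∈ futureCone d) :
    mink ((mnorm x)⁻¹ • x) ((mnorm x)⁻¹ • x) = -1 ∧ 0 < ((mnorm x)⁻¹ • x).2 := by
  have h0 := mnorm_pos hx
  refine ⟨?_, ?_⟩
  · have h1 : mnorm x * mnorm x = -mink x x :=
      Real.mul_self_sqrt (by have := hx.1; linarith)
    have h2 : mink x x = -(mnorm x * mnorm x) := by linarith
    rw [mink_smul_smul, h2]
    field_simp
  · exact mul_pos (inv_pos.2 h0) hx.2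

open Classical in
/-- The radial projection `x ↦ x / ‖x‖₋` of `𝓕` onto `ℍ^d` (with a dummy value off `𝓕`). -/
def hypProj {d : ℕ} (x : Mink d) : Hyp d :=
  if hx : x ∈ futureCone d then ⟨(mnorm x)⁻¹ • x, normalize_mem hx⟩ else hypGraph 0

/-- The extension to `𝓕`, constant along rays, of a function on `ℍ^d`. -/
def zeroExt {d : ℕ} (f : Hyp d → ℝ) (x : Mink d) : ℝ := f (hypProj x)

/-- The `1`-extension to `𝓕` of a function on `ℍ^d`: `H(x) = ‖x‖₋ h(x / ‖x‖₋)`. -/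
def oneExt {d : ℕ} (h : Hyp d → ℝ) (x : Mink d) : ℝ := mnorm x * h (hypProj x)

/-! ## Smooth functions and the Laplacian on `ℍ^d` -/

/-- `f` is a `C^∞` function on the manifold `ℍ^d`. -/
def IsSmoothHyp {d : ℕ} (f : Hyp d → ℝ) : Prop := ContDiffOn ℝ ∞ (zeroExt f) (futureCone d)

/-- The wave operator `□ = ∂₁² + ⋯ + ∂_d² - ∂_{d+1}²`. -/
def wave {d : ℕ} (F : Mink d → ℝ) (x : Mink d) : ℝ :=
  (∑ i : Fin d, fderiv ℝ (fderiv ℝ F) x (EuclideanSpace.single i 1, 0)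
      (EuclideanSpace.single i 1, 0))
    - fderiv ℝ (fderiv ℝ F) x (0, 1) (0, 1)

/-- The Laplace-Beltrami operator of `ℍ^d`.  On `𝓕`, with `r = ‖x‖₋`, the flat metric is
`-dr² + r² g`, so that `□ = -∂_r² - (d / r) ∂_r + r⁻² Δ`; applied to the extension of `f` that is
constant along rays, and evaluated at `r = 1`, this is `Δ f`. -/
def lap {d : ℕ} (f : Hyp d → ℝ) (x : Hyp d) : ℝ := wave (zeroExt f) x

/-- The test functions `C_c^∞(ℍ^d)`. -/
def IsTest {d : ℕ} (f : Hyp d → ℝ) : Prop := IsSmoothHyp f ∧ HasCompactSupport f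

/-- `C_c^∞(ℍ^d)` as a type. -/
def TestFun (d : ℕ) : Type := {f : Hyp d → ℝ // IsTest f}

/-- The distribution `S₁(h) = (1/d) Δ h - h` on `ℍ^d`, for a continuous function `h`:
`(S₁(h), f) = ∫ h ((1/d) Δ f - f) dℍ^d`. -/
def S1 {d : ℕ} (h : Hyp d → ℝ) (f : TestFun d) : ℝ :=
  ∫ x, h x * (1 / (d : ℝ) * lap f.1 x - f.1 x) ∂(hypVol d)

/-! ## Hyperbolic isometries, quotients and cocycles -/

/-- The group of isometries of `ℍ^d`: the linear isometries of Minkowski space that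
preserve `𝓕`. -/
def HypIsom (d : ℕ) : Subgroup (Mink d ≃L[ℝ] Mink d) where
  carrier := {γ | (∀ x y, mink (γ x) (γ y) = mink x y) ∧ ∀ x, γ x ∈ futureCone d ↔ x ∈ futureCone d}
  one_mem' := ⟨fun _ _ => rfl, fun _ => Iff.rfl⟩
  mul_mem' := by
    rintro a b ⟨ha, ha'⟩ ⟨hb, hb'⟩
    refine ⟨fun x y => ?_, fun x => ?_⟩
    · show mink (a (b x)) (a (b y)) = _
      rw [ha, hb]
    · show a (b x) ∈ _ ↔ _
      rw [ha', hb']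
  inv_mem' := by
    rintro a ⟨ha, ha'⟩
    refine ⟨fun x y => ?_, fun x => ?_⟩
    · show mink (a.symm x) (a.symm y) = _
      rw [← ha, a.apply_symm_apply, a.apply_symm_apply]
    · show a.symm x ∈ _ ↔ _
      rw [← ha', a.apply_symm_apply]

/-- The linear map underlying an isometry. -/
def isomLin {d : ℕ} (γ : HypIsom d) : Mink d ≃L[ℝ] Mink d := γ.1

lemma Hyp.mem_cone {d : ℕ} (x : Hyp d) : (x : Mink d) ∈ futureCone d :=
  ⟨by rw [x.2.1]; norm_num, x.2.2⟩

instance (d : ℕ) : MulAction (HypIsom d) (Hyp d) where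
  smul γ x := ⟨isomLin γ x, by
    refine ⟨?_, ((γ.2.2 x).2 x.mem_cone).2⟩
    exact (γ.2.1 _ _).trans x.2.1⟩
  one_smul _ := rfl
  mul_smul _ _ _ := rfl

/-- The quotient `ℍ^d / Γ`.  It carries the quotient topology and its Borel `σ`-algebra (a set is
measurable if and only if its preimage in `ℍ^d` is). -/
abbrev HypQuot {d : ℕ} (Γ : Subgroup (HypIsom d)) : Type := MulAction.orbitRel.Quotient Γ (Hyp d)

/-- The covering projection `ℍ^d → ℍ^d / Γ`. -/
def covProj {d : ℕ} (Γ : Subgroup (HypIsom d)) (x : Hyp d) : HypQuot Γ := Quotient.mk _ x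

/-- `Γ` acts freely and properly discontinuously on `ℍ^d`, with compact quotient: `ℍ^d / Γ` is a
compact hyperbolic manifold. -/
structure IsCocompact {d : ℕ} (Γ : Subgroup (HypIsom d)) : Prop where
  free : ∀ (γ : Γ) (x : Hyp d), γ • x = x → γ = 1
  properlyDiscontinuous : ProperlyDiscontinuousSMul Γ (Hyp d)
  compact : CompactSpace (HypQuot Γ)

/-- The `1`-cocycles `Z¹(Γ, ℝ^{d+1})`. -/
def IsCocycle {d : ℕ} {Γ : Subgroup (HypIsom d)} (τ : Γ → Mink d) : Prop :=
  ∀ γ δ : Γ, τ (γ * δ) = τ γ + isomLin γ.1 (τ δ)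

/-- `H : 𝓕 → ℝ` is `τ`-equivariant: it is `1`-homogeneous and
`H(γ η) = H(η) + ⟨γ⁻¹ τ_γ, η⟩₋`. -/
def IsEquivariantCone {d : ℕ} {Γ : Subgroup (HypIsom d)} (τ : Γ → Mink d) (H : Mink d → ℝ) :
    Prop :=
  (∀ η ∈ futureCone d, ∀ t : ℝ, 0 < t → H (t • η) = t * H η) ∧
    ∀ γ : Γ, ∀ η ∈ futureCone d, H (isomLin γ.1 η) = H η + mink ((isomLin γ.1).symm (τ γ)) η

/-- `h : ℍ^d → ℝ` is `τ`-equivariant: its `1`-extension is. -/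
def IsEquivariant {d : ℕ} {Γ : Subgroup (HypIsom d)} (τ : Γ → Mink d) (h : Hyp d → ℝ) : Prop :=
  IsEquivariantCone τ (oneExt h)

/-! ## Smooth functions and the Laplacian on `ℍ^d / Γ`

The Laplacian of `ℍ^d` commutes with isometries, so that it descends to the quotient. -/

lemma isOpen_futureCone (d : ℕ) : IsOpen (futureCone d) := by
  have h1 : Continuous fun x : Mink d => mink x x := by unfold mink; fun_prop
  exact (isOpen_lt h1 continuous_const).inter (isOpen_lt continuous_const continuous_snd)

lemma hypProj_lin {d : ℕ} (γ : HypIsom d) {x : Mink d} (hx : x ∈ futureCone d) :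
    hypProj (isomLin γ x) = γ • hypProj x := by
  have hγ : isomLin γ x ∈ futureCone d := (γ.2.2 x).2 hx
  have hn : mnorm (isomLin γ x) = mnorm x := by
    unfold mnorm
    rw [show mink (isomLin γ x) (isomLin γ x) = mink x x from γ.2.1 x x]
  apply Subtype.ext
  show (hypProj (isomLin γ x)).1 = isomLin γ (hypProj x).1
  rw [hypProj, hypProj, dif_pos hγ, dif_pos hx]
  show (mnorm (isomLin γ x))⁻¹ • isomLin γ x = isomLin γ ((mnorm x)⁻¹ • x)
  rw [hn, map_smul]

lemma zeroExt_comp_lin {d : ℕ} (γ : HypIsom d) {f : Hyp d → ℝ} (hf : ∀ x, f (γ • x) = f x) :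
    zeroExt f ∘ isomLin γ = zeroExt f := by
  funext x
  show f (hypProj (isomLin γ x)) = f (hypProj x)
  by_cases hx : x ∈ futureCone d
  · rw [hypProj_lin γ hx, hf]
  · have hγ : isomLin γ x ∉ futureCone d := fun h => hx ((γ.2.2 x).1 h)
    rw [hypProj, hypProj, dif_neg hx, dif_neg hγ]

/-- The standard basis of Minkowski space. -/
def minkBasis (d : ℕ) : Fin d ⊕ Unit → Mink d :=
  Sum.elim (fun i => (EuclideanSpace.single i 1, 0)) (fun _ => (0, 1))

/-- The signs of the standard basis. -/
def minkSign (d : ℕ) : Fin d ⊕ Unit → ℝ := Sum.elim (fun _ => 1) (fun _ => -1)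

lemma mink_basis {d : ℕ} (i j : Fin d ⊕ Unit) :
    mink (minkBasis d i) (minkBasis d j) = Matrix.diagonal (minkSign d) i j := by
  rcases i with i | i <;> rcases j with j | j <;>
    simp [mink, minkBasis, minkSign, Matrix.diagonal_apply, EuclideanSpace.inner_single_left,
      PiLp.single_apply]

lemma mink_expand {d : ℕ} (x : Mink d) :
    x = ∑ j, (minkSign d j * mink (minkBasis d j) x) • minkBasis d j := by
  simp only [Fintype.sum_sum_type, minkSign, minkBasis, mink, Sum.elim_inl, Sum.elim_inr]
  refine Prod.ext ?_ ?_
  · ext i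
    simp [EuclideanSpace.inner_single_left, Prod.fst_sum, Pi.single_apply]
  · simp [Prod.snd_sum]

lemma mink_comm {d : ℕ} (x y : Mink d) : mink x y = mink y x := by
  simp only [mink, real_inner_comm, mul_comm]

/-- The trace of a bilinear form with respect to the Minkowski form is Lorentz invariant. -/
lemma trace_lin {d : ℕ} (γ : HypIsom d) (B : Mink d →L[ℝ] Mink d →L[ℝ] ℝ) :
    ∑ i, minkSign d i * B (isomLin γ (minkBasis d i)) (isomLin γ (minkBasis d i))
      = ∑ i, minkSign d i * B (minkBasis d i) (minkBasis d i) := by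
  classical
  set J : Matrix (Fin d ⊕ Unit) (Fin d ⊕ Unit) ℝ := Matrix.diagonal (minkSign d) with hJ
  set A : Matrix (Fin d ⊕ Unit) (Fin d ⊕ Unit) ℝ :=
    Matrix.of fun j i => minkSign d j * mink (minkBasis d j) (isomLin γ (minkBasis d i)) with hA
  have hsq : ∀ j, minkSign d j * minkSign d j = 1 := by
    rintro (j | j) <;> simp [minkSign]
  have hJJ : J * J = 1 := by
    rw [hJ, Matrix.diagonal_mul_diagonal]
    simp [hsq]
  have hexp : ∀ i, isomLin γ (minkBasis d i) = ∑ j, A j i • minkBasis d j := fun i => mink_expand _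
  have hlin : ∀ (s : Fin d ⊕ Unit → ℝ) (y : Mink d),
      mink (∑ j, s j • minkBasis d j) y = ∑ j, s j * mink (minkBasis d j) y := by
    intro s y
    simp only [mink, Prod.fst_sum, Prod.snd_sum, sum_inner, Finset.sum_mul, Prod.smul_fst,
      Prod.smul_snd, real_inner_smul_left, smul_eq_mul, mul_sub, Finset.sum_sub_distrib, mul_assoc]
  have hAJA : A.transpose * J * A = J := by
    ext i k
    have h1 : mink (isomLin γ (minkBasis d i)) (isomLin γ (minkBasis d k)) = J i k :=
      (γ.2.1 _ _).trans (mink_basis i k)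
    rw [← h1]
    conv_rhs => rw [hexp i, hlin]
    rw [Matrix.mul_apply]
    refine Finset.sum_congr rfl fun j _ => ?_
    rw [hJ, Matrix.mul_diagonal, Matrix.transpose_apply]
    simp only [hA, Matrix.of_apply]
    linear_combination (minkSign d j * mink (minkBasis d j) (isomLin γ (minkBasis d i)) *
      mink (minkBasis d j) (isomLin γ (minkBasis d k))) * hsq j
  have hinv : (J * A.transpose * J) * A = 1 := by
    rw [Matrix.mul_assoc, Matrix.mul_assoc, ← Matrix.mul_assoc A.transpose, hAJA, hJJ]
  have hinv' : A * J * A.transpose = J := by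
    have h2 := mul_eq_one_comm.1 hinv
    have h3 : (A * (J * A.transpose * J)) * J = J := by rw [h2, Matrix.one_mul]
    calc A * J * A.transpose = A * J * A.transpose * (J * J) := by rw [hJJ, Matrix.mul_one]
      _ = (A * (J * A.transpose * J)) * J := by simp only [Matrix.mul_assoc]
      _ = J := h3
  have hent : ∀ j k, ∑ i, minkSign d i * (A j i * A k i) = J j k := by
    intro j k
    rw [← hinv', Matrix.mul_apply]
    refine Finset.sum_congr rfl fun i _ => ?_
    rw [hJ, Matrix.mul_diagonal, Matrix.transpose_apply]
    ring
  calc ∑ i, minkSign d i * B (isomLin γ (minkBasis d i)) (isomLin γ (minkBasis d i))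
      = ∑ i, ∑ j, ∑ k, minkSign d i * (A j i * A k i) * B (minkBasis d j) (minkBasis d k) := by
        refine Finset.sum_congr rfl fun i _ => ?_
        rw [hexp i]
        simp only [map_sum, map_smul, sum_apply, smul_apply,
          smul_eq_mul, Finset.mul_sum]
        rw [Finset.sum_comm]
        refine Finset.sum_congr rfl fun j _ => Finset.sum_congr rfl fun k _ => ?_
        ring
    _ = ∑ j, ∑ k, (∑ i, minkSign d i * (A j i * A k i)) * B (minkBasis d j) (minkBasis d k) := by
        rw [Finset.sum_comm]
        refine Finset.sum_congr rfl fun j _ => ?_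
        rw [Finset.sum_comm]
        refine Finset.sum_congr rfl fun k _ => ?_
        rw [Finset.sum_mul]
    _ = ∑ i, minkSign d i * B (minkBasis d i) (minkBasis d i) := by
        refine Finset.sum_congr rfl fun j _ => ?_
        simp only [hent, hJ, Matrix.diagonal_apply, ite_mul, zero_mul, Finset.sum_ite_eq,
          Finset.mem_univ, if_true]

lemma wave_eq {d : ℕ} (F : Mink d → ℝ) (x : Mink d) :
    wave F x = ∑ i, minkSign d i * fderiv ℝ (fderiv ℝ F) x (minkBasis d i) (minkBasis d i) := by
  simp only [Fintype.sum_sum_type, minkSign, minkBasis, Sum.elim_inl, Sum.elim_inr, wave,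
    Finset.univ_unique, Finset.sum_singleton, one_mul]
  ring

lemma wave_lin {d : ℕ} (γ : HypIsom d) {F : Mink d → ℝ} (hF : F ∘ isomLin γ = F) {x : Mink d}
    (hd : DifferentiableAt ℝ (fderiv ℝ F) (isomLin γ x)) :
    wave F (isomLin γ x) = wave F x := by
  have h1 : fderiv ℝ F = fun y => (fderiv ℝ F (isomLin γ y)).comp (isomLin γ : Mink d →L[ℝ] Mink d) := by
    funext y
    conv_lhs => rw [← hF]
    exact (isomLin γ).comp_right_fderiv
  have h2 : ∀ v w, fderiv ℝ (fderiv ℝ F) x v w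
      = fderiv ℝ (fderiv ℝ F) (isomLin γ x) (isomLin γ v) (isomLin γ w) := by
    intro v w
    have hc : HasFDerivAt (fun y => fderiv ℝ F (isomLin γ y))
        ((fderiv ℝ (fderiv ℝ F) (isomLin γ x)).comp (isomLin γ : Mink d →L[ℝ] Mink d)) x :=
      hd.hasFDerivAt.comp x (isomLin γ).hasFDerivAt
    have hc2 := hc.clm_comp (hasFDerivAt_const (isomLin γ : Mink d →L[ℝ] Mink d) x)
    conv_lhs => rw [h1, hc2.fderiv]
    simp
  rw [wave_eq, wave_eq, ← trace_lin γ]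
  simp only [h2]

lemma contDiffOn_wave {d : ℕ} {F : Mink d → ℝ} (hF : ContDiffOn ℝ ∞ F (futureCone d)) :
    ContDiffOn ℝ ∞ (wave F) (futureCone d) := by
  have ho := isOpen_futureCone d
  have h1 : ContDiffOn ℝ ∞ (fderiv ℝ F) (futureCone d) := hF.fderiv_of_isOpen ho (by simp)
  have h2 : ContDiffOn ℝ ∞ (fderiv ℝ (fderiv ℝ F)) (futureCone d) :=
    h1.fderiv_of_isOpen ho (by simp)
  unfold wave
  refine ContDiffOn.sub (ContDiffOn.sum fun i _ => ?_) ?_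
  · exact (h2.clm_apply contDiffOn_const).clm_apply contDiffOn_const
  · exact (h2.clm_apply contDiffOn_const).clm_apply contDiffOn_const

lemma contDiffOn_normalize (d : ℕ) :
    ContDiffOn ℝ ∞ (fun x : Mink d => (mnorm x)⁻¹ • x) (futureCone d) := by
  have h1 : ContDiff ℝ ∞ fun x : Mink d => -mink x x := by
    unfold mink
    exact ((contDiff_fst.inner ℝ contDiff_fst).sub (contDiff_snd.mul contDiff_snd)).neg
  have h2 : ContDiffOn ℝ ∞ (fun x : Mink d => mnorm x) (futureCone d) :=
    h1.contDiffOn.sqrt fun x hx => by have := hx.1; linarith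
  exact (h2.inv fun x hx => (mnorm_pos hx).ne').smul contDiffOn_id

lemma IsSmoothHyp.lap {d : ℕ} {f : Hyp d → ℝ} (hf : IsSmoothHyp f) : IsSmoothHyp (lap f) := by
  have h1 : ContDiffOn ℝ ∞ (fun x : Mink d => wave (zeroExt f) ((mnorm x)⁻¹ • x)) (futureCone d) :=
    (contDiffOn_wave hf).comp (contDiffOn_normalize d)
      fun x hx => Hyp.mem_cone ⟨_, normalize_mem hx⟩
  refine h1.congr fun x hx => ?_
  show wave (zeroExt f) (hypProj x).1 = _
  rw [hypProj, dif_pos hx]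

lemma lap_smul {d : ℕ} (γ : HypIsom d) {f : Hyp d → ℝ} (hs : IsSmoothHyp f)
    (hf : ∀ x, f (γ • x) = f x) (x : Hyp d) : lap f (γ • x) = lap f x := by
  have ho := isOpen_futureCone d
  have h1 : ContDiffOn ℝ ∞ (fderiv ℝ (zeroExt f)) (futureCone d) :=
    ContDiffOn.fderiv_of_isOpen hs ho (by simp)
  have hm : isomLin γ (x : Mink d) ∈ futureCone d := (γ • x).mem_cone
  exact wave_lin γ (zeroExt_comp_lin γ hf)
    ((h1.differentiableOn (by simp)).differentiableAt (ho.mem_nhds hm))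

/-- The space `C^∞(ℍ^d / Γ)`. -/
def SmoothQuot {d : ℕ} (Γ : Subgroup (HypIsom d)) : Submodule ℝ (HypQuot Γ → ℝ) where
  carrier := {f | IsSmoothHyp (f ∘ covProj Γ)}
  zero_mem' := contDiffOn_const (c := (0 : ℝ))
  add_mem' hf hg := ContDiffOn.add hf hg
  smul_mem' c _ hf := contDiffOn_const (c := c) |>.smul hf

lemma lap_covProj {d : ℕ} {Γ : Subgroup (HypIsom d)} (f : SmoothQuot Γ) (γ : Γ) (x : Hyp d) :
    lap (f.1 ∘ covProj Γ) (γ • x) = lap (f.1 ∘ covProj Γ) x :=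
  lap_smul γ.1 f.2 (fun _ => congrArg f.1 (Quotient.sound ⟨γ, rfl⟩)) x

/-- The Laplace-Beltrami operator of `ℍ^d / Γ` on smooth functions: `(Δ f) ∘ P = Δ (f ∘ P)` for the
covering projection `P`. -/
def lapQuot {d : ℕ} {Γ : Subgroup (HypIsom d)} (f : SmoothQuot Γ) : SmoothQuot Γ :=
  ⟨Quotient.lift (lap (f.1 ∘ covProj Γ)) (by
    rintro _ b ⟨γ, rfl⟩
    exact lap_covProj f γ b), f.2.lap⟩

/-- A distribution on the compact manifold `ℍ^d / Γ`: a linear functional on `C^∞(ℍ^d / Γ)` that is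
continuous for the `C^∞` topology, i.e. bounded by finitely many derivatives on a compact set. -/
structure QuotDistribution {d : ℕ} (Γ : Subgroup (HypIsom d)) where
  toLin : SmoothQuot Γ →ₗ[ℝ] ℝ
  bound : ∃ (K : Set (Hyp d)) (N : ℕ) (C : ℝ), IsCompact K ∧ ∀ (f : SmoothQuot Γ) (b : ℝ),
    (∀ x ∈ K, ∀ n ≤ N, ‖iteratedFDeriv ℝ n (zeroExt (f.1 ∘ covProj Γ)) (x : Mink d)‖ ≤ b) →
      |toLin f| ≤ C * b

/-- `T` solves `(1/d) Δ T - T = μ'` in the sense of distributions on `ℍ^d / Γ`. -/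
def IsSolution {d : ℕ} {Γ : Subgroup (HypIsom d)} (μ' : Measure (HypQuot Γ))
    (T : QuotDistribution Γ) : Prop :=
  ∀ f : SmoothQuot Γ, T.toLin ((1 / (d : ℝ)) • lapQuot f - f) = ∫ m, f.1 m ∂μ'

/-! ## The explicit solution -/

/-- `k(ρ) = (cosh ρ / v_{d-1}) ∫_{+∞}^ρ dt / (sinh^{d-1} t cosh² t)`, where `v_{d-1}` is the area of
the unit sphere of `ℝ^d`. -/
def radialKernel (d : ℕ) (ρ : ℝ) : ℝ :=
  Real.cosh ρ / (volume : Measure (EuclideanSpace ℝ (Fin d))).toSphere.real univ *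
    -∫ t in Ioi ρ, 1 / (Real.sinh t ^ (d - 1) * Real.cosh t ^ 2)

/-- The kernel `G(x, y)`. -/
def greenKernel {d : ℕ} (x y : Hyp d) : ℝ := radialKernel d (hypDist x y)

/-- `h_f(x) = d ∫ G(x, y) f(y) dℍ^d(y)`. -/
def greenPotential {d : ℕ} (f : Hyp d → ℝ) (x : Hyp d) : ℝ :=
  d * ∫ y, greenKernel x y * f y ∂(hypVol d)

/-- `μ` is the pull-back to `ℍ^d` of the measure `μ'` on `ℍ^d / Γ`: `μ(A) = μ'(P(A))` for each Borel
set `A` on which the covering projection `P` is injective. -/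
def IsPullback {d : ℕ} {Γ : Subgroup (HypIsom d)} (μ' : Measure (HypQuot Γ))
    (μ : Measure (Hyp d)) : Prop :=
  ∀ A : Set (Hyp d), MeasurableSet A → InjOn (covProj Γ) A → μ A = μ' (covProj Γ '' A)

/-- `T` is the push-forward to `ℍ^d / Γ` of the `Γ`-invariant distribution `h_μ` on `ℍ^d` given by
`(h_μ, f) = ∫ h_f dμ`: if `f'` on `ℍ^d / Γ` is the sum over the fibres of a test function `f`
on `ℍ^d` (when the covering projection is injective near the support of `f`, this means that
`f` is the lift of `f'` to that sheet), then `(T, f') = (h_μ, f)`. -/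
def IsGreenPushforward {d : ℕ} {Γ : Subgroup (HypIsom d)} (μ : Measure (Hyp d))
    (T : QuotDistribution Γ) : Prop :=
  ∀ f : Hyp d → ℝ, IsTest f →
    (∀ x, Integrable (fun y => greenKernel x y * f y) (hypVol d)) ∧
    Integrable (greenPotential f) μ ∧
    ∀ f' : SmoothQuot Γ, (∀ x, f'.1 (covProj Γ x) = ∑ᶠ γ : Γ, f (γ • x)) →
      T.toLin f' = ∫ x, greenPotential f x ∂μ

/-! ## F-convex sets and area measures -/

/-- F-convex sets: proper closed convex sets that are intersections of future sides of space-like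
hyperplanes, and for which each future time-like vector is a support vector. -/
structure IsFConvex {d : ℕ} (K : Set (Mink d)) : Prop where
  proper : K ≠ univ
  closed : IsClosed K
  convex : Convex ℝ K
  inter : ∃ S : Set (Mink d × ℝ), (∀ p ∈ S, p.1 ∈ futureCone d) ∧
    K = {x | ∀ p ∈ S, mink x p.1 ≤ p.2}
  support : ∀ η ∈ futureCone d, ∃ α : ℝ, (∀ k ∈ K, mink η k ≤ α) ∧ ∃ k ∈ K, mink η k = α

/-- `τ`-F-convex sets: F-convex sets that are setwise invariant under the affine isometries
`x ↦ γ x + τ_γ`. -/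
def IsTauFConvex {d : ℕ} {Γ : Subgroup (HypIsom d)} (τ : Γ → Mink d) (K : Set (Mink d)) : Prop :=
  IsFConvex K ∧ ∀ γ : Γ, (fun x => isomLin γ.1 x + τ γ) '' K = K

/-- `r` is the orthogonal projection of `k ∈ K` onto `∂K`: the point of `∂K` in the closure of the
past cone of `k` that maximizes the Lorentzian distance to `k`. -/
def IsOrthProj {d : ℕ} (K : Set (Mink d)) (k r : Mink d) : Prop :=
  (r ∈ frontier K ∧ k - r ∈ closure (futureCone d)) ∧
    ∀ r' ∈ frontier K, k - r' ∈ closure (futureCone d) → mnorm (k - r') ≤ mnorm (k - r)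

/-- The set `K_{(0,ε]}(A)` of the points `k` of `K` whose cosmological time `T(k) = ‖k - r(k)‖₋` is in
`(0, ε]` and whose normal `N(k) = (k - r(k)) / T(k)` is in `A`. -/
def brush {d : ℕ} (K : Set (Mink d)) (ε : ℝ) (A : Set (Hyp d)) : Set (Mink d) :=
  {k | k ∈ K ∧ ∃ r, IsOrthProj K k r ∧ 0 < mnorm (k - r) ∧ mnorm (k - r) ≤ ε ∧
    ∃ η ∈ A, (η : Mink d) = (mnorm (k - r))⁻¹ • (k - r)}

/-- `S 0, …, S d` are the area measures of `K`: Radon measures on `ℍ^d` such that, for all Borel sets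
`A` and all `ε > 0`, with `V` the Lebesgue measure,
`V(K_{(0,ε]}(A)) = (1 / (d+1)) ∑_{i=0}^d ε^{d+1-i} binom(d+1, i) S_i(A)`. -/
def IsAreaMeasures {d : ℕ} (K : Set (Mink d)) (S : Fin (d + 1) → Measure (Hyp d)) : Prop :=
  (∀ i, IsFiniteMeasureOnCompacts (S i)) ∧
    ∀ A : Set (Hyp d), MeasurableSet A → ∀ ε : ℝ, 0 < ε →
      volume (brush K ε A) = ((d : ℝ≥0∞) + 1)⁻¹ *
        ∑ i : Fin (d + 1), ENNReal.ofReal ε ^ (d + 1 - (i : ℕ)) *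
          ((d + 1).choose i : ℝ≥0∞) * S i A

/-- `μ` is the first area measure of `K`. -/
def IsFirstAreaMeasure {d : ℕ} (K : Set (Mink d)) (μ : Measure (Hyp d)) : Prop :=
  ∃ S : Fin (d + 1) → Measure (Hyp d), IsAreaMeasures K S ∧
    ∃ i : Fin (d + 1), (i : ℕ) = 1 ∧ S i = μ

end

/-! ## Minkowski geometry -/

section Geometry

variable {d : ℕ}

/-! All three statements reduce to the operator L = (1/d)Δ - 1 on ℍ^d and to an explicit inverse of
it on bounded functions.

Green representation. For a function R of s = -⟨x, y⟩₋ = cosh d(x, y), the Laplacian is (s² - 1)R''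
+ d s R' (`lap_radial`). Thus R = s solves L R = 0, and reduction of order gives the second solution
-s ∫_s^∞ w, which is the Green kernel. Replacing w by θ w, with a smooth cut-off θ compactly
supported in (1, ∞), gives a test function whose image under L is (1/d) θ' times an explicit density
(`IsCut.lap_kernel`). If θ rises near 1 and falls near infinity, this is a difference of two radial
averages about x: an inner one whose mass tends to 1 while it shrinks to x, and an outer one of mass
at most 1/m (`IsStep.mass`). Testing a weak equation L u = g with this kernel and letting the inner
scale tend to 0 expresses u(x) as an outer mean plus a truncated potential of g (`IsWeakSol.repr`).
If u is bounded the outer mean disappears as m → ∞, so u is the Green potential of g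
(`IsWeakSol.eq_green`). The case u = 1, where L 1 = -1, bounds the L¹ norm of the Green kernel by
1/d. The same representation shows that continuous weak solutions with smooth right-hand side are
smooth, because both of its terms depend smoothly on x.

Parts (1) and (2). On a cocompact quotient invariant continuous functions are bounded, so L is a
bijection of C^∞(ℍ^d/Γ) whose inverse is the Green potential (`quotPotential_lap`, `exists_lap_eq`).
A distributional solution for μ' is therefore f ↦ ∫ h_f dμ' and nothing else; unfolding the integral
over the Γ-orbits turns this into the formula upstairs. Two τ-equivariant functions differ by an
invariant, hence bounded, function; if their S₁ agree this difference satisfies L w = 0, so it is 0.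

Part (3). It suffices to show that S₁ of the support function h of K is a universal constant times
the first area measure (`exists_S1_suppHyp_eq`), since part (2) then identifies the support
functions, and these determine the sets. Rescale K to sK with s → 0. Let T_s(x) be the minimum over
ℍ^d of η ↦ s h(η) - ⟨x, η⟩₋, and N_s(x) the minimizer; these are the cosmological time and the
normal of sK at x. For a weight φ and a test function f, the integral of φ(T_s) f(N_s) is computed
twice. By the definition of the area measures it is a polynomial in s, whose coefficient of s is a
moment of φ times ∫ f dS₁ (`integral_steiner`). Its derivative at s = 0, where T_0 = ‖x‖₋ and N_0 =
x/‖x‖₋, is a multiple of ∫ h (Δf - d f) (`MinField.tendsto_integral`).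

In that derivative h is only continuous, so N_s cannot be differentiated in s. Two facts replace
this. Minimality gives |N_s - N_0|² = o(s), so second-order Taylor remainders are negligible. And
the Minkowski gradient of T_s is -N_s, so the first-order term in N_s - N_0 is a product of
gradients, which Green's formula moves onto f. After that only (T_s - T_0)/s → h is needed. -/

lemma mink_add_left (x y z : Mink d) : mink (x + y) z = mink x z + mink y z := by
  simp only [mink, Prod.fst_add, Prod.snd_add, inner_add_left]; ring

lemma mink_add_right (x y z : Mink d) : mink x (y + z) = mink x y + mink x z := by
  simp only [mink, Prod.fst_add, Prod.snd_add, inner_add_right]; ring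

lemma mink_smul_left (a : ℝ) (x y : Mink d) : mink (a • x) y = a * mink x y := by
  simpa using mink_smul_smul a 1 x y

lemma mink_smul_right (a : ℝ) (x y : Mink d) : mink x (a • y) = a * mink x y := by
  simpa using mink_smul_smul 1 a x y

lemma mink_neg_left (x y : Mink d) : mink (-x) y = -mink x y := by
  simpa using mink_smul_left (-1) x y

lemma mink_neg_right (x y : Mink d) : mink x (-y) = -mink x y := by
  simpa using mink_smul_right (-1) x y

lemma mink_sub_left (x y z : Mink d) : mink (x - y) z = mink x z - mink y z := by
  rw [sub_eq_add_neg, mink_add_left, mink_neg_left, sub_eq_add_neg]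

lemma mink_sub_right (x y z : Mink d) : mink x (y - z) = mink x y - mink x z := by
  rw [sub_eq_add_neg, mink_add_right, mink_neg_right, sub_eq_add_neg]

lemma contDiff_mink : ContDiff ℝ ∞ fun p : Mink d × Mink d => mink p.1 p.2 := by
  unfold mink
  exact ((contDiff_fst.comp contDiff_fst).inner ℝ (contDiff_fst.comp contDiff_snd)).sub
    ((contDiff_snd.comp contDiff_fst).mul (contDiff_snd.comp contDiff_snd))

lemma continuous_mink : Continuous fun p : Mink d × Mink d => mink p.1 p.2 :=
  contDiff_mink.continuous

/-- The Minkowski form as a continuous bilinear map. -/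
noncomputable def minkL (d : ℕ) : Mink d →L[ℝ] Mink d →L[ℝ] ℝ :=
  LinearMap.toContinuousLinearMap
    { toFun := fun x => LinearMap.toContinuousLinearMap
        { toFun := fun y => mink x y
          map_add' := fun y z => mink_add_right x y z
          map_smul' := fun a y => mink_smul_right a x y }
      map_add' := fun x y => by ext <;> simp [mink_add_left]
      map_smul' := fun a x => by ext <;> simp [mink_smul_left] }

@[simp] lemma minkL_apply (x y : Mink d) : minkL d x y = mink x y := rfl

lemma abs_mink_le (x y : Mink d) : |mink x y| ≤ 2 * ‖x‖ * ‖y‖ := by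
  have h1 : |inner ℝ x.1 y.1| ≤ ‖x‖ * ‖y‖ :=
    (abs_real_inner_le_norm _ _).trans
      (mul_le_mul (norm_fst_le x) (norm_fst_le y) (norm_nonneg _) (norm_nonneg _))
  have h2 : |x.2 * y.2| ≤ ‖x‖ * ‖y‖ := by
    rw [abs_mul]
    exact mul_le_mul (norm_snd_le x) (norm_snd_le y) (abs_nonneg _) (norm_nonneg _)
  calc |mink x y| ≤ |inner ℝ x.1 y.1| + |x.2 * y.2| := abs_sub _ _
    _ ≤ 2 * ‖x‖ * ‖y‖ := by linarith

lemma mem_futureCone {x : Mink d} : x ∈ futureCone d ↔ ‖x.1‖ < x.2 := by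
  simp only [futureCone, mem_ofPred_eq, mink, real_inner_self_eq_norm_sq]
  constructor
  · rintro ⟨h1, h2⟩
    nlinarith [norm_nonneg x.1]
  · intro h
    have := norm_nonneg x.1
    exact ⟨by nlinarith, by linarith⟩

lemma closure_futureCone : closure (futureCone d) = {x | ‖x.1‖ ≤ x.2} := by
  apply subset_antisymm
  · refine closure_minimal (fun x hx => (mem_futureCone.1 hx).le) ?_
    exact isClosed_le (by fun_prop) (by fun_prop)
  · intro x hx
    have h : Filter.Tendsto (fun t : ℝ => (x.1, x.2 + t)) (𝓝[>] 0) (𝓝 x) := by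
      have : Continuous fun t : ℝ => (x.1, x.2 + t) := by fun_prop
      simpa using (this.tendsto 0).mono_left nhdsWithin_le_nhds
    refine mem_closure_of_tendsto h ?_
    filter_upwards [self_mem_nhdsWithin] with t ht
    rw [mem_futureCone]
    have : ‖x.1‖ ≤ x.2 := hx
    have ht : (0 : ℝ) < t := ht
    show ‖x.1‖ < x.2 + t
    linarith

lemma smul_mem_futureCone {x : Mink d} (hx : x ∈ futureCone d) {t : ℝ} (ht : 0 < t) :
    t • x ∈ futureCone d := by
  rw [mem_futureCone] at *
  simp only [Prod.smul_fst, norm_smul, Real.norm_eq_abs, abs_of_pos ht, Prod.smul_snd, smul_eq_mul]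
  exact mul_lt_mul_of_pos_left hx ht

lemma add_mem_futureCone {x y : Mink d} (hx : x ∈ futureCone d) (hy : ‖y.1‖ ≤ y.2) :
    x + y ∈ futureCone d := by
  rw [mem_futureCone] at *
  have := norm_add_le x.1 y.1
  simp only [Prod.fst_add, Prod.snd_add]
  linarith

lemma convex_futureCone : Convex ℝ (futureCone d) := by
  intro x hx y hy a b ha hb hab
  rcases ha.eq_or_lt with rfl | ha
  · rw [show b = 1 by linarith]; simpa using hy
  · refine add_mem_futureCone (smul_mem_futureCone hx ha) ?_
    rw [mem_futureCone] at hy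
    simp only [Prod.smul_fst, norm_smul, Real.norm_eq_abs, abs_of_nonneg hb, Prod.smul_snd,
      smul_eq_mul]
    exact mul_le_mul_of_nonneg_left hy.le hb

lemma mnorm_smul (x : Mink d) {t : ℝ} (ht : 0 ≤ t) : mnorm (t • x) = t * mnorm x := by
  unfold mnorm
  rw [mink_smul_smul, show -(t * t * mink x x) = t ^ 2 * -mink x x by ring,
    Real.sqrt_mul (sq_nonneg t), Real.sqrt_sq ht]

lemma mnorm_sq {x : Mink d} (hx : x ∈ futureCone d) : mnorm x ^ 2 = -mink x x :=
  Real.sq_sqrt (by have := hx.1; linarith)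

@[simp] lemma Hyp.mnorm_eq (x : Hyp d) : mnorm (x : Mink d) = 1 := by
  simp [mnorm, x.2.1]

lemma hypProj_coe {x : Mink d} (hx : x ∈ futureCone d) :
    (hypProj x : Mink d) = (mnorm x)⁻¹ • x := by
  rw [hypProj, dif_pos hx]

lemma mnorm_smul_hypProj {x : Mink d} (hx : x ∈ futureCone d) :
    mnorm x • (hypProj x : Mink d) = x := by
  rw [hypProj_coe hx, smul_smul, mul_inv_cancel₀ (mnorm_pos hx).ne', one_smul]

@[simp] lemma hypProj_hyp (x : Hyp d) : hypProj (x : Mink d) = x := by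
  apply Subtype.ext
  rw [hypProj_coe x.mem_cone]; simp

lemma hypProj_smul {x : Mink d} (hx : x ∈ futureCone d) {t : ℝ} (ht : 0 < t) :
    hypProj (t • x) = hypProj x := by
  apply Subtype.ext
  rw [hypProj_coe hx, hypProj_coe (smul_mem_futureCone hx ht), mnorm_smul x ht.le, smul_smul,
    mul_inv, mul_comm t⁻¹, mul_assoc, inv_mul_cancel₀ ht.ne', mul_one]

@[simp] lemma zeroExt_hyp (f : Hyp d → ℝ) (x : Hyp d) : zeroExt f x = f x := by simp [zeroExt]

@[simp] lemma oneExt_hyp (f : Hyp d → ℝ) (x : Hyp d) : oneExt f x = f x := by simp [oneExt]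

/-- The reverse Cauchy-Schwarz inequality for causal vectors. -/
lemma mnorm_mul_le {x y : Mink d} (hx : ‖x.1‖ ≤ x.2) (hy : ‖y.1‖ ≤ y.2) :
    mnorm x * mnorm y ≤ -mink x y := by
  have hx0 := norm_nonneg x.1
  have hy0 := norm_nonneg y.1
  have hcs := real_inner_le_norm x.1 y.1
  have h0 : 0 ≤ x.2 * y.2 - ‖x.1‖ * ‖y.1‖ := by
    nlinarith [mul_le_mul hx hy hy0 (hx0.trans hx)]
  have h : x.2 * y.2 - ‖x.1‖ * ‖y.1‖ ≤ -mink x y := by simp only [mink]; linarith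
  refine le_trans ?_ h
  have e : ∀ z : Mink d, -mink z z = z.2 ^ 2 - ‖z.1‖ ^ 2 := by
    intro z; simp only [mink, real_inner_self_eq_norm_sq]; ring
  unfold mnorm
  rw [e, e, ← Real.sqrt_mul (by nlinarith)]
  apply Real.sqrt_le_iff.2 ⟨h0, ?_⟩
  nlinarith [sq_nonneg (x.2 * ‖y.1‖ - y.2 * ‖x.1‖)]

lemma Hyp.fst_lt (x : Hyp d) : ‖x.1.1‖ < x.1.2 := mem_futureCone.1 x.mem_cone

lemma Hyp.one_le (x y : Hyp d) : 1 ≤ -mink (x : Mink d) y := by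
  simpa using mnorm_mul_le x.fst_lt.le y.fst_lt.le

lemma Hyp.sq_eq (x : Hyp d) : x.1.2 ^ 2 = 1 + ‖x.1.1‖ ^ 2 := by
  have := x.2.1
  simp only [mink, real_inner_self_eq_norm_sq] at this
  linarith

lemma Hyp.snd_eq (x : Hyp d) : x.1.2 = Real.sqrt (1 + ‖x.1.1‖ ^ 2) := by
  rw [← x.sq_eq, Real.sqrt_sq x.2.2.le]

lemma Hyp.one_le_snd (x : Hyp d) : 1 ≤ x.1.2 := by
  have := x.sq_eq
  nlinarith [x.2.2, sq_nonneg ‖x.1.1‖]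

lemma Hyp.norm_eq (x : Hyp d) : ‖(x : Mink d)‖ = x.1.2 := by
  rw [Prod.norm_def, Real.norm_eq_abs, abs_of_pos x.2.2, max_eq_right x.fst_lt.le]

/-- Here -⟨x, y⟩₋ - 1 is half the Lorentzian square |a - b|² - (x.2 - y.2)² of x - y. Since (x.2)² -
|a|² = 1 = (y.2)² - |b|², the time difference is at most |a - b| (|a| + |b|)/(x.2 + y.2), and (x.2 +
y.2)² exceeds (|a| + |b|)² by at least 4, so a definite fraction of |a - b|² survives. This converts
every estimate on the form into one in norm. -/
lemma Hyp.norm_sub_sq_le (x y : Hyp d) :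
    ‖(x : Mink d) - y‖ ^ 2 ≤ (x.1.2 + y.1.2) ^ 2 / 2 * (-mink (x : Mink d) y - 1) := by
  set a := x.1.1
  set b := y.1.1
  have hx := x.sq_eq
  have hy := y.sq_eq
  have hx0 := x.2.2
  have hy0 := y.2.2
  have ha := norm_nonneg x.1.1
  have hb := norm_nonneg y.1.1
  have hab : |‖x.1.1‖ - ‖y.1.1‖| ≤ ‖x.1.1 - y.1.1‖ := abs_norm_sub_norm_le _ _
  have hn := norm_nonneg (x.1.1 - y.1.1)
  have hxy : 1 ≤ x.1.2 * y.1.2 - ‖x.1.1‖ * ‖y.1.1‖ := by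
    have h0 : 0 ≤ x.1.2 * y.1.2 - ‖x.1.1‖ * ‖y.1.1‖ := by
      nlinarith [mul_le_mul x.fst_lt.le y.fst_lt.le hb hx0.le]
    have : (x.1.2 * y.1.2) ^ 2 = (1 + ‖x.1.1‖ ^ 2) * (1 + ‖y.1.1‖ ^ 2) := by rw [mul_pow, hx, hy]
    have h2 : (1 + ‖x.1.1‖ * ‖y.1.1‖) ^ 2 ≤ (x.1.2 * y.1.2) ^ 2 := by
      rw [this]; nlinarith [sq_nonneg (‖x.1.1‖ - ‖y.1.1‖)]
    have := abs_le_of_sq_le_sq' h2 (by positivity)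
    linarith [this.2]
  have hD : (x.1.2 - y.1.2) * (x.1.2 + y.1.2)
      = (‖x.1.1‖ - ‖y.1.1‖) * (‖x.1.1‖ + ‖y.1.1‖) := by linear_combination hx - hy
  have hsq : (‖x.1.1‖ - ‖y.1.1‖) ^ 2 ≤ ‖x.1.1 - y.1.1‖ ^ 2 := sq_le_sq' (by
    linarith [(abs_le.1 hab).1]) (abs_le.1 hab).2
  have hm : -mink (x : Mink d) y - 1 = (‖x.1.1 - y.1.1‖ ^ 2 - (x.1.2 - y.1.2) ^ 2) / 2 := by
    simp only [mink, @norm_sub_sq ℝ, RCLike.re_to_real]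
    nlinarith
  have hS : 4 ≤ (x.1.2 + y.1.2) ^ 2 - (‖x.1.1‖ + ‖y.1.1‖) ^ 2 := by nlinarith
  have hle : (x.1.2 - y.1.2) ^ 2 * (x.1.2 + y.1.2) ^ 2
      ≤ ‖x.1.1 - y.1.1‖ ^ 2 * (‖x.1.1‖ + ‖y.1.1‖) ^ 2 := by
    rw [← mul_pow, hD, mul_pow]
    exact mul_le_mul_of_nonneg_right hsq (sq_nonneg _)
  have hfst : ‖(x : Mink d) - y‖ = ‖x.1.1 - y.1.1‖ := by
    rw [Prod.norm_def]
    apply max_eq_left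
    show |x.1.2 - y.1.2| ≤ _
    apply abs_le_of_sq_le_sq _ hn
    have : 0 < (x.1.2 + y.1.2) ^ 2 := by positivity
    refine le_of_mul_le_mul_right (hle.trans ?_) this
    apply mul_le_mul_of_nonneg_left _ (sq_nonneg _)
    linarith
  rw [hfst, hm]
  nlinarith [sq_nonneg ‖x.1.1 - y.1.1‖, mul_le_mul_of_nonneg_left hS (sq_nonneg ‖x.1.1 - y.1.1‖)]

lemma Hyp.eq_of_mink {x y : Hyp d} (h : -mink (x : Mink d) y ≤ 1) : x = y := by
  have h1 := x.norm_sub_sq_le y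
  have h2 := x.one_le y
  rw [show -mink (x : Mink d) y - 1 = 0 by linarith, mul_zero] at h1
  apply Subtype.ext
  exact sub_eq_zero.1 (norm_eq_zero.1 (pow_eq_zero_iff two_ne_zero |>.1 (le_antisymm h1 (sq_nonneg _))))

/-- For x in the open cone the factor on the left is positive, so -⟨x, y⟩₋ controls the height of y;
all later compactness and coercivity in ℍ^d comes from this. -/
lemma snd_le_of_mink (x : Mink d) {y : Mink d} (hy : ‖y.1‖ ≤ y.2) :
    (x.2 - ‖x.1‖) * y.2 ≤ -mink x y := by
  have hcs := real_inner_le_norm x.1 y.1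
  have := mul_le_mul_of_nonneg_left hy (norm_nonneg x.1)
  simp only [mink]
  nlinarith

/-! ## Topology of hyperbolic space -/

lemma isClosed_hyp : IsClosed {x : Mink d | mink x x = -1 ∧ 0 < x.2} := by
  have : {x : Mink d | mink x x = -1 ∧ 0 < x.2} = {x | mink x x = -1} ∩ {x | 1 ≤ x.2} := by
    ext x
    constructor
    · intro h
      exact ⟨h.1, Hyp.one_le_snd ⟨x, h⟩⟩
    · intro h
      exact ⟨h.1, lt_of_lt_of_le one_pos h.2⟩
  rw [this]
  have h1 : Continuous fun x : Mink d => mink x x := continuous_mink.comp (continuous_id.prodMk continuous_id)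
  exact (isClosed_eq h1 continuous_const).inter (isClosed_le continuous_const continuous_snd)

instance : ProperSpace (Hyp d) :=
  ProperSpace.of_isClosed isClosed_hyp

lemma isCompact_hyp_le (x : Hyp d) (S : ℝ) : IsCompact {y : Hyp d | -mink (x : Mink d) y ≤ S} := by
  have hp : 0 < x.1.2 - ‖x.1.1‖ := sub_pos.2 x.fst_lt
  refine (isClosed_hyp.isClosedEmbedding_subtypeVal.isCompact_preimage
    (isCompact_closedBall (0 : Mink d) (S / (x.1.2 - ‖x.1.1‖)))).of_isClosed_subset ?_ ?_
  · exact isClosed_le ((continuous_mink.comp (continuous_const.prodMk continuous_subtype_val)).neg)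
      continuous_const
  · intro y hy
    simp only [mem_preimage, mem_closedBall_zero_iff]
    rw [Hyp.norm_eq y, le_div_iff₀ hp, mul_comm]
    exact (snd_le_of_mink x (Hyp.fst_lt y).le).trans hy

/-- The parametrisation `hypGraph` as a homeomorphism. -/
noncomputable def hypHomeo (d : ℕ) : EuclideanSpace ℝ (Fin d) ≃ₜ Hyp d where
  toFun := hypGraph
  invFun x := x.1.1
  left_inv _ := rfl
  right_inv x := Subtype.ext (Prod.ext rfl x.snd_eq.symm)
  continuous_toFun := by
    refine Continuous.subtype_mk ?_ _
    fun_prop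
  continuous_invFun := by fun_prop

lemma continuous_hypGraph : Continuous (hypGraph : EuclideanSpace ℝ (Fin d) → Hyp d) :=
  (hypHomeo d).continuous

lemma contDiff_hypGraph :
    ContDiff ℝ ∞ fun v : EuclideanSpace ℝ (Fin d) => (hypGraph v : Mink d) := by
  refine contDiff_id.prodMk ?_
  refine ContDiff.sqrt (contDiff_const.add (contDiff_norm_sq ℝ)) fun v => ?_
  positivity

lemma contDiffOn_mnorm : ContDiffOn ℝ ∞ (fun x : Mink d => mnorm x) (futureCone d) := by
  have h1 : ContDiff ℝ ∞ fun x : Mink d => -mink x x :=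
    (contDiff_mink.comp (contDiff_id.prodMk contDiff_id)).neg
  exact h1.contDiffOn.sqrt fun x hx => by have := hx.1; linarith

lemma continuous_mnorm : Continuous (mnorm : Mink d → ℝ) :=
  ((continuous_mink.comp (continuous_id.prodMk continuous_id)).neg).sqrt

lemma contDiffOn_hypProj :
    ContDiffOn ℝ ∞ (fun x : Mink d => (hypProj x : Mink d)) (futureCone d) :=
  (contDiffOn_normalize d).congr fun _ hx => hypProj_coe hx

lemma continuousOn_hypProj : ContinuousOn (hypProj : Mink d → Hyp d) (futureCone d) := by
  refine (Topology.IsInducing.continuousOn_iff (g := (Subtype.val : Hyp d → Mink d))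
    Topology.IsInducing.subtypeVal).2 ?_
  exact contDiffOn_hypProj.continuousOn

lemma IsSmoothHyp.continuous {f : Hyp d → ℝ} (hf : IsSmoothHyp f) : Continuous f := by
  have : f = fun x : Hyp d => zeroExt f x := by ext; simp
  rw [this]
  have h : ContinuousOn (zeroExt f) (futureCone d) := ContDiffOn.continuousOn hf
  exact h.comp_continuous continuous_subtype_val fun x => x.mem_cone

lemma continuousOn_zeroExt {f : Hyp d → ℝ} (hf : Continuous f) :
    ContinuousOn (zeroExt f) (futureCone d) :=
  hf.comp_continuousOn continuousOn_hypProj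

/-- A function that is smooth near `ℍ^d` restricts to a smooth function. -/
lemma isSmoothHyp_of_contDiffOn {F : Mink d → ℝ} (hF : ContDiffOn ℝ ∞ F (futureCone d)) :
    IsSmoothHyp fun x : Hyp d => F x :=
  hF.comp contDiffOn_hypProj fun x _ => (hypProj x).mem_cone

lemma mink_smul_hyp (γ : HypIsom d) (x y : Hyp d) :
    mink ((γ • x : Hyp d) : Mink d) (γ • y : Hyp d) = mink (x : Mink d) y := γ.2.1 x y

instance : ContinuousConstSMul (HypIsom d) (Hyp d) where
  continuous_const_smul γ := by
    refine Continuous.subtype_mk ?_ _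
    exact (isomLin γ).continuous.comp continuous_subtype_val

lemma continuous_hyp_smul (γ : HypIsom d) : Continuous fun x : Hyp d => γ • x :=
  continuous_const_smul γ

/-! ## Point reflections -/

lemma refl_aux {q : Mink d} (hq : q ∈ futureCone d) (x y : Mink d) :
    mink (-x + (2 * mink x q / mink q q) • q) (-y + (2 * mink y q / mink q q) • q) = mink x y := by
  have hne : mink q q ≠ 0 := hq.1.ne
  simp only [mink_add_left, mink_add_right, mink_neg_left, mink_neg_right, mink_smul_left,
    mink_smul_right, mink_comm q y]
  field_simp
  ring

lemma refl_refl {q : Mink d} (hq : q ∈ futureCone d) (x : Mink d) :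
    -(-x + (2 * mink x q / mink q q) • q)
      + (2 * mink (-x + (2 * mink x q / mink q q) • q) q / mink q q) • q = x := by
  have hne : mink q q ≠ 0 := hq.1.ne
  have h : mink (-x + (2 * mink x q / mink q q) • q) q = mink x q := by
    simp only [mink_add_left, mink_neg_left, mink_smul_left]
    field_simp
    ring
  rw [h]
  abel

/-- Were x past-directed, -x would be in the cone and the reverse Cauchy-Schwarz inequality would
give the opposite sign of ⟨x, z⟩₋. -/
lemma snd_pos_of_mink {x z : Mink d} (hx : mink x x < 0) (hz : z ∈ futureCone d)
    (hxz : mink x z < 0) : 0 < x.2 := by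
  by_contra hcon
  have h0 : mink (-x) (-x) < 0 := by rw [mink_neg_left, mink_neg_right, neg_neg]; exact hx
  have hne : x.2 ≠ 0 := by
    intro h
    have : 0 ≤ mink x x := by
      simp only [mink, real_inner_self_eq_norm_sq, h, mul_zero, sub_zero]; positivity
    linarith
  have hF : -x ∈ futureCone d := ⟨h0, by
    have := lt_of_le_of_ne (not_lt.1 hcon) hne
    simpa using this⟩
  have h1 := mnorm_mul_le (mem_futureCone.1 hF).le (mem_futureCone.1 hz).le
  have h2 := mul_pos (mnorm_pos hF) (mnorm_pos hz)
  rw [mink_neg_left] at h1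
  linarith

/-- The reflection `x ↦ -x + 2 ⟨x, q⟩₋ / ⟨q, q⟩₋ q` in a future time-like vector `q`: the point
symmetry of `ℍ^d` about the direction of `q`. -/
noncomputable def pointRefl (q : Mink d) (hq : q ∈ futureCone d) : HypIsom d :=
  ⟨ContinuousLinearEquiv.equivOfInverse
      (-(ContinuousLinearMap.id ℝ (Mink d)) +
        ((2 / mink q q) • minkL d q).smulRight q)
      (-(ContinuousLinearMap.id ℝ (Mink d)) +
        ((2 / mink q q) • minkL d q).smulRight q)
      (fun x => by
        convert refl_refl hq x using 2
        all_goals simp [mink_comm q]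
        all_goals ring_nf)
      (fun x => by
        convert refl_refl hq x using 2
        all_goals simp [mink_comm q]
        all_goals ring_nf), by
    have key : ∀ x : Mink d, (-(ContinuousLinearMap.id ℝ (Mink d)) +
        ((2 / mink q q) • minkL d q).smulRight q) x = -x + (2 * mink x q / mink q q) • q := by
      intro x
      simp only [add_apply, neg_apply, ContinuousLinearMap.id_apply,
        ContinuousLinearMap.smulRight_apply, smul_apply, minkL_apply, smul_eq_mul, mink_comm q]
      ring_nf
    have hF : ∀ x ∈ futureCone d, -x + (2 * mink x q / mink q q) • q ∈ futureCone d := by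
      intro x hx
      have h1 : mink (-x + (2 * mink x q / mink q q) • q) (-x + (2 * mink x q / mink q q) • q) < 0 := by
        rw [refl_aux hq]; exact hx.1
      refine ⟨h1, snd_pos_of_mink h1 hq ?_⟩
      have hne : mink q q ≠ 0 := hq.1.ne
      have h2 : mink (-x + (2 * mink x q / mink q q) • q) q = mink x q := by
        simp only [mink_add_left, mink_neg_left, mink_smul_left]
        field_simp
        ring
      rw [h2]
      have h3 := mnorm_mul_le (mem_futureCone.1 hx).le (mem_futureCone.1 hq).le
      have h4 := mul_pos (mnorm_pos hx) (mnorm_pos hq)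
      linarith
    refine ⟨fun x y => ?_, fun x => ⟨fun h => ?_, fun h => ?_⟩⟩
    · show mink ((-(ContinuousLinearMap.id ℝ (Mink d)) +
        ((2 / mink q q) • minkL d q).smulRight q) x) ((-(ContinuousLinearMap.id ℝ (Mink d)) +
        ((2 / mink q q) • minkL d q).smulRight q) y) = _
      rw [key, key, refl_aux hq]
    · have h' : (-(ContinuousLinearMap.id ℝ (Mink d)) +
        ((2 / mink q q) • minkL d q).smulRight q) x ∈ futureCone d := h
      rw [key] at h'
      have := hF _ h'
      rwa [refl_refl hq] at this
    · show (-(ContinuousLinearMap.id ℝ (Mink d)) +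
        ((2 / mink q q) • minkL d q).smulRight q) x ∈ futureCone d
      rw [key]
      exact hF x h⟩

lemma isomLin_pointRefl (q : Mink d) (hq : q ∈ futureCone d) (x : Mink d) :
    isomLin (pointRefl q hq) x = -x + (2 * mink x q / mink q q) • q := by
  show (-(ContinuousLinearMap.id ℝ (Mink d)) + ((2 / mink q q) • minkL d q).smulRight q) x = _
  simp only [add_apply, neg_apply, ContinuousLinearMap.id_apply,
    ContinuousLinearMap.smulRight_apply, smul_apply, minkL_apply, smul_eq_mul, mink_comm q]
  ring_nf

lemma Hyp.add_mem_cone (x y : Hyp d) : (x : Mink d) + y ∈ futureCone d :=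
  add_mem_futureCone x.mem_cone y.fst_lt.le

/-- The isometry exchanging two points of `ℍ^d`. -/
noncomputable def hypSwap (x y : Hyp d) : HypIsom d := pointRefl (x + y) (x.add_mem_cone y)

lemma hypSwap_coe (x y z : Hyp d) : ((hypSwap x y • z : Hyp d) : Mink d) =
    -(z : Mink d) + (2 * mink (z : Mink d) (x + y) / mink (x + y : Mink d) (x + y)) • (x + y) :=
  isomLin_pointRefl _ (x.add_mem_cone y) _

lemma hypSwap_smul_left (x y : Hyp d) : hypSwap x y • x = y := by
  apply Subtype.ext
  rw [hypSwap_coe]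
  have h1 : mink (x + y : Mink d) (x + y) = 2 * mink (x : Mink d) (x + y) := by
    simp only [mink_add_left, mink_add_right, x.2.1, y.2.1, mink_comm (y : Mink d) x]; ring
  rw [← h1, div_self (x.add_mem_cone y).1.ne, one_smul]
  abel

/-- The base point of `ℍ^d`. -/
noncomputable def hypOrigin (d : ℕ) : Hyp d := hypGraph 0

lemma hypOrigin_coe : (hypOrigin d : Mink d) = (0, 1) := by
  simp [hypOrigin, hypGraph]

lemma mink_hypOrigin (y : Mink d) : -mink (hypOrigin d : Mink d) y = y.2 := by
  rw [hypOrigin_coe]; simp [mink]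

lemma contDiffOn_swap_aux {X : Type*} [NormedAddCommGroup X] [NormedSpace ℝ X] {s : Set X}
    {z q : X → Mink d} (hz : ContDiffOn ℝ ∞ z s) (hq : ContDiffOn ℝ ∞ q s)
    (hq0 : ∀ p ∈ s, mink (q p) (q p) ≠ 0) :
    ContDiffOn ℝ ∞ (fun p => -z p + (2 * mink (z p) (q p) / mink (q p) (q p)) • q p) s := by
  have h1 : ContDiffOn ℝ ∞ (fun p => mink (z p) (q p)) s :=
    contDiff_mink.comp_contDiffOn (hz.prodMk hq)
  have h2 : ContDiffOn ℝ ∞ (fun p => mink (q p) (q p)) s :=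
    contDiff_mink.comp_contDiffOn (hq.prodMk hq)
  exact hz.neg.add (((contDiffOn_const.mul h1).div h2 hq0).smul hq)

/-- The isometry carrying the base point to a given centre depends smoothly on that centre, so a
derivative in the centre of a radial kernel can be transferred to the function integrated against
it. -/
lemma contDiffOn_swap : ContDiffOn ℝ ∞
    (fun p : Mink d × EuclideanSpace ℝ (Fin d) =>
      ((hypSwap (hypOrigin d) (hypProj p.1) • (hypGraph p.2 : Hyp d) : Hyp d) : Mink d))
    (futureCone d ×ˢ univ) := by
  have hz : ContDiffOn ℝ ∞ (fun p : Mink d × EuclideanSpace ℝ (Fin d) => (hypGraph p.2 : Mink d))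
      (futureCone d ×ˢ univ) := (contDiff_hypGraph.comp contDiff_snd).contDiffOn
  have h0 : ContDiffOn ℝ ∞ (fun p : Mink d × EuclideanSpace ℝ (Fin d) => (hypProj p.1 : Mink d))
      (futureCone d ×ˢ univ) := contDiffOn_hypProj.comp contDiffOn_fst fun p hp => hp.1
  have hq : ContDiffOn ℝ ∞ (fun p : Mink d × EuclideanSpace ℝ (Fin d) =>
      (hypOrigin d : Mink d) + hypProj p.1) (futureCone d ×ˢ univ) := contDiffOn_const.add h0
  refine (contDiffOn_swap_aux hz hq fun p _ =>
    (Hyp.add_mem_cone (hypOrigin d) (hypProj p.1)).1.ne).congr fun p _ => ?_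
  exact hypSwap_coe _ _ _

end Geometry

/-! ### Hyperbolic volume: polar coordinates, invariance, radial integrals. -/

section Measure

variable {d : ℕ}

/-! ## The volume of hyperbolic space -/

lemma measurableEmbedding_hypGraph :
    MeasurableEmbedding (hypGraph : EuclideanSpace ℝ (Fin d) → Hyp d) :=
  (hypHomeo d).measurableEmbedding

lemma measurable_hypDensity : Measurable fun u : EuclideanSpace ℝ (Fin d) =>
    ENNReal.ofReal (1 / Real.sqrt (1 + ‖u‖ ^ 2)) := by fun_prop

lemma lintegral_hypVol (f : Hyp d → ℝ≥0∞) : ∫⁻ x, f x ∂(hypVol d) =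
    ∫⁻ v, ENNReal.ofReal (1 / Real.sqrt (1 + ‖v‖ ^ 2)) * f (hypGraph v) := by
  rw [hypVol, measurableEmbedding_hypGraph.lintegral_map,
    lintegral_withDensity_eq_lintegral_mul_non_measurable _ measurable_hypDensity]
  · rfl
  · exact Filter.Eventually.of_forall fun _ => ENNReal.ofReal_lt_top

lemma integral_hypVol (f : Hyp d → ℝ) : ∫ x, f x ∂(hypVol d) =
    ∫ v, 1 / Real.sqrt (1 + ‖v‖ ^ 2) * f (hypGraph v) := by
  rw [hypVol, measurableEmbedding_hypGraph.integral_map,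
    integral_withDensity_eq_integral_toReal_smul measurable_hypDensity]
  · refine integral_congr_ae (Filter.Eventually.of_forall fun v => ?_)
    simp only [smul_eq_mul]
    rw [ENNReal.toReal_ofReal (by positivity)]
  · exact Filter.Eventually.of_forall fun _ => ENNReal.ofReal_lt_top

lemma integrable_hypVol (f : Hyp d → ℝ) : Integrable f (hypVol d) ↔
    Integrable fun v => 1 / Real.sqrt (1 + ‖v‖ ^ 2) * f (hypGraph v) := by
  rw [hypVol, measurableEmbedding_hypGraph.integrable_map_iff,
    integrable_withDensity_iff_integrable_smul' measurable_hypDensity]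
  · refine integrable_congr (Filter.Eventually.of_forall fun v => ?_)
    simp only [smul_eq_mul, Function.comp]
    rw [ENNReal.toReal_ofReal (by positivity)]
  · exact Filter.Eventually.of_forall fun _ => ENNReal.ofReal_lt_top

instance : IsFiniteMeasureOnCompacts (hypVol d) where
  lt_top_of_isCompact K hK := by
    have h1 : IsCompact ((hypGraph : EuclideanSpace ℝ (Fin d) → Hyp d) ⁻¹' K) :=
      (hypHomeo d).isCompact_preimage.2 hK
    rw [hypVol, measurableEmbedding_hypGraph.map_apply,
      withDensity_apply _ (measurableEmbedding_hypGraph.measurable hK.measurableSet)]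
    refine lt_of_le_of_lt (lintegral_mono (g := fun _ => 1) fun v => ?_) ?_
    · rw [← ENNReal.ofReal_one]
      apply ENNReal.ofReal_le_ofReal
      rw [div_le_one (by positivity), Real.one_le_sqrt]
      nlinarith [sq_nonneg ‖v‖]
    · simpa using h1.measure_lt_top

lemma hypVol_singleton (hd : 1 ≤ d) (x : Hyp d) : hypVol d {x} = 0 := by
  have : Nonempty (Fin d) := ⟨⟨0, hd⟩⟩
  rw [hypVol, measurableEmbedding_hypGraph.map_apply]
  refine withDensity_absolutelyContinuous _ _ ?_
  refine Set.Subsingleton.measure_zero (fun a ha b hb => ?_) _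
  exact measurableEmbedding_hypGraph.injective (ha.trans hb.symm)

/-! ## Polar coordinates in the future cone -/

lemma measurableSet_futureCone (d : ℕ) : MeasurableSet (futureCone d) :=
  (isOpen_futureCone d).measurableSet

/-- The measure `t^d dt` on `(0, ∞)`. -/
noncomputable def radialMeasure (d : ℕ) : Measure ℝ :=
  (volume.restrict (Ioi (0 : ℝ))).withDensity fun t => ENNReal.ofReal (t ^ d)

instance : SFinite (radialMeasure d) := by unfold radialMeasure; infer_instance

lemma aemeasurable_polar : AEMeasurable (fun x : Mink d => (mnorm x, hypProj x))
    (volume.restrict (futureCone d)) :=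
  (continuous_mnorm.continuousOn.prodMk continuousOn_hypProj).aemeasurable
    (measurableSet_futureCone d)

lemma lintegral_smul_eq (F : EuclideanSpace ℝ (Fin d) → ℝ≥0∞) {t : ℝ} (ht : 0 < t) :
    ∫⁻ v, F v = ENNReal.ofReal (t ^ d) * ∫⁻ u, F (t • u) := by
  have h := Measure.map_addHaar_smul (volume : Measure (EuclideanSpace ℝ (Fin d))) ht.ne'
  have h2 : ∫⁻ u, F (t • u) = ∫⁻ v, F v ∂(Measure.map (t • ·) volume) :=
    ((Homeomorph.smulOfNeZero t ht.ne').measurableEmbedding.lintegral_map F).symm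
  rw [h2, h, lintegral_smul_measure, finrank_euclideanSpace_fin, abs_of_pos (by positivity),
    smul_eq_mul, ← mul_assoc, ← ENNReal.ofReal_mul (by positivity),
    mul_inv_cancel₀ (by positivity), ENNReal.ofReal_one, one_mul]

/-- On the vertical line over v substitute τ = √(t² + |v|²); then t is the Minkowski norm of (v, τ)
and the point of ℍ^d below it is the graph point over v/t. -/
lemma fst_slice (v : EuclideanSpace ℝ (Fin d)) (g : ℝ × Hyp d → ℝ≥0∞) :
    ∫⁻ τ in Ioi ‖v‖, g (mnorm (v, τ), hypProj (v, τ)) =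
    ∫⁻ t in Ioi (0 : ℝ), ENNReal.ofReal (t / Real.sqrt (t ^ 2 + ‖v‖ ^ 2)) *
      g (t, hypGraph (t⁻¹ • v)) := by
  have himg : (fun t : ℝ => Real.sqrt (t ^ 2 + ‖v‖ ^ 2)) '' Ioi 0 = Ioi ‖v‖ := by
    ext τ
    simp only [mem_image, mem_Ioi]
    constructor
    · rintro ⟨t, ht, rfl⟩
      apply Real.lt_sqrt_of_sq_lt
      nlinarith
    · intro h
      have hv := norm_nonneg v
      refine ⟨Real.sqrt (τ ^ 2 - ‖v‖ ^ 2), Real.sqrt_pos.2 (by nlinarith), ?_⟩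
      rw [Real.sq_sqrt (by nlinarith), sub_add_cancel, Real.sqrt_sq (by linarith)]
  have hder : ∀ t ∈ Ioi (0 : ℝ), HasDerivWithinAt (fun t : ℝ => Real.sqrt (t ^ 2 + ‖v‖ ^ 2))
      (t / Real.sqrt (t ^ 2 + ‖v‖ ^ 2)) (Ioi 0) t := by
    intro t ht
    have ht : 0 < t := ht
    have h1 : HasDerivAt (fun t : ℝ => t ^ 2 + ‖v‖ ^ 2) (2 * t) t := by
      simpa using (hasDerivAt_pow 2 t).add_const (‖v‖ ^ 2)
    have h2 := h1.sqrt (by positivity)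
    refine (h2.congr_deriv ?_).hasDerivWithinAt
    have : Real.sqrt (t ^ 2 + ‖v‖ ^ 2) ≠ 0 := by positivity
    field_simp
  have hinj : InjOn (fun t : ℝ => Real.sqrt (t ^ 2 + ‖v‖ ^ 2)) (Ioi 0) := by
    intro a ha b hb hab
    have ha : 0 < a := ha
    have hb : 0 < b := hb
    have := (Real.sqrt_inj (by positivity) (by positivity)).1 hab
    exact (sq_eq_sq₀ ha.le hb.le).1 (by linarith)
  rw [← himg, lintegral_image_eq_lintegral_abs_deriv_mul measurableSet_Ioi hder hinj]
  refine setLIntegral_congr_fun measurableSet_Ioi fun t ht => ?_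
  have ht : 0 < t := ht
  have hx : ((v, Real.sqrt (t ^ 2 + ‖v‖ ^ 2)) : Mink d) = t • (hypGraph (t⁻¹ • v) : Mink d) := by
    refine Prod.ext ?_ ?_
    · simp [hypGraph, smul_smul, ht.ne']
    · simp only [hypGraph, Prod.smul_mk, smul_eq_mul, norm_smul, norm_inv, Real.norm_eq_abs,
        abs_of_pos ht]
      rw [← Real.sqrt_sq ht.le, ← Real.sqrt_mul (sq_nonneg _), Real.sqrt_sq ht.le]
      congr 1
      field_simp
  rw [hx, mnorm_smul _ ht.le, hypProj_smul (Hyp.mem_cone _) ht, hypProj_hyp, Hyp.mnorm_eq, mul_one,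
    abs_of_nonneg (by positivity)]

/-- Polar coordinates in the future cone. -/
theorem map_polar : (volume.restrict (futureCone d)).map (fun x => (mnorm x, hypProj x)) =
    (radialMeasure d).prod (hypVol d) := by
  refine Measure.ext_of_lintegral _ fun g hg => ?_
  rw [lintegral_map' hg.aemeasurable aemeasurable_polar]
  have hm : AEMeasurable (indicator (futureCone d) fun x => g (mnorm x, hypProj x))
      (volume : Measure (Mink d)) := by
    rw [aemeasurable_indicator_iff (measurableSet_futureCone d)]
    exact hg.comp_aemeasurable aemeasurable_polar
  rw [← lintegral_indicator (measurableSet_futureCone d), Measure.volume_eq_prod] at *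
  rw [lintegral_prod _ hm]
  have h1 : ∀ v : EuclideanSpace ℝ (Fin d),
      ∫⁻ τ, indicator (futureCone d) (fun x => g (mnorm x, hypProj x)) (v, τ) =
      ∫⁻ t in Ioi (0 : ℝ), ENNReal.ofReal (t / Real.sqrt (t ^ 2 + ‖v‖ ^ 2)) *
        g (t, hypGraph (t⁻¹ • v)) := by
    intro v
    rw [← fst_slice, ← lintegral_indicator measurableSet_Ioi]
    refine lintegral_congr fun τ => ?_
    simp only [indicator, mem_futureCone, mem_Ioi]
  simp only [h1]
  have hmeas : Measurable fun p : EuclideanSpace ℝ (Fin d) × ℝ =>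
      ENNReal.ofReal (p.2 / Real.sqrt (p.2 ^ 2 + ‖p.1‖ ^ 2)) *
        g (p.2, hypGraph (p.2⁻¹ • p.1)) := by
    refine Measurable.mul (by fun_prop) (hg.comp (measurable_snd.prodMk ?_))
    exact measurableEmbedding_hypGraph.measurable.comp (by fun_prop)
  -- After exchanging the integrals, v = t u in the space variable produces the factor t^d, and the
  -- remaining Jacobian 1/√(1 + |u|²) is the density of the hyperbolic volume.
  rw [lintegral_lintegral_swap hmeas.aemeasurable, lintegral_prod _ hg.aemeasurable, radialMeasure,
    lintegral_withDensity_eq_lintegral_mul _ (by fun_prop) hg.lintegral_prod_right']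
  refine setLIntegral_congr_fun measurableSet_Ioi fun t ht => ?_
  have ht : 0 < t := ht
  simp only [Pi.mul_apply]
  rw [lintegral_hypVol, lintegral_smul_eq _ ht]
  congr 1
  refine lintegral_congr fun u => ?_
  rw [smul_smul, inv_mul_cancel₀ ht.ne', one_smul, norm_smul, Real.norm_eq_abs, abs_of_pos ht]
  congr 2
  rw [show t ^ 2 + (t * ‖u‖) ^ 2 = t ^ 2 * (1 + ‖u‖ ^ 2) by ring, Real.sqrt_mul (sq_nonneg t),
    Real.sqrt_sq ht.le]
  field_simp

lemma integral_polar {φ : ℝ → ℝ} {f : Hyp d → ℝ} (hφ : Continuous φ) (hf : Continuous f) :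
    ∫ x in futureCone d, φ (mnorm x) * zeroExt f x =
      (∫ t in Ioi (0 : ℝ), t ^ d * φ t) * ∫ y, f y ∂(hypVol d) := by
  have h1 : ∫ x in futureCone d, φ (mnorm x) * zeroExt f x =
      ∫ p, φ p.1 * f p.2 ∂((volume.restrict (futureCone d)).map
        fun x => (mnorm x, hypProj x)) := by
    rw [integral_map aemeasurable_polar]
    · rfl
    · exact (by fun_prop : Continuous fun p : ℝ × Hyp d => φ p.1 * f p.2).aestronglyMeasurable
  rw [h1, map_polar, integral_prod_mul, radialMeasure,
    integral_withDensity_eq_integral_toReal_smul (by fun_prop)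
      (Filter.Eventually.of_forall fun _ => ENNReal.ofReal_lt_top)]
  congr 1
  refine setIntegral_congr_fun measurableSet_Ioi fun t ht => ?_
  have ht : 0 < t := ht
  simp only [smul_eq_mul]
  rw [ENNReal.toReal_ofReal (by positivity)]

/-! ## Invariance under isometries -/

/-- `minkBasis` as a basis. -/
noncomputable def minkModuleBasis (d : ℕ) : Module.Basis (Fin d ⊕ Unit) ℝ (Mink d) :=
  (EuclideanSpace.basisFun (Fin d) ℝ).toBasis.prod (Module.Basis.singleton Unit ℝ)

lemma minkModuleBasis_apply (i : Fin d ⊕ Unit) : minkModuleBasis d i = minkBasis d i := by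
  rcases i with i | i <;> simp [minkModuleBasis, minkBasis, Module.Basis.prod_apply]

/-- In the standard basis an isometry g satisfies gᵀ J g = J with det J ≠ 0; hence (det g)² = 1. -/
lemma abs_det_isom (γ : HypIsom d) :
    |LinearMap.det ((isomLin γ : Mink d ≃L[ℝ] Mink d) : Mink d →ₗ[ℝ] Mink d)| = 1 := by
  classical
  set b := minkModuleBasis d
  let B : LinearMap.BilinForm ℝ (Mink d) :=
    LinearMap.mk₂ ℝ mink mink_add_left mink_smul_left mink_add_right mink_smul_right
  set g : Mink d →ₗ[ℝ] Mink d := ((isomLin γ : Mink d ≃L[ℝ] Mink d) : Mink d →ₗ[ℝ] Mink d)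
  have hB : B.comp g g = B := by
    apply LinearMap.ext₂
    intro x y
    exact γ.2.1 x y
  have hJ : LinearMap.BilinForm.toMatrix b B = Matrix.diagonal (minkSign d) := by
    ext i j
    rw [LinearMap.BilinForm.toMatrix_apply, minkModuleBasis_apply, minkModuleBasis_apply]
    exact mink_basis i j
  have h := LinearMap.BilinForm.toMatrix_comp b b B g g
  rw [hB, hJ] at h
  have h2 := congrArg Matrix.det h
  rw [Matrix.det_mul, Matrix.det_mul, Matrix.det_transpose, LinearMap.det_toMatrix,
    Matrix.det_diagonal] at h2
  have hne : ∏ i, minkSign d i ≠ 0 := by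
    rw [Finset.prod_ne_zero_iff]
    rintro (i | i) _ <;> simp [minkSign]
  have h3 : LinearMap.det g ^ 2 = 1 := by
    apply mul_right_cancel₀ hne
    linear_combination -h2
  rw [← sq_abs] at h3
  exact (pow_eq_one_iff_of_nonneg (abs_nonneg _) two_ne_zero).1 h3

instance : (volume : Measure (Mink d)).IsAddHaarMeasure :=
  inferInstanceAs ((volume : Measure (EuclideanSpace ℝ (Fin d))).prod
    (volume : Measure ℝ)).IsAddHaarMeasure

lemma measurePreserving_isomLin (γ : HypIsom d) :
    MeasurePreserving (isomLin γ) (volume : Measure (Mink d)) volume := by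
  refine ⟨(isomLin γ).continuous.measurable, ?_⟩
  have h0 : LinearMap.det ((isomLin γ : Mink d ≃L[ℝ] Mink d) : Mink d →ₗ[ℝ] Mink d) ≠ 0 := by
    intro h
    have := abs_det_isom γ
    rw [h] at this
    simp at this
  have h := Measure.map_linearMap_addHaar_eq_smul_addHaar (volume : Measure (Mink d)) h0
  rw [abs_inv, abs_det_isom, inv_one, ENNReal.ofReal_one, one_smul] at h
  exact h

lemma preimage_isomLin_cone (γ : HypIsom d) : isomLin γ ⁻¹' futureCone d = futureCone d :=
  Set.ext fun x => γ.2.2 x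

lemma mnorm_isomLin (γ : HypIsom d) (x : Mink d) : mnorm (isomLin γ x) = mnorm x := by
  unfold mnorm
  rw [show mink (isomLin γ x) (isomLin γ x) = mink x x from γ.2.1 x x]

/-- This factor is cancelled when a hyperbolic volume is read off from the Lebesgue measure of a
truncated cone. -/
lemma radialMeasure_Ioc : radialMeasure d (Ioc 0 1) ≠ 0 ∧ radialMeasure d (Ioc 0 1) ≠ ⊤ := by
  have hs : Ioc (0 : ℝ) 1 ⊆ Ioi 0 := fun t ht => ht.1
  rw [radialMeasure, withDensity_apply _ measurableSet_Ioc,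
    Measure.restrict_restrict measurableSet_Ioc, inter_eq_self_of_subset_left hs]
  constructor
  · rw [Ne, lintegral_eq_zero_iff (by fun_prop)]
    intro h
    have h2 : ∀ᵐ t ∂(volume.restrict (Ioc (0 : ℝ) 1)), False := by
      filter_upwards [h, ae_restrict_mem measurableSet_Ioc] with t ht ht'
      have : 0 < t ^ d := pow_pos ht'.1 d
      simp only [Pi.zero_apply, ENNReal.ofReal_eq_zero] at ht
      linarith
    rw [Filter.eventually_false_iff_eq_bot, ae_eq_bot, Measure.restrict_eq_zero] at h2
    simp at h2
  · refine (lt_of_le_of_lt (setLIntegral_mono (g := fun _ => 1) (by fun_prop)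
      fun t ht => ?_) ?_).ne
    · rw [← ENNReal.ofReal_one]
      exact ENNReal.ofReal_le_ofReal (pow_le_one₀ ht.1.le ht.2)
    · simp

/-- The hyperbolic volume is invariant under isometries. -/
theorem measurePreserving_smul (γ : HypIsom d) :
    MeasurePreserving (fun x : Hyp d => γ • x) (hypVol d) (hypVol d) := by
  refine ⟨(continuous_hyp_smul γ).measurable, ?_⟩
  ext A hA
  have hA' : MeasurableSet ((fun x : Hyp d => γ • x) ⁻¹' A) :=
    (continuous_hyp_smul γ).measurable hA
  rw [Measure.map_apply (continuous_hyp_smul γ).measurable hA]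
  -- Up to a finite nonzero factor, the volume of A is the Lebesgue measure of the cone over A cut
  -- at radius 1. Lorentz maps preserve Lebesgue measure and the radius, so the invariance descends
  -- to ℍ^d.
  have key : ∀ A : Set (Hyp d), MeasurableSet A → radialMeasure d (Ioc 0 1) * hypVol d A =
      ∫⁻ x in futureCone d, indicator (Ioc (0 : ℝ) 1 ×ˢ A) 1 (mnorm x, hypProj x) := by
    intro A hA
    have hm : MeasurableSet (Ioc (0 : ℝ) 1 ×ˢ A) := measurableSet_Ioc.prod hA
    rw [← Measure.prod_prod, ← map_polar, ← lintegral_indicator_one hm,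
      lintegral_map' ((measurable_one.indicator hm).aemeasurable) aemeasurable_polar]
  obtain ⟨h0, h1⟩ := radialMeasure_Ioc (d := d)
  apply (ENNReal.mul_right_inj h0 h1).1
  rw [key _ hA, key _ hA']
  have hp := (measurePreserving_isomLin γ).restrict_preimage (measurableSet_futureCone d)
  rw [preimage_isomLin_cone] at hp
  conv_rhs => rw [← hp.lintegral_comp_emb (isomLin γ).toHomeomorph.measurableEmbedding]
  refine setLIntegral_congr_fun (measurableSet_futureCone d) fun x hx => ?_
  rw [hypProj_lin γ hx, mnorm_isomLin]
  rfl

lemma integral_hyp_smul (γ : HypIsom d) (f : Hyp d → ℝ) :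
    ∫ x, f (γ • x) ∂(hypVol d) = ∫ x, f x ∂(hypVol d) :=
  (measurePreserving_smul γ).integral_comp (Homeomorph.smul γ).measurableEmbedding f

/-! ## Integration of radial functions -/

lemma mink_swap (x y : Hyp d) :
    -mink (x : Mink d) (hypSwap (hypOrigin d) x • y : Hyp d) = y.1.2 := by
  conv_lhs => rw [← hypSwap_smul_left (hypOrigin d) x, hypSwap_smul_left]
  have := mink_smul_hyp (hypSwap (hypOrigin d) x) (hypOrigin d) y
  rw [hypSwap_smul_left] at this
  rw [this, mink_hypOrigin]

/-- The area `v_{d-1}` of the unit sphere of `ℝ^d`. -/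
noncomputable def sphereArea (d : ℕ) : ℝ :=
  (volume : Measure (EuclideanSpace ℝ (Fin d))).toSphere.real univ

lemma sphereArea_pos (hd : 1 ≤ d) : 0 < sphereArea d := by
  have : Nonempty (Fin d) := ⟨⟨0, hd⟩⟩
  rw [sphereArea, Measure.toSphere_real_apply_univ, finrank_euclideanSpace_fin]
  have h1 : (0 : ℝ) < d := by exact_mod_cast hd
  refine mul_pos h1 (ENNReal.toReal_pos ?_ ?_)
  · exact (Metric.measure_ball_pos _ _ one_pos).ne'
  · exact measure_ball_lt_top.ne

/-- An isometry moves the centre to the base point, where -⟨o, y⟩₋ is the height √(1 + |u|²) of the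
graph; Euclidean polar coordinates in u finish. -/
lemma integral_radial (hd : 1 ≤ d) (x : Hyp d) (g : ℝ → ℝ) :
    ∫ y, g (-mink (x : Mink d) y) ∂(hypVol d) = sphereArea d *
      ∫ r in Ioi (0 : ℝ), r ^ (d - 1) * (1 / Real.sqrt (1 + r ^ 2) * g (Real.sqrt (1 + r ^ 2))) := by
  have : Nonempty (Fin d) := ⟨⟨0, hd⟩⟩
  rw [← integral_hyp_smul (hypSwap (hypOrigin d) x)]
  simp only [mink_swap]
  rw [integral_hypVol, sphereArea, Measure.toSphere_real_apply_univ]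
  have := integral_fun_norm_addHaar (volume : Measure (EuclideanSpace ℝ (Fin d)))
    (fun r => 1 / Real.sqrt (1 + r ^ 2) * g (Real.sqrt (1 + r ^ 2)))
  simp only [nsmul_eq_mul, smul_eq_mul, finrank_euclideanSpace_fin] at this ⊢
  rw [mul_assoc, ← this]
  rfl

end Measure

/-! ### The wave operator on the cone and the Laplacian of ℍ^d. -/

section Calculus

variable {d : ℕ}

/-! ## Calculus of the wave operator -/

lemma two_le_contDiff_infty : (2 : WithTop ℕ∞) ≤ ((⊤ : ℕ∞) : WithTop ℕ∞) :=
  WithTop.coe_le_coe.2 (le_top : (2 : ℕ∞) ≤ ⊤)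

/-- The Minkowski product `⟨∇F, ∇G⟩₋` of two gradients. -/
noncomputable def mdot (F G : Mink d → ℝ) (x : Mink d) : ℝ :=
  ∑ i, minkSign d i * (fderiv ℝ F x (minkBasis d i) * fderiv ℝ G x (minkBasis d i))

lemma minkSign_mul_self (i : Fin d ⊕ Unit) : minkSign d i * minkSign d i = 1 := by
  rcases i with i | i <;> simp [minkSign]

/-- The vector a is the Minkowski gradient of F at x, so the product of gradients is the derivative
of G along it. -/
lemma mdot_of_fderiv_left {F G : Mink d → ℝ} {x a : Mink d} (h : fderiv ℝ F x = minkL d a) :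
    mdot F G x = fderiv ℝ G x a := by
  conv_rhs => rw [mink_expand a, map_sum]
  refine Finset.sum_congr rfl fun i _ => ?_
  rw [map_smul, h, minkL_apply, mink_comm, smul_eq_mul, mul_assoc]

lemma mdot_comm (F G : Mink d → ℝ) (x : Mink d) : mdot F G x = mdot G F x :=
  Finset.sum_congr rfl fun i _ => by ring

lemma wave_congr {F G : Mink d → ℝ} {x : Mink d} (h : F =ᶠ[𝓝 x] G) : wave F x = wave G x := by
  simp only [wave_eq, h.fderiv.fderiv_eq]

lemma fderiv_fderiv_apply {F : Mink d → ℝ} {x : Mink d} (hF : ContDiffAt ℝ 2 F x) (v w : Mink d) :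
    fderiv ℝ (fderiv ℝ F) x v w = fderiv ℝ (fun y => fderiv ℝ F y w) x v := by
  have h1 : DifferentiableAt ℝ (fderiv ℝ F) x :=
    (hF.fderiv_right (m := 1) (by norm_num)).differentiableAt (by norm_num)
  rw [fderiv_clm_apply h1 (differentiableAt_const w)]
  simp

lemma ContDiffAt.differentiableAt_fderiv_apply {F : Mink d → ℝ} {x : Mink d}
    (hF : ContDiffAt ℝ 2 F x) (v : Mink d) :
    DifferentiableAt ℝ (fun y => fderiv ℝ F y v) x :=
  ((hF.fderiv_right (m := 1) (by norm_num)).differentiableAt (by norm_num)).clm_apply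
    (differentiableAt_const v)

lemma ContDiffAt.eventually_differentiableAt {F : Mink d → ℝ} {x : Mink d}
    (hF : ContDiffAt ℝ 2 F x) : ∀ᶠ y in 𝓝 x, DifferentiableAt ℝ F y :=
  (hF.eventually (by simp)).mono fun _ h => h.differentiableAt (by norm_num)

lemma wave_mul {F G : Mink d → ℝ} {x : Mink d} (hF : ContDiffAt ℝ 2 F x)
    (hG : ContDiffAt ℝ 2 G x) :
    wave (fun y => F y * G y) x = F x * wave G x + 2 * mdot F G x + G x * wave F x := by
  have hFd : DifferentiableAt ℝ F x := hF.differentiableAt (by norm_num)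
  have hGd : DifferentiableAt ℝ G x := hG.differentiableAt (by norm_num)
  have key : ∀ v, fderiv ℝ (fderiv ℝ fun y => F y * G y) x v v =
      F x * fderiv ℝ (fderiv ℝ G) x v v + 2 * (fderiv ℝ F x v * fderiv ℝ G x v)
        + G x * fderiv ℝ (fderiv ℝ F) x v v := by
    intro v
    rw [fderiv_fderiv_apply (hF.mul hG), fderiv_fderiv_apply hF, fderiv_fderiv_apply hG]
    have he : (fun y => fderiv ℝ (fun y => F y * G y) y v) =ᶠ[𝓝 x]
        fun y => F y * fderiv ℝ G y v + G y * fderiv ℝ F y v := by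
      filter_upwards [hF.eventually_differentiableAt, hG.eventually_differentiableAt] with y h1 h2
      rw [fderiv_fun_mul h1 h2]
      simp
    rw [he.fderiv_eq, fderiv_fun_add (hFd.fun_mul (hG.differentiableAt_fderiv_apply v))
      (hGd.fun_mul (hF.differentiableAt_fderiv_apply v)),
      fderiv_fun_mul hFd (hG.differentiableAt_fderiv_apply v),
      fderiv_fun_mul hGd (hF.differentiableAt_fderiv_apply v)]
    simp only [add_apply, smul_apply, smul_eq_mul]
    ring
  simp only [wave_eq, mdot, key, Finset.mul_sum, ← Finset.sum_add_distrib]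
  exact Finset.sum_congr rfl fun i _ => by ring

lemma wave_comp {F : Mink d → ℝ} {x : Mink d} {Q : ℝ → ℝ} (hF : ContDiffAt ℝ 2 F x)
    (hQ : ContDiffAt ℝ 2 Q (F x)) :
    wave (fun y => Q (F y)) x = deriv (deriv Q) (F x) * mdot F F x + deriv Q (F x) * wave F x := by
  have hFd : DifferentiableAt ℝ F x := hF.differentiableAt (by norm_num)
  have hQ1 : DifferentiableAt ℝ (deriv Q) (F x) := by
    have h1 : DifferentiableAt ℝ (fderiv ℝ Q) (F x) :=
      (hQ.fderiv_right (m := 1) (by norm_num)).differentiableAt (by norm_num)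
    exact h1.clm_apply (differentiableAt_const (1 : ℝ))
  have hQe : ∀ᶠ y in 𝓝 x, DifferentiableAt ℝ Q (F y) :=
    hFd.continuousAt.eventually
      ((hQ.eventually (by simp)).mono fun _ h => h.differentiableAt (by norm_num))
  have key : ∀ v, fderiv ℝ (fderiv ℝ fun y => Q (F y)) x v v =
      deriv (deriv Q) (F x) * (fderiv ℝ F x v * fderiv ℝ F x v)
        + deriv Q (F x) * fderiv ℝ (fderiv ℝ F) x v v := by
    intro v
    have hQF : ContDiffAt ℝ 2 (fun y => Q (F y)) x := hQ.comp x hF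
    rw [fderiv_fderiv_apply hQF, fderiv_fderiv_apply hF]
    have he : (fun y => fderiv ℝ (fun y => Q (F y)) y v) =ᶠ[𝓝 x]
        fun y => deriv Q (F y) * fderiv ℝ F y v := by
      filter_upwards [hF.eventually_differentiableAt, hQe] with y h1 h2
      have := h2.hasDerivAt.comp_hasFDerivAt y h1.hasFDerivAt
      rw [show (fun y => Q (F y)) = Q ∘ F from rfl, this.fderiv]
      simp
    have h3 := hQ1.hasDerivAt.comp_hasFDerivAt x hFd.hasFDerivAt
    have h4 : DifferentiableAt ℝ (fun y => deriv Q (F y)) x := h3.differentiableAt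
    have h5 : fderiv ℝ (fun y => deriv Q (F y)) x = deriv (deriv Q) (F x) • fderiv ℝ F x :=
      h3.fderiv
    rw [he.fderiv_eq, fderiv_fun_mul h4 (hF.differentiableAt_fderiv_apply v), h5]
    simp only [add_apply, smul_apply, smul_eq_mul]
    ring
  simp only [wave_eq, mdot, key, Finset.mul_sum, ← Finset.sum_add_distrib]
  exact Finset.sum_congr rfl fun i _ => by ring

lemma hasFDerivAt_mink_self (x : Mink d) :
    HasFDerivAt (fun y : Mink d => -mink y y) (minkL d ((-2 : ℝ) • x)) x := by
  have h := ((minkL d).hasFDerivAt (x := x)).clm_apply (hasFDerivAt_id x)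
  refine h.neg.congr_fderiv ?_
  ext v <;> simp [mink_comm _ x] <;> ring

lemma fderiv_mink_self (x : Mink d) :
    fderiv ℝ (fun y : Mink d => -mink y y) x = minkL d ((-2 : ℝ) • x) :=
  (hasFDerivAt_mink_self x).fderiv

lemma wave_mink_self (x : Mink d) : wave (fun y : Mink d => -mink y y) x = -2 * (d + 1) := by
  have h : fderiv ℝ (fderiv ℝ fun y : Mink d => -mink y y) x = (-2 : ℝ) • minkL d := by
    have : fderiv ℝ (fun y : Mink d => -mink y y) = fun x => ((-2 : ℝ) • minkL d) x := by
      funext x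
      rw [fderiv_mink_self, map_smul]; rfl
    rw [this]
    exact ((-2 : ℝ) • minkL d).fderiv
  rw [wave_eq, h]
  have : ∀ i, minkSign d i * ((-2 : ℝ) • minkL d) (minkBasis d i) (minkBasis d i) = -2 := by
    intro i
    simp only [smul_apply, minkL_apply, mink_basis, Matrix.diagonal_apply_eq, smul_eq_mul]
    linear_combination -2 * minkSign_mul_self i
  simp only [this, Finset.sum_const, Finset.card_univ, Fintype.card_sum, Fintype.card_fin,
    Fintype.card_unit, nsmul_eq_mul]
  push_cast
  ring

lemma fderiv_mnorm {x : Mink d} (hx : x ∈ futureCone d) :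
    fderiv ℝ mnorm x = minkL d ((-(mnorm x)⁻¹) • x) := by
  have h := (hasFDerivAt_mink_self x).sqrt (by have := hx.1; linarith)
  have h2 : fderiv ℝ mnorm x = _ := h.fderiv
  have := mnorm_pos hx
  rw [h2, ← map_smul, smul_smul]
  congr 2
  change 1 / (2 * mnorm x) * -2 = _
  field_simp

lemma differentiableAt_mnorm {x : Mink d} (hx : x ∈ futureCone d) :
    DifferentiableAt ℝ mnorm x :=
  ((contDiffOn_mnorm.contDiffAt ((isOpen_futureCone d).mem_nhds hx)).differentiableAt (by simp))

/-! ## Homogeneity -/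

lemma zeroExt_smul (f : Hyp d → ℝ) {t : ℝ} (ht : 0 < t) (x : Mink d) :
    zeroExt f (t • x) = zeroExt f x := by
  by_cases hx : x ∈ futureCone d
  · simp only [zeroExt, hypProj_smul hx ht]
  · have h : t • x ∉ futureCone d := fun h => hx (by
      simpa [smul_smul, ht.ne'] using smul_mem_futureCone h (inv_pos.2 ht))
    simp only [zeroExt, hypProj, dif_neg hx, dif_neg h]

lemma fderiv_zeroExt_smul (f : Hyp d → ℝ) {t : ℝ} (ht : 0 < t) (x : Mink d) :
    fderiv ℝ (zeroExt f) x = t • fderiv ℝ (zeroExt f) (t • x) := by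
  rw [← fderiv_comp_smul]
  congr 1
  funext y
  exact (zeroExt_smul f ht y).symm

lemma wave_zeroExt_smul (f : Hyp d → ℝ) {t : ℝ} (ht : 0 < t) (x : Mink d) :
    wave (zeroExt f) x = t ^ 2 * wave (zeroExt f) (t • x) := by
  have h : fderiv ℝ (fderiv ℝ (zeroExt f)) x
      = t • t • fderiv ℝ (fderiv ℝ (zeroExt f)) (t • x) := by
    conv_lhs => rw [show fderiv ℝ (zeroExt f) = t • fun x => fderiv ℝ (zeroExt f) (t • x) from
      funext fun x => fderiv_zeroExt_smul f ht x]
    have h1 : fderiv ℝ (t • fun x => fderiv ℝ (zeroExt f) (t • x)) x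
        = t • fderiv ℝ (fun x => fderiv ℝ (zeroExt f) (t • x)) x :=
      congrFun (fderiv_const_smul_field (𝕜 := ℝ)
        (f := fun x => fderiv ℝ (zeroExt f) (t • x)) t) x
    rw [h1, fderiv_comp_smul (f := fderiv ℝ (zeroExt f))]
  simp only [wave_eq, h, Finset.mul_sum, smul_apply, smul_eq_mul]
  exact Finset.sum_congr rfl fun i _ => by ring

lemma wave_zeroExt (f : Hyp d → ℝ) {x : Mink d} (hx : x ∈ futureCone d) :
    wave (zeroExt f) x = (mnorm x)⁻¹ ^ 2 * zeroExt (lap f) x := by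
  rw [wave_zeroExt_smul f (inv_pos.2 (mnorm_pos hx)), ← hypProj_coe hx]
  rfl

/-- Euler's relation in degree 0. -/
lemma fderiv_zeroExt_self {f : Hyp d → ℝ} {x : Mink d}
    (hf : DifferentiableAt ℝ (zeroExt f) x) : fderiv ℝ (zeroExt f) x x = 0 := by
  have h1 : HasDerivAt (fun t : ℝ => x + t • x) x 0 := by
    simpa using ((hasDerivAt_id (0 : ℝ)).smul_const x).const_add x
  have hf' : HasFDerivAt (zeroExt f) (fderiv ℝ (zeroExt f) x) (x + (0 : ℝ) • x) := by
    simpa using hf.hasFDerivAt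
  have h2 := hf'.comp_hasDerivAt (0 : ℝ) h1
  have h3 : (zeroExt f ∘ fun t : ℝ => x + t • x) =ᶠ[𝓝 0] fun _ => zeroExt f x := by
    filter_upwards [lt_mem_nhds (show (-1 : ℝ) < 0 by norm_num)] with t ht
    have : x + t • x = (1 + t) • x := by rw [add_smul, one_smul]
    simp only [Function.comp, this]
    exact zeroExt_smul f (by linarith) x
  exact (h2.congr_of_eventuallyEq h3.symm).unique (hasDerivAt_const _ _)

lemma IsSmoothHyp.contDiffAt {f : Hyp d → ℝ} (hf : IsSmoothHyp f) {x : Mink d}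
    (hx : x ∈ futureCone d) : ContDiffAt ℝ ∞ (zeroExt f) x :=
  ContDiffOn.contDiffAt hf ((isOpen_futureCone d).mem_nhds hx)

/-- The gradient of the norm is radial and the extension is constant along rays. Hence weights
φ(‖x‖₋) contribute no derivative term in Green's formula. -/
lemma mdot_mnorm_zeroExt {f : Hyp d → ℝ} (hf : IsSmoothHyp f) {x : Mink d}
    (hx : x ∈ futureCone d) : mdot mnorm (zeroExt f) x = 0 := by
  rw [mdot_of_fderiv_left (fderiv_mnorm hx), map_smul,
    fderiv_zeroExt_self ((hf.contDiffAt hx).differentiableAt (by simp)), smul_zero]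

/-! ## Integration by parts -/

lemma integral_fderiv_eq_zero {W : Mink d → ℝ} (hW : ContDiff ℝ 1 W) (hc : HasCompactSupport W)
    (v : Mink d) : Integrable (fun x => fderiv ℝ W x v) ∧ ∫ x, fderiv ℝ W x v = 0 := by
  have hi : Integrable (fun x => fderiv ℝ W x v) :=
    ((hW.continuous_fderiv (by norm_num)).clm_apply continuous_const).integrable_of_hasCompactSupport
      (hc.fderiv_apply ℝ v)
  refine ⟨hi, ?_⟩
  have h := integral_mul_fderiv_eq_neg_fderiv_mul_of_integrable (μ := (volume : Measure (Mink d)))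
    (f := fun _ => (1 : ℝ)) (g := W) (v := v) (by simp) (by simpa using hi)
    (by simpa using hW.continuous.integrable_of_hasCompactSupport hc)
    (fun x _ => differentiableAt_const _) (fun x _ => hW.differentiable (by norm_num) x)
  simpa using h

/-- W is controlled only inside U; vanishing off a compact part of U allows an extension by zero, to
which integration by parts on the whole space applies. -/
lemma contDiff_indicator {U K : Set (Mink d)} (hU : IsOpen U) (hK : IsCompact K) (hKU : K ⊆ U)
    {W : Mink d → ℝ} (hW : ContDiffOn ℝ 1 W U) (h0 : ∀ x ∈ U, x ∉ K → W x = 0) :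
    ContDiff ℝ 1 (U.indicator W) ∧ HasCompactSupport (U.indicator W) ∧
      ∀ x ∉ K, U.indicator W =ᶠ[𝓝 x] 0 := by
  have hz : ∀ x ∉ K, U.indicator W x = 0 := by
    intro x hx
    by_cases hxU : x ∈ U
    · rw [indicator_of_mem hxU, h0 x hxU hx]
    · exact indicator_of_notMem hxU _
  have hz' : ∀ x ∉ K, U.indicator W =ᶠ[𝓝 x] 0 := by
    intro x hx
    filter_upwards [hK.isClosed.isOpen_compl.mem_nhds hx] with y hy
    exact hz y hy
  refine ⟨contDiff_iff_contDiffAt.2 fun x => ?_, HasCompactSupport.intro hK hz, hz'⟩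
  by_cases hx : x ∈ U
  · refine (hW.contDiffAt (hU.mem_nhds hx)).congr_of_eventuallyEq ?_
    filter_upwards [hU.mem_nhds hx] with y hy
    exact indicator_of_mem hy _
  · exact contDiffAt_const.congr_of_eventuallyEq (hz' x fun h => hx (hKU h))

/-- Green's formula in the cone, for the weight `φ (‖x‖₋)`. -/
theorem integral_mdot_add_wave {U K : Set (Mink d)} (hU : IsOpen U) (hUF : U ⊆ futureCone d)
    (hK : IsCompact K) (hKU : K ⊆ U) {φ : ℝ → ℝ} (hφ : ContDiff ℝ ∞ φ) {u : Mink d → ℝ}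
    (hu : ContDiffOn ℝ 1 u U) {f : Hyp d → ℝ} (hf : IsSmoothHyp f)
    (h0 : ∀ x ∈ U, x ∉ K → ∀ v, φ (mnorm x) * u x * fderiv ℝ (zeroExt f) x v = 0) :
    IntegrableOn (fun x => φ (mnorm x) * (mdot u (zeroExt f) x + u x * wave (zeroExt f) x)) U ∧
    ∫ x in U, φ (mnorm x) * (mdot u (zeroExt f) x + u x * wave (zeroExt f) x) = 0 := by
  -- The signed divergence of these fields is the integrand: the term differentiating φ(‖x‖₋) is a
  -- multiple of ⟨∇‖x‖₋, ∇f⟩₋ = 0.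
  set W : Fin d ⊕ Unit → Mink d → ℝ := fun i =>
    U.indicator fun x => φ (mnorm x) * u x * fderiv ℝ (zeroExt f) x (minkBasis d i)
  have hφU : ContDiffOn ℝ 1 (fun x : Mink d => φ (mnorm x)) U :=
    (hφ.comp_contDiffOn (contDiffOn_mnorm.mono hUF)).of_le (by exact_mod_cast le_top)
  have hfU : ∀ v, ContDiffOn ℝ 1 (fun x => fderiv ℝ (zeroExt f) x v) U := fun v =>
    ((ContDiffOn.fderiv_of_isOpen (m := 1) hf (isOpen_futureCone d)
      (by norm_cast)).clm_apply contDiffOn_const).mono hUF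
  have hW := fun i => contDiff_indicator hU hK hKU ((hφU.mul hu).mul (hfU (minkBasis d i)))
    (fun x hx hxK => h0 x hx hxK _)
  have hint := fun i => integral_fderiv_eq_zero (hW i).1 (hW i).2.1 (minkBasis d i)
  have hsum : ∀ x, ∑ i, minkSign d i * fderiv ℝ (W i) x (minkBasis d i) =
      U.indicator (fun x => φ (mnorm x) *
        (mdot u (zeroExt f) x + u x * wave (zeroExt f) x)) x := by
    intro x
    by_cases hx : x ∈ U
    · rw [indicator_of_mem hx]
      have hn := hU.mem_nhds hx
      have hxF := hUF hx
      have d1 : DifferentiableAt ℝ (fun x : Mink d => φ (mnorm x)) x :=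
        (hφU.contDiffAt hn).differentiableAt (by norm_num)
      have d2 : DifferentiableAt ℝ u x := (hu.contDiffAt hn).differentiableAt (by norm_num)
      have d3 : ∀ v, DifferentiableAt ℝ (fun x => fderiv ℝ (zeroExt f) x v) x := fun v =>
        ((hfU v).contDiffAt hn).differentiableAt (by norm_num)
      have e1 : fderiv ℝ (fun x : Mink d => φ (mnorm x)) x
          = deriv φ (mnorm x) • fderiv ℝ mnorm x :=
        ((hφ.differentiable (by simp) (mnorm x)).hasDerivAt.comp_hasFDerivAt x
          (differentiableAt_mnorm hxF).hasFDerivAt).fderiv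
      have hd : ∀ i, fderiv ℝ (W i) x (minkBasis d i) =
          deriv φ (mnorm x) * u x * (fderiv ℝ mnorm x (minkBasis d i) *
            fderiv ℝ (zeroExt f) x (minkBasis d i)) +
          φ (mnorm x) * (fderiv ℝ u x (minkBasis d i) *
            fderiv ℝ (zeroExt f) x (minkBasis d i)) +
          φ (mnorm x) * u x *
            fderiv ℝ (fderiv ℝ (zeroExt f)) x (minkBasis d i) (minkBasis d i) := by
        intro i
        have he : W i =ᶠ[𝓝 x] fun x =>
            φ (mnorm x) * u x * fderiv ℝ (zeroExt f) x (minkBasis d i) := by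
          filter_upwards [hn] with y hy
          exact indicator_of_mem hy _
        rw [he.fderiv_eq, fderiv_fun_mul (d1.fun_mul d2) (d3 _), fderiv_fun_mul d1 d2, e1,
          fderiv_fderiv_apply ((hf.contDiffAt hxF).of_le two_le_contDiff_infty)]
        simp only [add_apply, smul_apply, smul_eq_mul]
        ring
      have hE := mdot_mnorm_zeroExt hf hxF
      rw [mdot] at hE
      simp only [hd, wave_eq, mdot, mul_add, Finset.sum_add_distrib, Finset.mul_sum]
      have : ∑ i, minkSign d i * (deriv φ (mnorm x) * u x * (fderiv ℝ mnorm x (minkBasis d i) *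
            fderiv ℝ (zeroExt f) x (minkBasis d i))) = 0 := by
        have := congrArg (fun t => deriv φ (mnorm x) * u x * t) hE
        simp only [Finset.mul_sum, mul_zero] at this
        rw [← this]
        exact Finset.sum_congr rfl fun i _ => by ring
      rw [this, zero_add]
      congr 1 <;> exact Finset.sum_congr rfl fun i _ => by ring
    · rw [indicator_of_notMem hx]
      refine Finset.sum_eq_zero fun i _ => ?_
      rw [((hW i).2.2 x fun h => hx (hKU h)).fderiv_eq]
      simp
  have hI : Integrable (fun x => ∑ i, minkSign d i * fderiv ℝ (W i) x (minkBasis d i)) :=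
    integrable_finsetSum _ fun i _ => (hint i).1.const_mul _
  constructor
  · rw [← integrable_indicator_iff hU.measurableSet]
    exact hI.congr (Filter.Eventually.of_forall hsum)
  · rw [← integral_indicator hU.measurableSet, ← integral_congr_ae (Filter.Eventually.of_forall hsum),
      integral_finsetSum _ fun i _ => (hint i).1.const_mul _]
    refine Finset.sum_eq_zero fun i _ => ?_
    rw [integral_const_mul, (hint i).2, mul_zero]

/-! ## Self-adjointness of the Laplacian -/

lemma lap_eq_zero_of_eventually {f : Hyp d → ℝ} {x : Hyp d} (h : f =ᶠ[𝓝 x] 0) : lap f x = 0 := by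
  have h1 : zeroExt f =ᶠ[𝓝 (x : Mink d)] 0 := by
    have hc : ContinuousAt (hypProj : Mink d → Hyp d) x :=
      continuousOn_hypProj.continuousAt ((isOpen_futureCone d).mem_nhds x.mem_cone)
    have := hc.eventually (by rw [hypProj_hyp]; exact h)
    exact this
  rw [lap, wave_congr h1, wave_eq]
  have : fderiv ℝ (0 : Mink d → ℝ) = 0 := by funext y; simp [Pi.zero_def]
  simp [this]

lemma HasCompactSupport.lap {f : Hyp d → ℝ} (hf : HasCompactSupport f) :
    HasCompactSupport (lap f) := by
  refine HasCompactSupport.intro hf fun x hx => ?_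
  exact lap_eq_zero_of_eventually (notMem_tsupport_iff_eventuallyEq.1 hx)

/-- The compact piece of the cone over `Z ⊆ ℍ^d` between radii `a` and `b`. -/
def coneOver (a b : ℝ) (Z : Set (Hyp d)) : Set (Mink d) :=
  (fun p : ℝ × Hyp d => p.1 • (p.2 : Mink d)) '' (Icc a b ×ˢ Z)

lemma isCompact_coneOver (a b : ℝ) {Z : Set (Hyp d)} (hZ : IsCompact Z) :
    IsCompact (coneOver a b Z) :=
  (isCompact_Icc.prod hZ).image (by fun_prop)

lemma coneOver_subset {a b : ℝ} (ha : 0 < a) (Z : Set (Hyp d)) : coneOver a b Z ⊆ futureCone d := by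
  rintro _ ⟨⟨t, z⟩, ⟨ht, _⟩, rfl⟩
  exact smul_mem_futureCone z.mem_cone (ha.trans_le ht.1)

lemma mem_coneOver {a b : ℝ} {Z : Set (Hyp d)} {x : Mink d} (hx : x ∈ futureCone d)
    (hab : mnorm x ∈ Icc a b) (hZ : hypProj x ∈ Z) : x ∈ coneOver a b Z :=
  ⟨(mnorm x, hypProj x), ⟨hab, hZ⟩, mnorm_smul_hypProj hx⟩

lemma exists_bump {a b : ℝ} (hab : a < b) : ∃ φ : ℝ → ℝ, ContDiff ℝ ∞ φ ∧ (∀ t, 0 ≤ φ t) ∧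
    (∀ t ∉ Icc a b, φ t = 0) ∧ 0 < φ ((a + b) / 2) := by
  let β : ContDiffBump ((a + b) / 2) :=
    { rIn := (b - a) / 4, rOut := (b - a) / 2, rIn_pos := by linarith, rIn_lt_rOut := by linarith }
  refine ⟨β, β.contDiff, fun t => β.nonneg, fun t ht => β.zero_of_le_dist ?_, ?_⟩
  · show (b - a) / 2 ≤ dist t ((a + b) / 2)
    rw [Real.dist_eq]
    rw [mem_Icc, not_and_or, not_le, not_le] at ht
    rcases ht with h | h
    · rw [abs_of_neg (by linarith)]; linarith
    · rw [abs_of_pos (by linarith)]; linarith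
  · rw [β.one_of_mem_closedBall (Metric.mem_closedBall_self β.rIn_pos.le)]
    exact one_pos

lemma integral_bump_pos {φ : ℝ → ℝ} (hφ : Continuous φ) (h0 : ∀ t, 0 ≤ φ t) {a b : ℝ} (ha : 0 < a)
    (hab : a < b) (hs : ∀ t ∉ Icc a b, φ t = 0) (hp : 0 < φ ((a + b) / 2)) (n : ℕ) :
    0 < ∫ t in Ioi (0 : ℝ), t ^ n * φ t := by
  have h1 : ∫ t in Ioi (0 : ℝ), t ^ n * φ t = ∫ t in Icc a b, t ^ n * φ t := by
    refine setIntegral_eq_of_subset_of_forall_sdiff_eq_zero measurableSet_Ioi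
      (fun t ht => ha.trans_le ht.1) fun t ht => ?_
    rw [hs t ht.2, mul_zero]
  rw [h1, integral_Icc_eq_integral_Ioc, ← intervalIntegral.integral_of_le hab.le]
  refine intervalIntegral.integral_pos hab (by fun_prop) (fun t ht => ?_)
    ⟨(a + b) / 2, ⟨by linarith, by linarith⟩, ?_⟩
  · exact mul_nonneg (pow_nonneg (ha.trans ht.1).le _) (h0 t)
  · exact mul_pos (pow_pos (by linarith) _) hp

lemma zeroExt_eventually_zero {f : Hyp d → ℝ} {x : Mink d} (hx : x ∈ futureCone d)
    (hn : hypProj x ∉ tsupport f) : zeroExt f =ᶠ[𝓝 x] 0 := by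
  have hc : ContinuousAt (hypProj : Mink d → Hyp d) x :=
    continuousOn_hypProj.continuousAt ((isOpen_futureCone d).mem_nhds hx)
  exact hc.eventually (notMem_tsupport_iff_eventuallyEq.1 hn)

/-- The Laplacian is symmetric for the hyperbolic volume. -/
theorem integral_mul_lap {f g : Hyp d → ℝ} (hf : IsTest f) (hg : IsSmoothHyp g) :
    ∫ x, g x * lap f x ∂(hypVol d) = ∫ x, f x * lap g x ∂(hypVol d) := by
  obtain ⟨ψ, hψ, hψ0, hψs, hψp⟩ := exists_bump (show (1 : ℝ) < 2 by norm_num)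
  have hpos := integral_bump_pos hψ.continuous hψ0 one_pos one_lt_two hψs hψp d
  -- The factor t² compensates the ‖x‖₋⁻² relating the wave operator to the Laplacian on extensions
  -- constant along rays.
  set φ : ℝ → ℝ := fun t => t ^ 2 * ψ t
  have hφ : ContDiff ℝ ∞ φ := (contDiff_id.pow 2).mul hψ
  set K := coneOver 1 2 (tsupport f)
  have hK : IsCompact K := isCompact_coneOver 1 2 hf.2
  have hKF : K ⊆ futureCone d := coneOver_subset one_pos _
  have hzero : ∀ x ∈ futureCone d, x ∉ K → φ (mnorm x) = 0 ∨ hypProj x ∉ tsupport f := by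
    intro x hx hxK
    by_contra! h
    refine hxK (mem_coneOver hx ?_ h.2)
    by_contra hm
    exact h.1 (by simp only [φ, hψs _ hm, mul_zero])
  have h1 := integral_mdot_add_wave (isOpen_futureCone d) subset_rfl hK hKF hφ
    (u := zeroExt g) (ContDiffOn.of_le hg (by exact_mod_cast le_top)) hf.1 (by
      intro x hx hxK v
      rcases hzero x hx hxK with h | h
      · rw [h]; ring
      · rw [(zeroExt_eventually_zero hx h).fderiv_eq]; simp [Pi.zero_def])
  have h2 := integral_mdot_add_wave (isOpen_futureCone d) subset_rfl hK hKF hφ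
    (u := zeroExt f) (ContDiffOn.of_le hf.1 (by exact_mod_cast le_top)) hg (by
      intro x hx hxK v
      rcases hzero x hx hxK with h | h
      · rw [h]; ring
      · rw [(zeroExt_eventually_zero hx h).eq_of_nhds]; simp)
  -- The gradient products are symmetric in f and g and cancel in the difference of the two Green
  -- formulas.
  have h3 := integral_sub h1.1 h2.1
  rw [h1.2, h2.2, sub_zero] at h3
  have hfl : Continuous (lap f) := hf.1.lap.continuous
  have hgl : Continuous (lap g) := hg.lap.continuous
  have h4 : ∫ x in futureCone d, ψ (mnorm x) *
      zeroExt (fun y => g y * lap f y - f y * lap g y) x = 0 := by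
    rw [← h3]
    refine setIntegral_congr_fun (measurableSet_futureCone d) fun x hx => ?_
    rw [wave_zeroExt f hx, wave_zeroExt g hx, mdot_comm (zeroExt f)]
    have := (mnorm_pos hx).ne'
    simp only [φ, zeroExt]
    field_simp
    ring
  rw [integral_polar (f := fun y => g y * lap f y - f y * lap g y) hψ.continuous ((hg.continuous.mul hfl).sub (hf.1.continuous.mul hgl))] at h4
  have h5 := (mul_eq_zero.1 h4).resolve_left hpos.ne'
  rw [integral_sub] at h5
  · linarith
  · exact (hg.continuous.mul hfl).integrable_of_hasCompactSupport hf.2.lap.mul_left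
  · exact (hf.1.continuous.mul hgl).integrable_of_hasCompactSupport hf.2.mul_right

/-! ## The Laplacian of radial functions -/

lemma deriv_rpow_neg_half {t : ℝ} :
    deriv (fun t : ℝ => t ^ (-(1 / 2) : ℝ)) t = -(1 / 2) * t ^ (-(3 / 2) : ℝ) := by
  rw [Real.deriv_rpow_const]
  norm_num

lemma deriv2_rpow_neg_half :
    deriv (deriv fun t : ℝ => t ^ (-(1 / 2) : ℝ)) 1 = 3 / 4 := by
  have h : deriv (fun t : ℝ => t ^ (-(1 / 2) : ℝ)) =ᶠ[𝓝 1] fun t => -(1 / 2) * t ^ (-(3 / 2) : ℝ) := by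
    filter_upwards [lt_mem_nhds (show (0 : ℝ) < 1 by norm_num)] with t ht
    exact deriv_rpow_neg_half
  rw [h.deriv_eq, deriv_const_mul_field, Real.deriv_rpow_const]
  norm_num

lemma mnorm_inv_eq {x : Mink d} (hx : x ∈ futureCone d) :
    (mnorm x)⁻¹ = (-mink x x) ^ (-(1 / 2) : ℝ) := by
  have := hx.1
  rw [mnorm, Real.sqrt_eq_rpow, ← Real.rpow_neg (by linarith)]

/-- The Laplacian of a function of `s = -⟨x, y⟩₋ = cosh d(x, y)`. -/
theorem lap_radial (x : Hyp d) {R : ℝ → ℝ} (hR : ContDiff ℝ ∞ R) (y : Hyp d) :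
    lap (fun y : Hyp d => R (-mink (x : Mink d) y)) y =
      ((-mink (x : Mink d) y) ^ 2 - 1) * deriv (deriv R) (-mink (x : Mink d) y)
        + d * (-mink (x : Mink d) y) * deriv R (-mink (x : Mink d) y) := by
  set s := -mink (x : Mink d) y with hs
  set l : Mink d → ℝ := fun z => minkL d (-(x : Mink d)) z with hl
  set q : Mink d → ℝ := fun z => -mink z z with hq
  set P : ℝ → ℝ := fun t => t ^ (-(1 / 2) : ℝ) with hP
  have hqy : q y = 1 := by simp [hq, y.2.1]
  have hly : l y = s := by simp [hl, hs]
  have cl : ContDiff ℝ 2 l := (minkL d (-(x : Mink d))).contDiff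
  have cq : ContDiff ℝ 2 q :=
    ((contDiff_mink.comp (contDiff_id.prodMk contDiff_id)).neg).of_le two_le_contDiff_infty
  have cP : ContDiffAt ℝ 2 P (q y) := by
    rw [hqy]; exact Real.contDiffAt_rpow_const_of_ne one_ne_zero
  have cPq : ContDiffAt ℝ 2 (fun z => P (q z)) (y : Mink d) := cP.comp _ cq.contDiffAt
  have dq : fderiv ℝ q y = minkL d ((-2 : ℝ) • (y : Mink d)) := fderiv_mink_self _
  have dl : ∀ z, fderiv ℝ l z = minkL d (-(x : Mink d)) := fun z =>
    (minkL d (-(x : Mink d))).fderiv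
  have dP1 : deriv P 1 = -(1 / 2) := by rw [hP, deriv_rpow_neg_half]; simp
  have dPq : fderiv ℝ (fun z => P (q z)) y = minkL d (y : Mink d) := by
    have h1 : HasDerivAt P (-(1 / 2)) (q y) := by
      rw [← dP1, hqy]
      rw [hqy] at cP
      exact (cP.differentiableAt (by norm_num)).hasDerivAt
    have := h1.comp_hasFDerivAt (y : Mink d) (cq.differentiable (by norm_num) _).hasFDerivAt
    rw [show (fun z => P (q z)) = P ∘ q from rfl, this.fderiv, dq, map_smul, smul_smul]
    norm_num
  -- Off ℍ^d the extension is R(σ) with σ(z) = -⟨x, z⟩₋ (-⟨z, z⟩₋)^(-1/2). The chain rule then needs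
  -- only ⟨∇σ, ∇σ⟩₋ = s² - 1 and □σ = d s at y.
  have hev : ∀ᶠ z in 𝓝 (y : Mink d), zeroExt (fun y : Hyp d => R (-mink (x : Mink d) y)) z
      = R (l z * P (q z)) := by
    filter_upwards [(isOpen_futureCone d).mem_nhds y.mem_cone] with z hz
    simp only [zeroExt, hypProj_coe hz, mink_smul_right, mnorm_inv_eq hz, hl, minkL_apply,
      mink_neg_left, hP, hq]
    congr 1
    ring
  have cσ : ContDiffAt ℝ 2 (fun z => l z * P (q z)) (y : Mink d) := cl.contDiffAt.mul cPq
  have hσ : l y * P (q y) = s := by rw [hqy, hly]; simp [hP]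
  have hPy : P (q y) = 1 := by rw [hqy]; simp [hP]
  have dσ : fderiv ℝ (fun z => l z * P (q z)) y = minkL d (-(x : Mink d) + s • (y : Mink d)) := by
    rw [fderiv_fun_mul (cl.differentiable (by norm_num) _) (cPq.differentiableAt (by norm_num)),
      dPq, dl, hly, hPy, one_smul, map_add, map_smul, add_comm]
  have wl : wave l y = 0 := by
    have : fderiv ℝ l = fun _ => minkL d (-(x : Mink d)) := funext dl
    rw [wave_eq, this]
    simp
  have wP : wave (fun z => P (q z)) y = d - 2 := by
    rw [wave_comp cq.contDiffAt cP, hqy, dP1, hP, deriv2_rpow_neg_half, mdot_of_fderiv_left dq,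
      dq, minkL_apply, mink_smul_smul, y.2.1, wave_mink_self]
    ring
  have wσ : wave (fun z => l z * P (q z)) y = d * s := by
    rw [wave_mul cl.contDiffAt cPq, wl, wP, mdot_of_fderiv_left (dl _), dPq, hly, minkL_apply,
      mink_neg_right, mink_comm, ← hs]
    ring
  rw [lap, wave_congr hev, wave_comp cσ (hR.of_le two_le_contDiff_infty).contDiffAt, hσ,
    wσ, mdot_of_fderiv_left dσ, dσ, minkL_apply]
  have : mink (-(x : Mink d) + s • (y : Mink d)) (-(x : Mink d) + s • (y : Mink d)) = s ^ 2 - 1 := by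
    simp only [mink_add_left, mink_add_right, mink_neg_left, mink_neg_right, mink_smul_left,
      mink_smul_right, x.2.1, y.2.1, mink_comm (y : Mink d) x]
    rw [show mink (x : Mink d) y = -s by rw [hs, neg_neg]]
    ring
  rw [this]
  ring

lemma isSmoothHyp_radial (x : Hyp d) {R : ℝ → ℝ} (hR : ContDiff ℝ ∞ R) :
    IsSmoothHyp fun y : Hyp d => R (-mink (x : Mink d) y) :=
  isSmoothHyp_of_contDiffOn (F := fun y => R (-mink (x : Mink d) y))
    (hR.comp (contDiff_mink.comp (contDiff_const.prodMk contDiff_id)).neg).contDiffOn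

lemma isTest_radial (x : Hyp d) {R : ℝ → ℝ} (hR : ContDiff ℝ ∞ R) {S : ℝ}
    (hS : ∀ s, S < s → R s = 0) : IsTest fun y : Hyp d => R (-mink (x : Mink d) y) := by
  refine ⟨isSmoothHyp_radial x hR, HasCompactSupport.intro (isCompact_hyp_le x S) fun y hy => ?_⟩
  exact hS _ (not_le.1 hy)

end Calculus

/-! ### Radial kernels, their masses, and cut-offs. -/

section Kernels

variable {d : ℕ}

/-! ## Radial kernels -/

/-- `1 / (v_{d-1} (σ² - 1)^{d/2} σ²)`. -/
noncomputable def radialWeight (d : ℕ) (σ : ℝ) : ℝ :=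
  1 / (sphereArea d * Real.sqrt (σ ^ 2 - 1) ^ d * σ ^ 2)

/-- `(s² - 1) / (v_{d-1} (s² - 1)^{d/2} s)`. -/
noncomputable def massDensity (d : ℕ) (s : ℝ) : ℝ :=
  (s ^ 2 - 1) / (sphereArea d * Real.sqrt (s ^ 2 - 1) ^ d * s)

/-- The kernel `-s ∫_s^∞ θ(σ) / (v_{d-1} (σ² - 1)^{d/2} σ²) dσ`; for `θ = 1` this is the Green
kernel as a function of `s = cosh ρ`, and `θ` is a cut-off. -/
noncomputable def cutKernel (d : ℕ) (θ : ℝ → ℝ) (s : ℝ) : ℝ :=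
  -s * ∫ σ in Ioi s, θ σ * radialWeight d σ

/-- Substitution σ = cosh t: the Jacobian sinh t lowers sinh^d to sinh^(d-1), and the minus sign is
that of the integral from +∞ to ρ. -/
lemma radialKernel_eq (hd : 1 ≤ d) {ρ : ℝ} (hρ : 0 ≤ ρ) :
    radialKernel d ρ = cutKernel d (fun _ => 1) (Real.cosh ρ) := by
  have himg : Real.cosh '' Ioi ρ = Ioi (Real.cosh ρ) := by
    ext s
    constructor
    · rintro ⟨t, ht, rfl⟩
      have ht : ρ < t := ht
      exact Real.cosh_lt_cosh.2 (by rwa [abs_of_nonneg hρ, abs_of_pos (by linarith)])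
    · intro hs
      have h1 : 1 ≤ s := (Real.one_le_cosh ρ).trans (le_of_lt hs)
      refine ⟨Real.arcosh s, ?_, Real.cosh_arcosh h1⟩
      have h2 : Real.cosh ρ < Real.cosh (Real.arcosh s) := by rw [Real.cosh_arcosh h1]; exact hs
      rwa [Real.cosh_lt_cosh, abs_of_nonneg hρ, abs_of_nonneg (Real.arcosh_nonneg h1)] at h2
  have hinj : InjOn Real.cosh (Ioi ρ) := fun a ha b hb h =>
    Real.cosh_injOn (hρ.trans (le_of_lt ha)) (hρ.trans (le_of_lt hb)) h
  have h := integral_image_eq_integral_abs_deriv_smul (measurableSet_Ioi (a := ρ))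
    (fun t _ => (Real.hasDerivAt_cosh t).hasDerivWithinAt) hinj
    (fun σ => 1 * radialWeight d σ)
  rw [cutKernel, ← himg, h, radialKernel]
  have hv := sphereArea_pos hd
  have h2 : ∫ t in Ioi ρ, |Real.sinh t| • (1 * radialWeight d (Real.cosh t)) =
      ∫ t in Ioi ρ, (sphereArea d)⁻¹ * (1 / (Real.sinh t ^ (d - 1) * Real.cosh t ^ 2)) := by
    refine setIntegral_congr_fun measurableSet_Ioi fun t ht => ?_
    have ht : 0 < t := lt_of_le_of_lt hρ ht
    have hs := Real.sinh_pos_iff.2 ht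
    have hc := Real.cosh_pos t
    have hsq : Real.sqrt (Real.cosh t ^ 2 - 1) = Real.sinh t := by
      rw [Real.cosh_sq, add_sub_cancel_right, Real.sqrt_sq hs.le]
    obtain ⟨k, rfl⟩ : ∃ k, d = k + 1 := ⟨d - 1, by omega⟩
    simp only [radialWeight, hsq, abs_of_pos hs, smul_eq_mul, Nat.add_sub_cancel]
    rw [pow_succ (Real.sinh t) k]
    field_simp
  rw [h2, integral_const_mul]
  unfold sphereArea
  ring

lemma greenKernel_eq (hd : 1 ≤ d) (x y : Hyp d) :
    greenKernel x y = cutKernel d (fun _ => 1) (-mink (x : Mink d) y) := by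
  rw [greenKernel, hypDist, radialKernel_eq hd (Real.arcosh_nonneg (x.one_le y)),
    Real.cosh_arcosh (x.one_le y)]

lemma radialWeight_nonneg (hd : 1 ≤ d) (σ : ℝ) : 0 ≤ radialWeight d σ := by
  have := sphereArea_pos hd
  unfold radialWeight
  positivity

lemma contDiffOn_radialWeight (hd : 1 ≤ d) : ContDiffOn ℝ ∞ (radialWeight d) (Ioi 1) := by
  have h1 : ContDiffOn ℝ ∞ (fun σ : ℝ => Real.sqrt (σ ^ 2 - 1)) (Ioi 1) :=
    ((contDiff_id.pow 2).sub contDiff_const).contDiffOn.sqrt fun σ hσ => by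
      have : (1 : ℝ) < σ := hσ
      simp only [id]; nlinarith
  refine contDiffOn_const.div ((contDiffOn_const.mul (h1.pow d)).mul (contDiffOn_id.pow 2)) ?_
  intro σ hσ
  have h : (1 : ℝ) < σ := hσ
  have h2 : 0 < Real.sqrt (σ ^ 2 - 1) := Real.sqrt_pos.2 (by nlinarith)
  have := sphereArea_pos hd
  have h3 : 0 < σ := by linarith
  positivity

lemma contDiffOn_massDensity (hd : 1 ≤ d) : ContDiffOn ℝ ∞ (massDensity d) (Ioi 1) := by
  have h1 : ContDiffOn ℝ ∞ (fun σ : ℝ => Real.sqrt (σ ^ 2 - 1)) (Ioi 1) :=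
    ((contDiff_id.pow 2).sub contDiff_const).contDiffOn.sqrt fun σ hσ => by
      have : (1 : ℝ) < σ := hσ
      simp only [id]; nlinarith
  refine ((contDiff_id.pow 2).sub contDiff_const).contDiffOn.div
    ((contDiffOn_const.mul (h1.pow d)).mul contDiffOn_id) ?_
  intro σ hσ
  have h : (1 : ℝ) < σ := hσ
  have h2 : 0 < Real.sqrt (σ ^ 2 - 1) := Real.sqrt_pos.2 (by nlinarith)
  have := sphereArea_pos hd
  have h3 : 0 < σ := by linarith
  positivity

/-- This logarithmic derivative is the reduction-of-order condition: s F(s) solves (s² - 1)R'' + d s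
R' - d R = 0 exactly when F''/F' = -d s/(s² - 1) - 2/s. -/
lemma hasDerivAt_radialWeight (hd : 1 ≤ d) {s : ℝ} (hs : 1 < s) :
    HasDerivAt (radialWeight d) (radialWeight d s * (-(d * s / (s ^ 2 - 1)) - 2 / s)) s := by
  have hq : 0 < s ^ 2 - 1 := by nlinarith
  have hr : 0 < Real.sqrt (s ^ 2 - 1) := Real.sqrt_pos.2 hq
  have hv := sphereArea_pos hd
  have h1 : HasDerivAt (fun σ : ℝ => σ ^ 2 - 1) (2 * s) s := by
    simpa using (hasDerivAt_pow 2 s).sub_const 1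
  have h2 := ((((h1.sqrt hq.ne').pow d).const_mul (sphereArea d)).mul (hasDerivAt_pow 2 s))
  have hne : sphereArea d * Real.sqrt (s ^ 2 - 1) ^ d * s ^ 2 ≠ 0 := by positivity
  have h3 := h2.inv hne
  have h4 : radialWeight d = ((fun y => sphereArea d * ((fun y => Real.sqrt (y ^ 2 - 1)) ^ d) y) *
      fun x => x ^ 2)⁻¹ := by
    funext σ
    simp [radialWeight]
  rw [h4]
  refine h3.congr_deriv ?_
  have hrs : Real.sqrt (s ^ 2 - 1) ^ 2 = s ^ 2 - 1 := Real.sq_sqrt hq.le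
  obtain ⟨k, rfl⟩ : ∃ k, d = k + 1 := ⟨d - 1, by omega⟩
  simp only [Pi.mul_apply, Pi.pow_apply, Pi.inv_apply, Nat.add_sub_cancel]
  set r := Real.sqrt (s ^ 2 - 1)
  rw [← hrs]
  have hs0 : s ≠ 0 := by linarith
  field_simp
  ring

/-- The product of a smooth function supported in `[b, ∞)`, `b > 1`, with a function that is smooth
on `(1, ∞)` is smooth. -/
lemma contDiff_mul_of_Ioi {θ g : ℝ → ℝ} (hθ : ContDiff ℝ ∞ θ) {b : ℝ} (hb : 1 < b)
    (h0 : ∀ s ≤ b, θ s = 0) (hg : ContDiffOn ℝ ∞ g (Ioi 1)) :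
    ContDiff ℝ ∞ fun s => θ s * g s := by
  rw [contDiff_iff_contDiffAt]
  intro s
  rcases lt_or_ge 1 s with hs | hs
  · exact hθ.contDiffAt.mul (hg.contDiffAt (Ioi_mem_nhds hs))
  · refine contDiffAt_const (c := (0 : ℝ)) |>.congr_of_eventuallyEq ?_
    filter_upwards [Iio_mem_nhds (lt_of_le_of_lt hs hb)] with t ht
    rw [h0 t (le_of_lt ht), zero_mul]

/-- An admissible cut-off: smooth, compactly supported in `(1, ∞)`. -/
structure IsCut (θ : ℝ → ℝ) (b S : ℝ) : Prop where
  smooth : ContDiff ℝ ∞ θ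
  one_lt : 1 < b
  left : ∀ s ≤ b, θ s = 0
  right : ∀ s, S ≤ s → θ s = 0

lemma integral_Ioi_eq_interval {f : ℝ → ℝ} {S : ℝ} (h : ∀ s, S ≤ s → f s = 0) (s : ℝ) :
    ∫ σ in Ioi s, f σ = ∫ σ in s..S, f σ := by
  rcases le_or_gt s S with hs | hs
  · rw [intervalIntegral.integral_of_le hs]
    refine setIntegral_eq_of_subset_of_forall_sdiff_eq_zero measurableSet_Ioi
      (fun t ht => ht.1) fun t ht => h t ?_
    by_contra hc
    exact ht.2 ⟨ht.1, (not_le.1 hc).le⟩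
  · have h1 : ∫ σ in Ioi s, f σ = 0 :=
      setIntegral_eq_zero_of_forall_eq_zero fun t ht => h t (hs.le.trans (le_of_lt ht))
    have h2 : ∫ σ in Ioc S s, f σ = 0 :=
      setIntegral_eq_zero_of_forall_eq_zero fun t ht => h t (le_of_lt ht.1)
    rw [intervalIntegral.integral_symm, intervalIntegral.integral_of_le hs.le, h1, h2, neg_zero]

namespace IsCut

variable {θ : ℝ → ℝ} {b S : ℝ}

lemma smooth_weight (h : IsCut θ b S) (hd : 1 ≤ d) :
    ContDiff ℝ ∞ fun s => θ s * radialWeight d s :=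
  contDiff_mul_of_Ioi h.smooth h.one_lt h.left (contDiffOn_radialWeight hd)

lemma hasDerivAt_integral (h : IsCut θ b S) (hd : 1 ≤ d) (s : ℝ) :
    HasDerivAt (fun s => ∫ σ in Ioi s, θ σ * radialWeight d σ) (-(θ s * radialWeight d s)) s := by
  have hc := (h.smooth_weight hd).continuous
  have he : (fun s => ∫ σ in Ioi s, θ σ * radialWeight d σ) =
      fun s => ∫ σ in s..S, θ σ * radialWeight d σ :=
    funext fun s => integral_Ioi_eq_interval (fun t ht => by rw [h.right t ht, zero_mul]) s
  rw [he]
  exact intervalIntegral.integral_hasDerivAt_left (hc.intervalIntegrable _ _)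
    hc.stronglyMeasurable.stronglyMeasurableAtFilter hc.continuousAt

lemma smooth_kernel (h : IsCut θ b S) (hd : 1 ≤ d) : ContDiff ℝ ∞ (cutKernel d θ) := by
  refine contDiff_neg.mul ?_
  rw [contDiff_infty_iff_deriv]
  refine ⟨fun s => (h.hasDerivAt_integral hd s).differentiableAt, ?_⟩
  rw [show deriv (fun s => ∫ σ in Ioi s, θ σ * radialWeight d σ) =
    fun s => -(θ s * radialWeight d s) from funext fun s => (h.hasDerivAt_integral hd s).deriv]
  exact (h.smooth_weight hd).neg

lemma kernel_eq_zero (h : IsCut θ b S) {s : ℝ} (hs : S < s) : cutKernel d θ s = 0 := by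
  rw [cutKernel, setIntegral_eq_zero_of_forall_eq_zero fun t ht => by
    rw [h.right t (hs.le.trans (le_of_lt ht)), zero_mul], mul_zero]

lemma isTest (h : IsCut θ b S) (hd : 1 ≤ d) (x : Hyp d) :
    IsTest fun y : Hyp d => cutKernel d θ (-mink (x : Mink d) y) :=
  isTest_radial x (h.smooth_kernel hd) fun _ hs => h.kernel_eq_zero hs

lemma deriv_left (h : IsCut θ b S) {s : ℝ} (hs : s < b) : deriv θ s = 0 := by
  have : θ =ᶠ[𝓝 s] fun _ => 0 := by
    filter_upwards [Iio_mem_nhds hs] with t ht using h.left t (le_of_lt ht)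
  rw [this.deriv_eq, deriv_const]

/-- Write the kernel as -s F with F' = -θ w. All terms in F cancel because s is a homogeneous
solution, all terms in θ w cancel by the logarithmic derivative of w, and only (s² - 1) s θ' w,
which is θ' times the mass density, remains. -/
lemma lap_kernel (h : IsCut θ b S) (hd : 1 ≤ d) (x y : Hyp d) :
    1 / (d : ℝ) * lap (fun y : Hyp d => cutKernel d θ (-mink (x : Mink d) y)) y
      - cutKernel d θ (-mink (x : Mink d) y) =
    1 / (d : ℝ) * (deriv θ (-mink (x : Mink d) y) * massDensity d (-mink (x : Mink d) y)) := by
  have hd0 : (d : ℝ) ≠ 0 := by positivity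
  rw [lap_radial x (h.smooth_kernel hd)]
  set s := -mink (x : Mink d) y with hs
  have hs1 : 1 ≤ s := x.one_le y
  set F := fun s => ∫ σ in Ioi s, θ σ * radialWeight d σ with hF
  set p := fun s => θ s * radialWeight d s with hp
  have hpd : Differentiable ℝ p := (h.smooth_weight hd).differentiable (by simp)
  have hFd : ∀ s, HasDerivAt F (-(p s)) s := h.hasDerivAt_integral hd
  have h1 : deriv (cutKernel d θ) = fun s => -F s + s * p s := by
    funext t
    have := ((hasDerivAt_id t).neg.mul (hFd t)).deriv
    rw [show cutKernel d θ = (-id) * F from rfl, this]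
    simp
  have h2 : deriv (deriv (cutKernel d θ)) s = 2 * p s + s * deriv p s := by
    rw [h1]
    have := ((hFd s).neg.add ((hasDerivAt_id s).mul (hpd s).hasDerivAt)).deriv
    rw [show (fun s => -F s + s * p s) = (-F + id * p) from rfl, this]
    simp
    ring
  rw [h2, h1]
  beta_reduce
  have hK : cutKernel d θ s = -s * F s := rfl
  rw [hK]
  -- The weight is singular at s = 1, the centre itself; there θ vanishes in a neighbourhood and
  -- both sides are 0.
  rcases hs1.eq_or_lt with h11 | h11
  · have hsb : s < b := by rw [← h11]; exact h.one_lt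
    have hp0 : p s = 0 := by simp only [hp, h.left s hsb.le, zero_mul]
    rw [h.deriv_left hsb, hp0, ← h11]
    field_simp
    ring
  · have hw := hasDerivAt_radialWeight hd h11
    have hp' : deriv p s = deriv θ s * radialWeight d s + θ s *
        (radialWeight d s * (-(d * s / (s ^ 2 - 1)) - 2 / s)) :=
      ((h.smooth.differentiable (by simp) s).hasDerivAt.mul hw).deriv
    have hq : 0 < s ^ 2 - 1 := by nlinarith
    have hm : massDensity d s = (s ^ 2 - 1) * s * radialWeight d s := by
      have hr : 0 < Real.sqrt (s ^ 2 - 1) := Real.sqrt_pos.2 hq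
      have hv := sphereArea_pos hd
      have : s ≠ 0 := by linarith
      rw [massDensity, radialWeight]
      field_simp
    have hs0 : s ≠ 0 := by linarith
    rw [hp', hm]
    simp only [hp]
    field_simp
    ring

end IsCut

/-! ## The mass lemma -/

/-- A smooth monotone step from `0` on `(-∞, a]` to `1` on `[b, ∞)`. -/
structure IsStep (f : ℝ → ℝ) (a b : ℝ) : Prop where
  smooth : ContDiff ℝ ∞ f
  one_lt : 1 < a
  mono : Monotone f
  left : ∀ s ≤ a, f s = 0
  right : ∀ s, b ≤ s → f s = 1

namespace IsStep

variable {f : ℝ → ℝ} {a b : ℝ}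

lemma lt (h : IsStep f a b) : a < b := by
  by_contra hc
  have h1 := h.left a le_rfl
  rw [h.right a (not_lt.1 hc)] at h1
  norm_num at h1

lemma nonneg (h : IsStep f a b) (s : ℝ) : 0 ≤ f s := by
  rcases le_total s a with hs | hs
  · rw [h.left s hs]
  · rw [← h.left a le_rfl]; exact h.mono hs

lemma le_one (h : IsStep f a b) (s : ℝ) : f s ≤ 1 := by
  rcases le_total s b with hs | hs
  · rw [← h.right b le_rfl]; exact h.mono hs
  · rw [h.right s hs]

lemma deriv_nonneg (h : IsStep f a b) (s : ℝ) : 0 ≤ deriv f s := h.mono.deriv_nonneg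

lemma deriv_left (h : IsStep f a b) {s : ℝ} (hs : s < a) : deriv f s = 0 := by
  have : f =ᶠ[𝓝 s] fun _ => 0 := by
    filter_upwards [Iio_mem_nhds hs] with t ht using h.left t (le_of_lt ht)
  rw [this.deriv_eq, deriv_const]

lemma deriv_right (h : IsStep f a b) {s : ℝ} (hs : b < s) : deriv f s = 0 := by
  have : f =ᶠ[𝓝 s] fun _ => 1 := by
    filter_upwards [Ioi_mem_nhds hs] with t ht using h.right t (le_of_lt ht)
  rw [this.deriv_eq, deriv_const]

lemma deriv_mul (h : IsStep f a b) {g : ℝ → ℝ} {u v : ℝ} {s : ℝ}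
    (hg : a ≤ s → s ≤ b → u ≤ g s ∧ g s ≤ v) :
    deriv f s * u ≤ deriv f s * g s ∧ deriv f s * g s ≤ deriv f s * v := by
  rcases lt_or_ge s a with h1 | h1
  · simp [h.deriv_left h1]
  rcases lt_or_ge b s with h2 | h2
  · simp [h.deriv_right h2]
  exact ⟨mul_le_mul_of_nonneg_left (hg h1 h2).1 (h.deriv_nonneg s),
    mul_le_mul_of_nonneg_left (hg h1 h2).2 (h.deriv_nonneg s)⟩

lemma massDensity_nonneg (hd : 1 ≤ d) {s : ℝ} (hs : 1 ≤ s) : 0 ≤ massDensity d s := by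
  have := sphereArea_pos hd
  have h2 : 0 ≤ s ^ 2 - 1 := by nlinarith
  unfold massDensity
  positivity

lemma smooth_density (h : IsStep f a b) (hd : 1 ≤ d) :
    ContDiff ℝ ∞ fun s => deriv f s * massDensity d s := by
  have h1 : ContDiff ℝ ∞ (deriv f) := (contDiff_infty_iff_deriv.1 h.smooth).2
  have ha := h.one_lt
  exact contDiff_mul_of_Ioi h1 (b := (1 + a) / 2) (by linarith)
    (fun s hs => h.deriv_left (by linarith)) (contDiffOn_massDensity hd)

lemma isTest (h : IsStep f a b) (hd : 1 ≤ d) (x : Hyp d) : IsTest fun y : Hyp d =>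
    deriv f (-mink (x : Mink d) y) * massDensity d (-mink (x : Mink d) y) :=
  isTest_radial x (h.smooth_density hd) (S := b) fun s hs => by rw [h.deriv_right hs, zero_mul]

lemma density_nonneg (h : IsStep f a b) (hd : 1 ≤ d) (x y : Hyp d) :
    0 ≤ deriv f (-mink (x : Mink d) y) * massDensity d (-mink (x : Mink d) y) :=
  mul_nonneg (h.deriv_nonneg _) (massDensity_nonneg hd (x.one_le y))

lemma integrable_mul (h : IsStep f a b) (hd : 1 ≤ d) (x : Hyp d) {u : Hyp d → ℝ}
    (hu : Continuous u) : Integrable (fun y : Hyp d => u y *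
      (deriv f (-mink (x : Mink d) y) * massDensity d (-mink (x : Mink d) y))) (hypVol d) :=
  (hu.mul (h.isTest hd x).1.continuous).integrable_of_hasCompactSupport (h.isTest hd x).2.mul_left

/-- The total mass of the radial density of a step on `[a, b]` is between `1 / b` and `1 / a`. -/
theorem mass (h : IsStep f a b) (hd : 1 ≤ d) (x : Hyp d) :
    1 / b ≤ ∫ y : Hyp d, deriv f (-mink (x : Mink d) y) * massDensity d (-mink (x : Mink d) y)
      ∂(hypVol d) ∧
    ∫ y : Hyp d, deriv f (-mink (x : Mink d) y) * massDensity d (-mink (x : Mink d) y)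
      ∂(hypVol d) ≤ 1 / a := by
  have ha := h.one_lt
  have hab := h.lt
  have hv := sphereArea_pos hd
  rw [integral_radial hd x (fun s => deriv f s * massDensity d s), ← integral_const_mul]
  set S : ℝ → ℝ := fun r => Real.sqrt (1 + r ^ 2) with hS
  have hSpos : ∀ r, 0 < S r := fun r => Real.sqrt_pos.2 (by positivity)
  have hSd : ∀ r, HasDerivAt S (r / S r) r := by
    intro r
    have h1 : HasDerivAt (fun r : ℝ => 1 + r ^ 2) (2 * r) r := by
      simpa using (hasDerivAt_pow 2 r).const_add 1
    refine (h1.sqrt (by positivity)).congr_deriv ?_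
    have : Real.sqrt (1 + r ^ 2) ≠ 0 := (hSpos r).ne'
    simp only [hS]
    field_simp
  have hq : ∀ r, HasDerivAt (fun r => f (S r)) (deriv f (S r) * (r / S r)) r := fun r =>
    (h.smooth.differentiable (by simp) (S r)).hasDerivAt.comp r (hSd r)
  have htend : Filter.Tendsto (fun r => f (S r)) Filter.atTop (𝓝 1) := by
    refine tendsto_const_nhds.congr' ?_
    filter_upwards [Filter.eventually_ge_atTop b, Filter.eventually_ge_atTop 0] with r hr hr0
    refine (h.right _ (hr.trans ?_)).symm
    exact Real.le_sqrt_of_sq_le (by linarith)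
  have hint : IntegrableOn (fun r => deriv f (S r) * (r / S r)) (Ioi 0) :=
    integrableOn_Ioi_deriv_of_nonneg' (fun r _ => hq r)
      (fun r hr => mul_nonneg (h.deriv_nonneg _) (div_nonneg (le_of_lt hr) (hSpos r).le)) htend
  have hval : ∫ r in Ioi (0 : ℝ), deriv f (S r) * (r / S r) = 1 := by
    rw [integral_Ioi_of_hasDerivAt_of_tendsto' (fun r _ => hq r) hint htend]
    rw [h.left (S 0) (by simp [hS]; exact ha.le), sub_zero]
  -- The density is normalized so that, in the radial variable r with S = √(1 + r²), the integrand
  -- is (f ∘ S)'(r)/S(r). The total integral of (f ∘ S)' is 1, and S lies between a and b where f'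
  -- does not vanish.
  have hcongr : ∀ r ∈ Ioi (0 : ℝ), sphereArea d * (r ^ (d - 1) *
      (1 / S r * (deriv f (S r) * massDensity d (S r)))) =
      deriv f (S r) * (1 / S r) * (r / S r) := by
    intro r hr
    have hr : 0 < r := hr
    have h1 : S r ^ 2 - 1 = r ^ 2 := by
      simp only [hS]; rw [Real.sq_sqrt (by positivity)]; ring
    have := hSpos r
    obtain ⟨k, rfl⟩ : ∃ k, d = k + 1 := ⟨d - 1, by omega⟩
    rw [massDensity, h1, Real.sqrt_sq hr.le, Nat.add_sub_cancel]
    field_simp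
    ring
  rw [setIntegral_congr_fun measurableSet_Ioi hcongr]
  have hb : ∀ r ∈ Ioi (0 : ℝ), deriv f (S r) * (r / S r) * (1 / b) ≤
      deriv f (S r) * (1 / S r) * (r / S r) ∧
      deriv f (S r) * (1 / S r) * (r / S r) ≤ deriv f (S r) * (r / S r) * (1 / a) := by
    intro r hr
    have hr : 0 < r := hr
    have hrS : 0 ≤ r / S r := div_nonneg hr.le (hSpos r).le
    have h2 := h.deriv_mul (g := fun s => 1 / s) (s := S r) (u := 1 / b) (v := 1 / a)
      (fun h1 h2 => ⟨one_div_le_one_div_of_le (hSpos r) h2,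
        one_div_le_one_div_of_le (by linarith) h1⟩)
    constructor
    · have := mul_le_mul_of_nonneg_right h2.1 hrS
      linarith
    · have := mul_le_mul_of_nonneg_right h2.2 hrS
      linarith
  have hint2 : IntegrableOn (fun r => deriv f (S r) * (1 / S r) * (r / S r)) (Ioi 0) := by
    refine (hint.mul_const (1 / a)).mono' ?_ ?_
    · have c1 : Continuous (deriv f) := h.smooth.continuous_deriv (by simp)
      have c2 : Continuous S := by simp only [hS]; fun_prop
      have c3 : Continuous fun r => deriv f (S r) * (1 / S r) * (r / S r) :=
        ((c1.comp c2).mul (continuous_const.div c2 fun r => (hSpos r).ne')).mul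
          (continuous_id.div c2 fun r => (hSpos r).ne')
      exact c3.aestronglyMeasurable
    · filter_upwards [ae_restrict_mem measurableSet_Ioi] with r hr
      have hr' : 0 < r := hr
      rw [Real.norm_of_nonneg]
      · exact (hb r hr).2
      · have := hSpos r
        have := h.deriv_nonneg (S r)
        positivity
  constructor
  · calc 1 / b = ∫ r in Ioi (0 : ℝ), deriv f (S r) * (r / S r) * (1 / b) := by
          rw [integral_mul_const, hval, one_mul]
      _ ≤ _ := setIntegral_mono_on (hint.mul_const _) hint2 measurableSet_Ioi fun r hr => (hb r hr).1
  · calc _ ≤ ∫ r in Ioi (0 : ℝ), deriv f (S r) * (r / S r) * (1 / a) :=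
          setIntegral_mono_on hint2 (hint.mul_const _) measurableSet_Ioi fun r hr => (hb r hr).2
      _ = 1 / a := by rw [integral_mul_const, hval, one_mul]

end IsStep

/-! ## Cut-offs -/

/-- A step from `0` to `1` on `[1 + 1/n, 1 + 2/n]`. -/
noncomputable def innerStep (n : ℝ) (s : ℝ) : ℝ := Real.smoothTransition (n * (s - 1) - 1)

/-- A step from `0` to `1` on `[m, 2 m]`. -/
noncomputable def outerStep (m : ℝ) (s : ℝ) : ℝ := Real.smoothTransition (s / m - 1)

lemma isStep_innerStep {n : ℝ} (hn : 0 < n) : IsStep (innerStep n) (1 + 1 / n) (1 + 2 / n) where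
  smooth := by
    have : ContDiff ℝ ∞ Real.smoothTransition := Real.smoothTransition.contDiff
    exact this.comp ((contDiff_const.mul (contDiff_id.sub contDiff_const)).sub contDiff_const)
  one_lt := by have : 0 < 1 / n := by positivity
               linarith
  mono := fun s t h => Real.smoothTransition.monotone (by nlinarith)
  left := fun s hs => Real.smoothTransition.zero_of_nonpos (by
    have : n * (s - 1) ≤ n * (1 / n) := mul_le_mul_of_nonneg_left (by linarith) hn.le
    rw [mul_one_div_cancel hn.ne'] at this
    linarith)
  right := fun s hs => Real.smoothTransition.one_of_one_le (by
    have : n * (2 / n) ≤ n * (s - 1) := mul_le_mul_of_nonneg_left (by linarith) hn.le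
    rw [mul_div_cancel₀ _ hn.ne'] at this
    linarith)

lemma isStep_outerStep {m : ℝ} (hm : 1 < m) : IsStep (outerStep m) m (2 * m) where
  smooth := by
    have : ContDiff ℝ ∞ Real.smoothTransition := Real.smoothTransition.contDiff
    exact this.comp ((contDiff_id.div_const m).sub contDiff_const)
  one_lt := hm
  mono := fun s t h => Real.smoothTransition.monotone (by
    have := div_le_div_of_nonneg_right h (by linarith : (0 : ℝ) ≤ m)
    linarith)
  left := fun s hs => Real.smoothTransition.zero_of_nonpos (by
    have := div_le_one_of_le₀ hs (by linarith)
    linarith)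
  right := fun s hs => Real.smoothTransition.one_of_one_le (by
    have : 2 ≤ s / m := by rw [le_div_iff₀ (by linarith)]; exact hs
    linarith)

/-- The cut-off `θ = α (1 - β)` for an inner step `α` and an outer step `β`. -/
noncomputable def cutoff (n m : ℝ) (s : ℝ) : ℝ := innerStep n s * (1 - outerStep m s)

lemma isCut_cutoff {n m : ℝ} (hn : 0 < n) (hm : 1 < m) :
    IsCut (cutoff n m) (1 + 1 / n) (2 * m) where
  smooth := (isStep_innerStep hn).smooth.mul (contDiff_const.sub (isStep_outerStep hm).smooth)
  one_lt := (isStep_innerStep hn).one_lt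
  left := fun s hs => by rw [cutoff, (isStep_innerStep hn).left s hs, zero_mul]
  right := fun s hs => by rw [cutoff, (isStep_outerStep hm).right s hs, sub_self, mul_zero]

/-- The transition zones do not overlap: the inner step is complete at 1 + 2/n ≤ 2, and the outer
one starts at m ≥ 2. So the product behaves like a difference. -/
lemma deriv_cutoff {n m : ℝ} (hn : 2 ≤ n) (hm : 2 ≤ m) (s : ℝ) :
    deriv (cutoff n m) s = deriv (innerStep n) s - deriv (outerStep m) s := by
  have hi := isStep_innerStep (show 0 < n by linarith)
  have ho := isStep_outerStep (show 1 < m by linarith)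
  have hb : 1 + 2 / n ≤ 2 := by
    have := div_le_one_of_le₀ hn (by linarith)
    linarith
  have h1 := (hi.smooth.differentiable (by simp) s).hasDerivAt.mul
    ((ho.smooth.differentiable (by simp) s).hasDerivAt.const_sub 1)
  rw [show cutoff n m = innerStep n * fun s => 1 - outerStep m s from rfl, h1.deriv]
  rcases le_or_gt s 2 with h2 | h2
  · rw [ho.left s (h2.trans hm)]
    rcases h2.eq_or_lt with h3 | h3
    · rw [hi.right s (by linarith)]; ring
    · rw [ho.deriv_left (by linarith)]; ring
  · rw [hi.deriv_right (by linarith), hi.right s (by linarith)]; ring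

end Kernels

/-! ### Weak solutions and the Green representation. -/

section Green

variable {d : ℕ}

/-! ## Limits of kernels -/

lemma measurable_radialWeight (d : ℕ) : Measurable (radialWeight d) := by
  unfold radialWeight; fun_prop

/-- The factor σ⁻² gives integrability at infinity, and √(σ² - 1) is bounded below on (s, ∞) because
s > 1. -/
lemma integrableOn_radialWeight (hd : 1 ≤ d) {s : ℝ} (hs : 1 < s) :
    IntegrableOn (radialWeight d) (Ioi s) := by
  have hv := sphereArea_pos hd
  have hr : 0 < Real.sqrt (s ^ 2 - 1) := Real.sqrt_pos.2 (by nlinarith)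
  have h := (integrableOn_Ioi_rpow_of_lt (show (-2 : ℝ) < -1 by norm_num)
    (show 0 < s by linarith)).const_mul (1 / (sphereArea d * Real.sqrt (s ^ 2 - 1) ^ d))
  refine h.mono' (measurable_radialWeight d).aestronglyMeasurable ?_
  filter_upwards [ae_restrict_mem measurableSet_Ioi] with σ hσ
  have hσ : s < σ := hσ
  have hσ0 : 0 < σ := by linarith
  rw [Real.norm_of_nonneg (radialWeight_nonneg hd σ), Real.rpow_neg hσ0.le, radialWeight,
    ← one_div, div_mul_div_comm, one_mul]
  norm_cast
  apply one_div_le_one_div_of_le (by positivity)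
  have : Real.sqrt (s ^ 2 - 1) ≤ Real.sqrt (σ ^ 2 - 1) := Real.sqrt_le_sqrt (by nlinarith)
  gcongr

lemma measurable_cutKernel (d : ℕ) {θ : ℝ → ℝ} (hθ : Measurable θ) :
    Measurable (cutKernel d θ) := by
  refine measurable_neg.mul ?_
  have h : StronglyMeasurable fun p : ℝ × ℝ =>
      (Ioi p.1).indicator (fun σ => θ σ * radialWeight d σ) p.2 := by
    have h1 : Measurable fun p : ℝ × ℝ =>
        ({p : ℝ × ℝ | p.1 < p.2}).indicator (fun p => θ p.2 * radialWeight d p.2) p :=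
      ((hθ.comp measurable_snd).mul ((measurable_radialWeight d).comp measurable_snd)).indicator
        (measurableSet_lt measurable_fst measurable_snd)
    exact h1.stronglyMeasurable
  have h2 := (h.integral_prod_right' (ν := volume)).measurable
  simp only [integral_indicator measurableSet_Ioi] at h2
  exact h2

lemma cutKernel_mono (hd : 1 ≤ d) {θ η : ℝ → ℝ} (hθ : Measurable θ) (hη : Measurable η)
    (h0 : ∀ s, 0 ≤ θ s) (hle : ∀ s, θ s ≤ η s) (h1 : ∀ s, η s ≤ 1) {s : ℝ} (hs : 1 < s) :
    |cutKernel d θ s| ≤ |cutKernel d η s| := by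
  have hw := integrableOn_radialWeight hd hs
  have hint : ∀ ζ : ℝ → ℝ, Measurable ζ → (∀ s, 0 ≤ ζ s) → (∀ s, ζ s ≤ 1) →
      IntegrableOn (fun σ => ζ σ * radialWeight d σ) (Ioi s) := by
    intro ζ hζ h0 h1
    refine hw.mono' (hζ.mul (measurable_radialWeight d)).aestronglyMeasurable
      (Filter.Eventually.of_forall fun σ => ?_)
    rw [Real.norm_of_nonneg (mul_nonneg (h0 σ) (radialWeight_nonneg hd σ))]
    exact mul_le_of_le_one_left (radialWeight_nonneg hd σ) (h1 σ)
  have hη0 : ∀ s, 0 ≤ η s := fun s => (h0 s).trans (hle s)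
  rw [cutKernel, cutKernel, abs_mul, abs_mul,
    abs_of_nonneg (integral_nonneg fun σ => mul_nonneg (h0 σ) (radialWeight_nonneg hd σ)),
    abs_of_nonneg (integral_nonneg fun σ => mul_nonneg (hη0 σ) (radialWeight_nonneg hd σ))]
  refine mul_le_mul_of_nonneg_left (integral_mono (hint θ hθ h0 fun s => (hle s).trans (h1 s))
    (hint η hη hη0 h1) fun σ => ?_) (abs_nonneg _)
  exact mul_le_mul_of_nonneg_right (hle σ) (radialWeight_nonneg hd σ)

lemma cutKernel_nonpos (hd : 1 ≤ d) {θ : ℝ → ℝ} (h0 : ∀ s, 0 ≤ θ s) {s : ℝ} (hs : 0 ≤ s) :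
    cutKernel d θ s ≤ 0 := by
  have := mul_nonneg hs (integral_nonneg (μ := volume.restrict (Ioi s))
    fun σ => mul_nonneg (h0 σ) (radialWeight_nonneg hd σ))
  rw [cutKernel, neg_mul]
  exact neg_nonpos.2 this

lemma tendsto_cutKernel (hd : 1 ≤ d) {θ : ℕ → ℝ → ℝ} {η : ℝ → ℝ} (hθ : ∀ n, Measurable (θ n))
    (h0 : ∀ n s, 0 ≤ θ n s) (h1 : ∀ n s, θ n s ≤ 1)
    (hlim : ∀ s, 1 < s → Filter.Tendsto (fun n => θ n s) Filter.atTop (𝓝 (η s))) {s : ℝ}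
    (hs : 1 < s) :
    Filter.Tendsto (fun n => cutKernel d (θ n) s) Filter.atTop (𝓝 (cutKernel d η s)) := by
  refine Filter.Tendsto.const_mul _ (tendsto_integral_of_dominated_convergence (radialWeight d)
    (fun n => ((hθ n).mul (measurable_radialWeight d)).aestronglyMeasurable)
    (integrableOn_radialWeight hd hs) (fun n => Filter.Eventually.of_forall fun σ => ?_) ?_)
  · rw [Real.norm_of_nonneg (mul_nonneg (h0 n σ) (radialWeight_nonneg hd σ))]
    exact mul_le_of_le_one_left (radialWeight_nonneg hd σ) (h1 n σ)
  · filter_upwards [ae_restrict_mem measurableSet_Ioi] with σ hσ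
    exact (hlim σ (hs.trans hσ)).mul_const _

lemma cutoff_nonneg {n m : ℝ} (hn : 0 < n) (hm : 1 < m) (s : ℝ) : 0 ≤ cutoff n m s :=
  mul_nonneg ((isStep_innerStep hn).nonneg s) (sub_nonneg.2 ((isStep_outerStep hm).le_one s))

lemma cutoff_le {n m : ℝ} (hn : 0 < n) (hm : 1 < m) (s : ℝ) : cutoff n m s ≤ 1 - outerStep m s :=
  mul_le_of_le_one_left (sub_nonneg.2 ((isStep_outerStep hm).le_one s))
    ((isStep_innerStep hn).le_one s)

lemma one_sub_outerStep_nonneg {m : ℝ} (hm : 1 < m) (s : ℝ) : 0 ≤ 1 - outerStep m s :=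
  sub_nonneg.2 ((isStep_outerStep hm).le_one s)

lemma one_sub_outerStep_le {m : ℝ} (hm : 1 < m) (s : ℝ) : 1 - outerStep m s ≤ 1 :=
  sub_le_self _ ((isStep_outerStep hm).nonneg s)

lemma measurable_outerStep (m : ℝ) : Measurable fun s => 1 - outerStep m s := by
  have : Continuous (outerStep m) := by
    unfold outerStep
    exact Real.smoothTransition.continuous.comp (by fun_prop)
  exact measurable_const.sub this.measurable

lemma measurable_cutoff (n m : ℝ) : Measurable (cutoff n m) := by
  have : Continuous (innerStep n) := by
    unfold innerStep
    exact Real.smoothTransition.continuous.comp (by fun_prop)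
  exact this.measurable.mul (measurable_outerStep m)

lemma tendsto_innerStep {s : ℝ} (hs : 1 < s) :
    Filter.Tendsto (fun n : ℕ => innerStep ((n : ℝ) + 2) s) Filter.atTop (𝓝 1) := by
  refine tendsto_const_nhds.congr' ?_
  have h1 : Filter.Tendsto (fun n : ℕ => 1 + 2 / ((n : ℝ) + 2)) Filter.atTop (𝓝 (1 + 0)) :=
    tendsto_const_nhds.add (tendsto_const_nhds.div_atTop
      (Filter.tendsto_atTop_add_const_right _ _ tendsto_natCast_atTop_atTop))
  filter_upwards [h1.eventually (ge_mem_nhds (by simpa using hs))] with n hn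
  exact ((isStep_innerStep (by positivity)).right s hn).symm

lemma tendsto_outerStep (s : ℝ) :
    Filter.Tendsto (fun n : ℕ => outerStep ((n : ℝ) + 2) s) Filter.atTop (𝓝 0) := by
  refine tendsto_const_nhds.congr' ?_
  have h1 : Filter.Tendsto (fun n : ℕ => (n : ℝ) + 2) Filter.atTop Filter.atTop :=
    Filter.tendsto_atTop_add_const_right _ _ tendsto_natCast_atTop_atTop
  filter_upwards [h1.eventually (Filter.eventually_ge_atTop s)] with n hn
  exact ((isStep_outerStep (by linarith [(Nat.cast_nonneg n : (0 : ℝ) ≤ n)])).left s hn).symm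

/-- The kernels are compared and passed to the limit only for s > 1; the excluded point y = x is not
an atom. -/
lemma ae_one_lt (hd : 1 ≤ d) (x : Hyp d) : ∀ᵐ y : Hyp d ∂(hypVol d), 1 < -mink (x : Mink d) y := by
  rw [ae_iff]
  refine measure_mono_null (fun y hy => ?_) (hypVol_singleton hd x)
  exact (Hyp.eq_of_mink (not_lt.1 hy)).symm

lemma continuous_mink_right (x : Hyp d) : Continuous fun y : Hyp d => -mink (x : Mink d) y :=
  (continuous_mink.comp (continuous_const.prodMk continuous_subtype_val)).neg

/-! ## Weak solutions -/

/-- `(1/d) Δ u - u = g` in the sense of distributions on `ℍ^d`. -/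
def IsWeakSol (u g : Hyp d → ℝ) : Prop := ∀ f : Hyp d → ℝ, IsTest f →
  ∫ x, u x * (1 / (d : ℝ) * lap f x - f x) ∂(hypVol d) = ∫ x, g x * f x ∂(hypVol d)

lemma isWeakSol_of_smooth {u : Hyp d → ℝ} (hu : IsSmoothHyp u) :
    IsWeakSol u fun x => 1 / (d : ℝ) * lap u x - u x := by
  intro f hf
  have hfc := hf.1.continuous
  have h1 : Integrable (fun x => u x * lap f x) (hypVol d) :=
    (hu.continuous.mul hf.1.lap.continuous).integrable_of_hasCompactSupport hf.2.lap.mul_left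
  have h2 : Integrable (fun x => u x * f x) (hypVol d) :=
    (hu.continuous.mul hfc).integrable_of_hasCompactSupport hf.2.mul_left
  have h3 : Integrable (fun x => f x * lap u x) (hypVol d) :=
    (hfc.mul hu.lap.continuous).integrable_of_hasCompactSupport hf.2.mul_right
  calc ∫ x, u x * (1 / (d : ℝ) * lap f x - f x) ∂(hypVol d)
      = ∫ x, (1 / (d : ℝ) * (u x * lap f x) - u x * f x) ∂(hypVol d) := by
        congr 1; funext x; ring
    _ = ∫ x, (1 / (d : ℝ) * (f x * lap u x) - u x * f x) ∂(hypVol d) := by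
        rw [integral_sub (h1.const_mul _) h2, integral_sub (h3.const_mul _) h2, integral_const_mul,
          integral_const_mul, integral_mul_lap hf hu]
    _ = _ := by congr 1; funext x; ring

lemma lap_const (c : ℝ) (x : Hyp d) : lap (fun _ => c) x = 0 := by
  have h : fderiv ℝ (zeroExt (d := d) fun _ => c) = fun _ => 0 := by
    funext y
    exact (hasFDerivAt_const c y).fderiv
  rw [lap, wave_eq, h]
  simp

/-- Constants are used as a probe: this identity yields the L¹ bound on the Green kernel. -/
lemma isWeakSol_one : IsWeakSol (d := d) (fun _ => 1) fun _ => -1 := by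
  have h := isWeakSol_of_smooth (d := d) (u := fun _ => 1) contDiffOn_const
  simpa [lap_const] using h

lemma IsWeakSol.sub {u u' g g' : Hyp d → ℝ} (h : IsWeakSol u g) (h' : IsWeakSol u' g')
    (hu : Continuous u) (hu' : Continuous u') (hg : Continuous g) (hg' : Continuous g') :
    IsWeakSol (fun x => u x - u' x) fun x => g x - g' x := by
  intro f hf
  have hfc := hf.1.continuous
  have hL : Continuous fun x => 1 / (d : ℝ) * lap f x - f x :=
    (continuous_const.mul hf.1.lap.continuous).sub hfc
  have hLs : HasCompactSupport fun x => 1 / (d : ℝ) * lap f x - f x :=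
    hf.2.lap.mul_left.sub hf.2
  have i1 : ∀ w : Hyp d → ℝ, Continuous w →
      Integrable (fun x => w x * (1 / (d : ℝ) * lap f x - f x)) (hypVol d) := fun w hw =>
    (hw.mul hL).integrable_of_hasCompactSupport (μ := hypVol d) hLs.mul_left
  have i2 : ∀ w : Hyp d → ℝ, Continuous w → Integrable (fun x => w x * f x) (hypVol d) :=
    fun w hw => (hw.mul hfc).integrable_of_hasCompactSupport (μ := hypVol d) hf.2.mul_left
  simp only [sub_mul]
  rw [integral_sub (i1 u hu) (i1 u' hu'), integral_sub (i2 g hg) (i2 g' hg'), h f hf, h' f hf]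

/-- The radial mean of `u` about `x` for the density of the step `f`. -/
noncomputable def stepMean (f : ℝ → ℝ) (u : Hyp d → ℝ) (x : Hyp d) : ℝ :=
  ∫ y : Hyp d, u y * (deriv f (-mink (x : Mink d) y) * massDensity d (-mink (x : Mink d) y))
    ∂(hypVol d)

/-- The cut-off kernel centred at x is an admissible test function, and the operator maps it to 1/d
times the inner density minus the outer density. -/
lemma IsWeakSol.level (hd : 1 ≤ d) {u g : Hyp d → ℝ} (hu : Continuous u) (h : IsWeakSol u g)
    {n m : ℝ} (hn : 2 ≤ n) (hm : 2 ≤ m) (x : Hyp d) :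
    stepMean (innerStep n) u x - stepMean (outerStep m) u x =
      d * ∫ y : Hyp d, g y * cutKernel d (cutoff n m) (-mink (x : Mink d) y) ∂(hypVol d) := by
  have hd0 : (d : ℝ) ≠ 0 := by positivity
  have hc := isCut_cutoff (show 0 < n by linarith) (show 1 < m by linarith)
  rw [← h _ (hc.isTest hd x), stepMean, stepMean,
    ← integral_sub ((isStep_innerStep (by linarith)).integrable_mul hd x hu)
      ((isStep_outerStep (by linarith)).integrable_mul hd x hu), ← integral_const_mul]
  refine integral_congr_ae (Filter.Eventually.of_forall fun y => ?_)
  simp only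
  rw [hc.lap_kernel hd, deriv_cutoff hn hm]
  field_simp

/-- The density is nonnegative with mass at most 1/a. For the outer step a = m, so outer means of
bounded functions vanish in the limit. -/
lemma abs_stepMean_le (hd : 1 ≤ d) {f : ℝ → ℝ} {a b : ℝ} (hf : IsStep f a b) {u : Hyp d → ℝ}
    {C : ℝ} (hC : ∀ y, |u y| ≤ C) (x : Hyp d) :
    |stepMean f u x| ≤ C / a := by
  have hC0 : 0 ≤ C := (abs_nonneg _).trans (hC x)
  have h1 := (hf.isTest hd x)
  have h2 := h1.1.continuous.integrable_of_hasCompactSupport (μ := hypVol d) h1.2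
  calc |stepMean f u x| ≤ ∫ y : Hyp d, C * (deriv f (-mink (x : Mink d) y) *
        massDensity d (-mink (x : Mink d) y)) ∂(hypVol d) := by
        rw [← Real.norm_eq_abs, stepMean]
        refine norm_integral_le_of_norm_le (h2.const_mul C) (Filter.Eventually.of_forall fun y => ?_)
        rw [norm_mul, Real.norm_eq_abs, Real.norm_of_nonneg (hf.density_nonneg hd x y)]
        exact mul_le_mul_of_nonneg_right (hC y) (hf.density_nonneg hd x y)
    _ ≤ C * (1 / a) := by
        rw [integral_const_mul]
        exact mul_le_mul_of_nonneg_left (hf.mass hd x).2 hC0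
    _ = C / a := by ring

lemma stepMean_one_le (hd : 1 ≤ d) {f : ℝ → ℝ} {a b : ℝ} (hf : IsStep f a b) (x : Hyp d) :
    0 ≤ stepMean f (fun _ => 1) x ∧ 1 / b ≤ stepMean f (fun _ => 1) x ∧
      stepMean f (fun _ => 1) x ≤ 1 / a := by
  have := hf.mass hd x
  simp only [stepMean, one_mul]
  refine ⟨integral_nonneg fun y => hf.density_nonneg hd x y, this⟩

/-- The inner means converge to the value at the centre. -/
theorem tendsto_stepMean_inner (hd : 1 ≤ d) {u : Hyp d → ℝ} (hu : Continuous u) (x : Hyp d) :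
    Filter.Tendsto (fun n : ℕ => stepMean (innerStep ((n : ℝ) + 2)) u x) Filter.atTop (𝓝 (u x)) := by
  have hstep : ∀ n : ℕ, IsStep (innerStep ((n : ℝ) + 2)) (1 + 1 / ((n : ℝ) + 2))
      (1 + 2 / ((n : ℝ) + 2)) := fun n => isStep_innerStep (by positivity)
  have hb : Filter.Tendsto (fun n : ℕ => 2 / ((n : ℝ) + 2)) Filter.atTop (𝓝 0) :=
    tendsto_const_nhds.div_atTop
      (Filter.tendsto_atTop_add_const_right _ _ tendsto_natCast_atTop_atTop)
  have hM : Filter.Tendsto (fun n : ℕ => stepMean (innerStep ((n : ℝ) + 2)) (fun _ => 1) x)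
      Filter.atTop (𝓝 1) := by
    refine tendsto_of_tendsto_of_tendsto_of_le_of_le (g := fun n : ℕ => 1 / (1 + 2 / ((n : ℝ) + 2)))
      (h := fun _ => 1) ?_ tendsto_const_nhds (fun n => (stepMean_one_le hd (hstep n) x).2.1)
      fun n => ((stepMean_one_le hd (hstep n) x).2.2).trans ?_
    · have := (hb.const_add 1).inv₀ (by norm_num)
      simpa [one_div] using this
    · rw [div_le_one (by positivity)]
      have : 0 ≤ 1 / ((n : ℝ) + 2) := by positivity
      linarith
  have hdiff : Filter.Tendsto (fun n : ℕ => stepMean (innerStep ((n : ℝ) + 2)) u x -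
      u x * stepMean (innerStep ((n : ℝ) + 2)) (fun _ => 1) x) Filter.atTop (𝓝 0) := by
    rw [Metric.tendsto_atTop]
    intro ε hε
    obtain ⟨δ, hδ, hδu⟩ := Metric.continuous_iff.1 hu x (ε / 2) (by linarith)
    -- On the support of the density -⟨x, y⟩₋ ≤ 1 + 2/n ≤ 2 (with n replaced by n + 2), so the
    -- height of y is at most 2/p. Hence C is an admissible constant in ‖x - y‖² ≤ C (-⟨x, y⟩₋ - 1),
    -- and the support shrinks to x.
    set p := x.1.2 - ‖x.1.1‖ with hp
    have hp0 : 0 < p := sub_pos.2 x.fst_lt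
    set C := (x.1.2 + 2 / p) ^ 2 / 2 with hC
    have hC0 : 0 ≤ C := by positivity
    have hlim : Filter.Tendsto (fun n : ℕ => C * (2 / ((n : ℝ) + 2))) Filter.atTop (𝓝 (C * 0)) :=
      hb.const_mul C
    rw [mul_zero] at hlim
    obtain ⟨N, hN⟩ := Filter.eventually_atTop.1
      (hlim.eventually (gt_mem_nhds (show (0 : ℝ) < δ ^ 2 by positivity)))
    refine ⟨N, fun n hn => ?_⟩
    have hs := hstep n
    have hn2 : 2 / ((n : ℝ) + 2) ≤ 1 := div_le_one_of_le₀ (by linarith [(Nat.cast_nonneg n : (0 : ℝ) ≤ n)]) (by positivity)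
    have h1 := hs.isTest hd x
    have h2 := h1.1.continuous.integrable_of_hasCompactSupport (μ := hypVol d) h1.2
    have hmass := (hs.mass hd x).2
    rw [Real.dist_eq, sub_zero]
    have e1 : stepMean (innerStep ((n : ℝ) + 2)) u x -
        u x * stepMean (innerStep ((n : ℝ) + 2)) (fun _ => 1) x =
        ∫ y : Hyp d, (u y - u x) * (deriv (innerStep ((n : ℝ) + 2)) (-mink (x : Mink d) y) *
          massDensity d (-mink (x : Mink d) y)) ∂(hypVol d) := by
      simp only [stepMean, one_mul, sub_mul]
      rw [integral_sub (hs.integrable_mul hd x hu) (h2.const_mul _), integral_const_mul]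
    rw [e1]
    have e2 : ∀ y : Hyp d, ‖(u y - u x) * (deriv (innerStep ((n : ℝ) + 2)) (-mink (x : Mink d) y) *
        massDensity d (-mink (x : Mink d) y))‖ ≤ ε / 2 *
        (deriv (innerStep ((n : ℝ) + 2)) (-mink (x : Mink d) y) *
        massDensity d (-mink (x : Mink d) y)) := by
      intro y
      rw [norm_mul, Real.norm_of_nonneg (hs.density_nonneg hd x y)]
      by_cases hy : -mink (x : Mink d) y ≤ 1 + 2 / ((n : ℝ) + 2)
      · refine mul_le_mul_of_nonneg_right ?_ (hs.density_nonneg hd x y)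
        refine (hδu y ?_).le
        have hy2 : y.1.2 ≤ 2 / p := by
          rw [le_div_iff₀ hp0, mul_comm]
          have := snd_le_of_mink x.1 y.fst_lt.le
          linarith
        have h4 : ‖(x : Mink d) - y‖ ^ 2 < δ ^ 2 := by
          refine lt_of_le_of_lt (x.norm_sub_sq_le y) (lt_of_le_of_lt ?_ (hN n hn))
          have hx2 := x.2.2
          have hy0 := y.2.2
          apply mul_le_mul _ (by linarith) (by linarith [x.one_le y]) hC0
          rw [hC]
          gcongr
        rw [dist_comm, Subtype.dist_eq, dist_eq_norm]
        exact lt_of_pow_lt_pow_left₀ 2 hδ.le h4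
      · rw [hs.deriv_right (not_le.1 hy)]
        simp
    calc _ ≤ ∫ y : Hyp d, ε / 2 * (deriv (innerStep ((n : ℝ) + 2)) (-mink (x : Mink d) y) *
          massDensity d (-mink (x : Mink d) y)) ∂(hypVol d) :=
          norm_integral_le_of_norm_le (h2.const_mul _) (Filter.Eventually.of_forall e2)
      _ ≤ ε / 2 * 1 := by
          rw [integral_const_mul]
          refine mul_le_mul_of_nonneg_left (hmass.trans ?_) (by linarith)
          rw [div_le_one (by positivity)]
          have : 0 ≤ 1 / ((n : ℝ) + 2) := by positivity
          linarith
      _ < ε := by linarith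
  have := hdiff.add (hM.const_mul (u x))
  simpa using this

/-! ## Integrability of the Green kernel -/

/-- For u = 1 and g = -1 the level identity says that d ∫ |K| is the inner mass minus the outer
mass, hence at most 1. -/
lemma cutKernel_integral_le (hd : 1 ≤ d) {n m : ℝ} (hn : 2 ≤ n) (hm : 2 ≤ m) (x : Hyp d) :
    ∫ y : Hyp d, |cutKernel d (cutoff n m) (-mink (x : Mink d) y)| ∂(hypVol d) ≤ 1 / d := by
  have hd0 : (0 : ℝ) < d := by exact_mod_cast hd
  have h := isWeakSol_one.level hd (u := fun _ => 1) continuous_const hn hm x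
  have h1 := stepMean_one_le hd (isStep_innerStep (show 0 < n by linarith)) x
  have h2 := stepMean_one_le hd (isStep_outerStep (show 1 < m by linarith)) x
  have h3 : 1 / (1 + 1 / n) ≤ 1 := by
    rw [div_le_one (by positivity)]
    have : 0 ≤ 1 / n := by positivity
    linarith
  have h4 : ∀ y : Hyp d, |cutKernel d (cutoff n m) (-mink (x : Mink d) y)| =
      -1 * cutKernel d (cutoff n m) (-mink (x : Mink d) y) := by
    intro y
    rw [abs_of_nonpos (cutKernel_nonpos hd (cutoff_nonneg (by linarith) (by linarith))
      (by linarith [x.one_le y]))]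
    ring
  simp only [h4]
  rw [le_div_iff₀ hd0, mul_comm]
  linarith [h1.2.2, h2.1]

lemma tendsto_cutoff_one (hd : 1 ≤ d) {s : ℝ} (hs : 1 < s) :
    Filter.Tendsto (fun n : ℕ => cutKernel d (cutoff ((n : ℝ) + 2) ((n : ℝ) + 2)) s) Filter.atTop
      (𝓝 (cutKernel d (fun _ => 1) s)) := by
  have hn : ∀ n : ℕ, (0 : ℝ) < (n : ℝ) + 2 ∧ (1 : ℝ) < (n : ℝ) + 2 := fun n => by
    have := (Nat.cast_nonneg n : (0 : ℝ) ≤ n)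
    constructor <;> linarith
  refine tendsto_cutKernel hd (fun n => measurable_cutoff _ _)
    (fun n s => cutoff_nonneg (hn n).1 (hn n).2 s)
    (fun n s => (cutoff_le (hn n).1 (hn n).2 s).trans (one_sub_outerStep_le (hn n).2 s))
    (fun s hs => ?_) hs
  have := (tendsto_innerStep hs).mul ((tendsto_outerStep s).const_sub 1)
  simpa [cutoff] using this

/-- Fatou's lemma along the cut-offs with both parameters equal to n + 2; the bound for each of them
is uniform in n and x. -/
lemma lintegral_green_le (hd : 1 ≤ d) (x : Hyp d) :
    ∫⁻ y : Hyp d, ‖cutKernel d (fun _ => 1) (-mink (x : Mink d) y)‖ₑ ∂(hypVol d)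
      ≤ ENNReal.ofReal (1 / d) := by
  have hm : ∀ n : ℕ, Measurable fun y : Hyp d =>
      cutKernel d (cutoff ((n : ℝ) + 2) ((n : ℝ) + 2)) (-mink (x : Mink d) y) := fun n =>
    (measurable_cutKernel d (measurable_cutoff _ _)).comp (continuous_mink_right x).measurable
  have hl : ∫⁻ y : Hyp d, ‖cutKernel d (fun _ => 1) (-mink (x : Mink d) y)‖ₑ ∂(hypVol d) =
      ∫⁻ y : Hyp d, Filter.liminf (fun n : ℕ => ‖cutKernel d
        (cutoff ((n : ℝ) + 2) ((n : ℝ) + 2)) (-mink (x : Mink d) y)‖ₑ) Filter.atTop ∂(hypVol d) := by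
    refine lintegral_congr_ae ?_
    filter_upwards [ae_one_lt hd x] with y hy
    exact (tendsto_cutoff_one hd hy).enorm.liminf_eq.symm
  rw [hl]
  refine (lintegral_liminf_le' fun n => (hm n).enorm.aemeasurable).trans ?_
  · refine Filter.liminf_le_of_frequently_le' (Filter.Frequently.of_forall fun n => ?_)
    have hn : (2 : ℝ) ≤ (n : ℝ) + 2 := by have := (Nat.cast_nonneg n : (0 : ℝ) ≤ n); linarith
    have hc := (isCut_cutoff (n := (n : ℝ) + 2) (m := (n : ℝ) + 2) (by linarith)
      (by linarith)).isTest hd x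
    rw [← ofReal_integral_norm_eq_lintegral_enorm
      (hc.1.continuous.integrable_of_hasCompactSupport hc.2)]
    exact ENNReal.ofReal_le_ofReal (cutKernel_integral_le hd hn hn x)

lemma integrable_green (hd : 1 ≤ d) (x : Hyp d) :
    Integrable (fun y : Hyp d => cutKernel d (fun _ => 1) (-mink (x : Mink d) y)) (hypVol d) :=
  ⟨((measurable_cutKernel d measurable_const).comp
    (continuous_mink_right x).measurable).aestronglyMeasurable,
    (lintegral_green_le hd x).trans_lt ENNReal.ofReal_lt_top⟩

lemma integral_green_le (hd : 1 ≤ d) (x : Hyp d) :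
    ∫ y : Hyp d, |cutKernel d (fun _ => 1) (-mink (x : Mink d) y)| ∂(hypVol d) ≤ 1 / d := by
  have h := lintegral_green_le hd x
  have h2 := ofReal_integral_norm_eq_lintegral_enorm (integrable_green hd x)
  rw [← h2] at h
  exact (ENNReal.ofReal_le_ofReal_iff (by positivity)).1 h

lemma integrable_outer (hd : 1 ≤ d) {m : ℝ} (hm : 1 < m) (x : Hyp d) :
    Integrable (fun y : Hyp d => cutKernel d (fun s => 1 - outerStep m s) (-mink (x : Mink d) y))
      (hypVol d) := by
  refine (integrable_green hd x).mono ((measurable_cutKernel d (measurable_outerStep m)).comp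
    (continuous_mink_right x).measurable).aestronglyMeasurable ?_
  filter_upwards [ae_one_lt hd x] with y hy
  exact cutKernel_mono hd (measurable_outerStep m) measurable_const
    (one_sub_outerStep_nonneg hm) (one_sub_outerStep_le hm) (fun _ => le_rfl) hy

lemma outer_kernel_eq_zero {m : ℝ} (hm : 1 < m) {s : ℝ} (hs : 2 * m < s) :
    cutKernel d (fun s => 1 - outerStep m s) s = 0 := by
  rw [cutKernel, setIntegral_eq_zero_of_forall_eq_zero fun t ht => by
    have ht : s < t := ht
    rw [(isStep_outerStep hm).right t (by linarith), sub_self, zero_mul], mul_zero]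

lemma integrable_mul_outer (hd : 1 ≤ d) {m : ℝ} (hm : 1 < m) {g : Hyp d → ℝ} (hg : Continuous g)
    (x : Hyp d) : Integrable (fun y : Hyp d => |g y| *
      |cutKernel d (fun s => 1 - outerStep m s) (-mink (x : Mink d) y)|) (hypVol d) := by
  obtain ⟨C, hC⟩ := (isCompact_hyp_le x (2 * m)).exists_bound_of_continuousOn hg.continuousOn
  refine ((integrable_outer hd hm x).norm.const_mul C).mono' ?_
    (Filter.Eventually.of_forall fun y => ?_)
  · exact (hg.abs.aestronglyMeasurable).mul (integrable_outer hd hm x).1.norm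
  · rw [Real.norm_of_nonneg (by positivity)]
    by_cases hy : -mink (x : Mink d) y ≤ 2 * m
    · exact mul_le_mul_of_nonneg_right (hC y hy) (abs_nonneg _)
    · rw [outer_kernel_eq_zero hm (not_le.1 hy)]; simp

/-- A weak solution is given by the cut-off Green kernel, up to a mean of the solution. -/
theorem IsWeakSol.repr (hd : 1 ≤ d) {u g : Hyp d → ℝ} (hu : Continuous u) (hg : Continuous g)
    (h : IsWeakSol u g) {m : ℝ} (hm : 2 ≤ m) (x : Hyp d) :
    u x = stepMean (outerStep m) u x + d * ∫ y : Hyp d,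
      g y * cutKernel d (fun s => 1 - outerStep m s) (-mink (x : Mink d) y) ∂(hypVol d) := by
  have hm1 : 1 < m := by linarith
  have hn : ∀ n : ℕ, (0 : ℝ) < (n : ℝ) + 2 ∧ (2 : ℝ) ≤ (n : ℝ) + 2 := fun n => by
    have := (Nat.cast_nonneg n : (0 : ℝ) ≤ n)
    constructor <;> linarith
  -- Only the inner parameter tends to infinity. With m fixed the kernels are dominated by one
  -- supported in a fixed hyperbolic ball, so no growth condition on u or g is needed.
  have h1 : Filter.Tendsto (fun n : ℕ => stepMean (innerStep ((n : ℝ) + 2)) u x -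
      stepMean (outerStep m) u x) Filter.atTop (𝓝 (u x - stepMean (outerStep m) u x)) :=
    (tendsto_stepMean_inner hd hu x).sub_const _
  have h2 : Filter.Tendsto (fun n : ℕ => (d : ℝ) * ∫ y : Hyp d, g y *
      cutKernel d (cutoff ((n : ℝ) + 2) m) (-mink (x : Mink d) y) ∂(hypVol d)) Filter.atTop
      (𝓝 (d * ∫ y : Hyp d, g y * cutKernel d (fun s => 1 - outerStep m s) (-mink (x : Mink d) y)
        ∂(hypVol d))) := by
    refine Filter.Tendsto.const_mul _ (tendsto_integral_of_dominated_convergence _ (fun n => ?_)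
      (integrable_mul_outer hd hm1 hg x) (fun n => ?_) ?_)
    · exact (hg.measurable.mul ((measurable_cutKernel d (measurable_cutoff _ _)).comp
        (continuous_mink_right x).measurable)).aestronglyMeasurable
    · filter_upwards [ae_one_lt hd x] with y hy
      rw [norm_mul]
      refine mul_le_mul_of_nonneg_left ?_ (norm_nonneg _)
      exact cutKernel_mono hd (measurable_cutoff _ _) (measurable_outerStep m)
        (cutoff_nonneg (hn n).1 hm1) (cutoff_le (hn n).1 hm1) (one_sub_outerStep_le hm1) hy
    · filter_upwards [ae_one_lt hd x] with y hy
      refine (tendsto_cutKernel hd (fun n => measurable_cutoff _ _)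
        (fun n s => cutoff_nonneg (hn n).1 hm1 s)
        (fun n s => (cutoff_le (hn n).1 hm1 s).trans (one_sub_outerStep_le hm1 s))
        (fun s hs => ?_) hy).const_mul _
      have := (tendsto_innerStep hs).mul_const (1 - outerStep m s)
      simpa [cutoff] using this
  have h3 := tendsto_nhds_unique h1 (h2.congr fun n => (h.level hd hu (hn n).2 hm x).symm)
  linarith

/-- A bounded weak solution is the Green potential of its right hand side. -/
theorem IsWeakSol.eq_green (hd : 1 ≤ d) {u g : Hyp d → ℝ} (hu : Continuous u) (hg : Continuous g)
    (h : IsWeakSol u g) {C : ℝ} (hC : ∀ y, |u y| ≤ C) {D : ℝ} (hD : ∀ y, |g y| ≤ D) (x : Hyp d) :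
    u x = greenPotential g x := by
  have hn : ∀ n : ℕ, (1 : ℝ) < (n : ℝ) + 2 ∧ (2 : ℝ) ≤ (n : ℝ) + 2 := fun n => by
    have := (Nat.cast_nonneg n : (0 : ℝ) ≤ n)
    constructor <;> linarith
  -- Boundedness of u enters here: the outer mean is at most C/(n + 2) in absolute value.
  have h1 : Filter.Tendsto (fun n : ℕ => stepMean (outerStep ((n : ℝ) + 2)) u x) Filter.atTop
      (𝓝 0) := by
    refine squeeze_zero_norm (fun n => abs_stepMean_le hd (isStep_outerStep (hn n).1) hC x) ?_
    exact tendsto_const_nhds.div_atTop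
      (Filter.tendsto_atTop_add_const_right _ _ tendsto_natCast_atTop_atTop)
  have h2 : Filter.Tendsto (fun n : ℕ => (d : ℝ) * ∫ y : Hyp d, g y *
      cutKernel d (fun s => 1 - outerStep ((n : ℝ) + 2) s) (-mink (x : Mink d) y) ∂(hypVol d))
      Filter.atTop (𝓝 (d * ∫ y : Hyp d, g y * cutKernel d (fun _ => 1) (-mink (x : Mink d) y)
        ∂(hypVol d))) := by
    refine Filter.Tendsto.const_mul _ (tendsto_integral_of_dominated_convergence _ (fun n => ?_)
      ((integrable_green hd x).norm.const_mul D) (fun n => ?_) ?_)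
    · exact (hg.measurable.mul ((measurable_cutKernel d (measurable_outerStep _)).comp
        (continuous_mink_right x).measurable)).aestronglyMeasurable
    · filter_upwards [ae_one_lt hd x] with y hy
      rw [norm_mul]
      refine mul_le_mul (hD y) ?_ (norm_nonneg _) ((abs_nonneg _).trans (hD x))
      exact cutKernel_mono hd (measurable_outerStep _) measurable_const
        (one_sub_outerStep_nonneg (hn n).1) (one_sub_outerStep_le (hn n).1) (fun _ => le_rfl) hy
    · filter_upwards [ae_one_lt hd x] with y hy
      refine (tendsto_cutKernel hd (fun n => measurable_outerStep _)
        (fun n s => one_sub_outerStep_nonneg (hn n).1 s)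
        (fun n s => one_sub_outerStep_le (hn n).1 s) (fun s hs => ?_) hy).const_mul _
      simpa using (tendsto_outerStep s).const_sub 1
  have h3 := h1.add h2
  rw [zero_add] at h3
  have h4 := tendsto_nhds_unique (tendsto_const_nhds.congr fun n =>
    h.repr hd hu hg (hn n).2 x) h3
  rw [h4, greenPotential]
  congr 2
  funext y
  rw [greenKernel_eq hd, mul_comm]

end Green

/-! ### Cocompact groups, uniqueness for equivariant functions, and regularity. -/

section Cocompact

variable {d : ℕ} {Γ : Subgroup (HypIsom d)}

/-! ## Cocompact groups -/

instance : ContinuousConstSMul Γ (Hyp d) := ⟨fun γ => continuous_hyp_smul γ.1⟩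

lemma covProj_smul (γ : Γ) (x : Hyp d) : covProj Γ (γ • x) = covProj Γ x :=
  Quotient.sound ⟨γ, rfl⟩

lemma covProj_eq_iff {x y : Hyp d} : covProj Γ x = covProj Γ y ↔ ∃ γ : Γ, γ • y = x :=
  Quotient.eq.trans Iff.rfl

lemma isOpenMap_covProj : IsOpenMap (covProj Γ) := isOpenMap_quotient_mk'_mul

/-- The projections of the balls about the base point are open and exhaust the compact quotient, so
a single ball meets every orbit. -/
lemma IsCocompact.exists_compact (hΓ : IsCocompact Γ) :
    ∃ K : Set (Hyp d), IsCompact K ∧ ∀ x, ∃ γ : Γ, γ • x ∈ K := by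
  have := hΓ.compact
  have hopen : ∀ n : ℕ, IsOpen (covProj Γ '' {y : Hyp d | -mink (hypOrigin d : Mink d) y < n}) :=
    fun n => isOpenMap_covProj _ (isOpen_lt (continuous_mink_right _) continuous_const)
  obtain ⟨t, ht⟩ := isCompact_univ.elim_finite_subcover _ hopen (by
    rintro m -
    induction m using Quotient.inductionOn with
    | h x =>
      obtain ⟨n, hn⟩ := exists_nat_gt (-mink (hypOrigin d : Mink d) x)
      exact mem_iUnion.2 ⟨n, x, hn, rfl⟩)
  obtain ⟨N, hN⟩ := t.exists_le
  refine ⟨_, isCompact_hyp_le (hypOrigin d) N, fun x => ?_⟩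
  obtain ⟨n, hn, y, hy, hyx⟩ := mem_iUnion₂.1 (ht (mem_univ (covProj Γ x)))
  obtain ⟨γ, rfl⟩ := covProj_eq_iff.1 hyx
  refine ⟨γ, ?_⟩
  have h1 : -mink (hypOrigin d : Mink d) (γ • x : Hyp d) < n := hy
  have h2 : (n : ℝ) ≤ N := by exact_mod_cast hN n hn
  exact (h1.trans_le h2).le

lemma IsCocompact.exists_bound (hΓ : IsCocompact Γ) {w : Hyp d → ℝ} (hw : Continuous w)
    (hinv : ∀ (γ : Γ) x, w (γ • x) = w x) : ∃ C, ∀ x, |w x| ≤ C := by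
  obtain ⟨K, hK, hcov⟩ := hΓ.exists_compact
  obtain ⟨C, hC⟩ := hK.exists_bound_of_continuousOn hw.continuousOn
  refine ⟨C, fun x => ?_⟩
  obtain ⟨γ, hγ⟩ := hcov x
  rw [← hinv γ x]
  exact hC _ hγ

lemma IsEquivariant.apply_smul {τ : Γ → Mink d} {h : Hyp d → ℝ} (hh : IsEquivariant τ h) (γ : Γ)
    (x : Hyp d) : h (γ • x) = h x + mink ((isomLin γ.1).symm (τ γ)) x := by
  have := hh.2 γ x x.mem_cone
  rwa [oneExt_hyp, show isomLin γ.1 (x : Mink d) = ((γ • x : Hyp d) : Mink d) from rfl,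
    oneExt_hyp] at this

/-- Continuous equivariant functions are determined by `S₁`. -/
theorem IsEquivariant.eq_of_S1 (hd : 1 ≤ d) (hΓ : IsCocompact Γ) {τ : Γ → Mink d}
    {h h' : Hyp d → ℝ} (hc : Continuous h) (hc' : Continuous h') (he : IsEquivariant τ h)
    (he' : IsEquivariant τ h') (hS : S1 h = S1 h') : h = h' := by
  have hw : Continuous fun x => h x - h' x := hc.sub hc'
  -- The translation term ⟨γ⁻¹τ_γ, x⟩₋ is the same for both functions; it cancels in the difference,
  -- which is Γ-invariant and therefore bounded.
  obtain ⟨C, hC⟩ := hΓ.exists_bound hw fun γ x => by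
    rw [he.apply_smul, he'.apply_smul]; ring
  have hweak : IsWeakSol (fun x => h x - h' x) fun _ => 0 := by
    intro f hf
    have hL : Continuous fun x => 1 / (d : ℝ) * lap f x - f x :=
      (continuous_const.mul hf.1.lap.continuous).sub hf.1.continuous
    have hLs : HasCompactSupport fun x => 1 / (d : ℝ) * lap f x - f x :=
      hf.2.lap.mul_left.sub hf.2
    have i1 : ∀ w : Hyp d → ℝ, Continuous w →
        Integrable (fun x => w x * (1 / (d : ℝ) * lap f x - f x)) (hypVol d) := fun w hw =>
      (hw.mul hL).integrable_of_hasCompactSupport hLs.mul_left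
    simp only [sub_mul, zero_mul, integral_zero]
    rw [integral_sub (i1 h hc) (i1 h' hc')]
    exact sub_eq_zero.2 (congrFun hS ⟨f, hf⟩)
  funext x
  -- A bounded weak solution is the Green potential of its right-hand side, here 0.
  have := hweak.eq_green hd hw continuous_const hC (D := 0) (by simp) x
  simp only [greenPotential, mul_zero, integral_zero] at this
  linarith

/-! ## Green potentials -/

lemma integrable_greenKernel (hd : 1 ≤ d) (x : Hyp d) :
    Integrable (fun y => greenKernel x y) (hypVol d) := by
  simp only [greenKernel_eq hd]
  exact integrable_green hd x

lemma integral_greenKernel_le (hd : 1 ≤ d) (x : Hyp d) :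
    ∫ y, |greenKernel x y| ∂(hypVol d) ≤ 1 / d := by
  simp only [greenKernel_eq hd]
  exact integral_green_le hd x

lemma greenKernel_comm (x y : Hyp d) : greenKernel x y = greenKernel y x := by
  rw [greenKernel, greenKernel, hypDist, hypDist, mink_comm]

lemma greenKernel_smul (γ : HypIsom d) (x y : Hyp d) :
    greenKernel (γ • x) (γ • y) = greenKernel x y := by
  rw [greenKernel, greenKernel, hypDist, hypDist, mink_smul_hyp]

lemma measurable_greenKernel (hd : 1 ≤ d) :
    Measurable fun p : Hyp d × Hyp d => greenKernel p.1 p.2 := by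
  simp only [greenKernel_eq hd]
  refine (measurable_cutKernel d measurable_const).comp (Continuous.measurable ?_)
  exact (continuous_mink.comp ((continuous_subtype_val.comp continuous_fst).prodMk
    (continuous_subtype_val.comp continuous_snd))).neg

lemma integrable_greenKernel_mul (hd : 1 ≤ d) {g : Hyp d → ℝ} (hg : Continuous g) {D : ℝ}
    (hD : ∀ y, |g y| ≤ D) (x : Hyp d) :
    Integrable (fun y => greenKernel x y * g y) (hypVol d) :=
  (integrable_greenKernel hd x).mul_bdd hg.aestronglyMeasurable
    (Filter.Eventually.of_forall hD)

/-- The factor d in the potential is exactly compensated by the bound 1/d on the L¹ norm of the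
kernel. -/
lemma abs_greenPotential_le (hd : 1 ≤ d) {g : Hyp d → ℝ} {D : ℝ}
    (hD : ∀ y, |g y| ≤ D) (x : Hyp d) : |greenPotential g x| ≤ D := by
  have hD0 : 0 ≤ D := (abs_nonneg _).trans (hD x)
  have hd0 : (0 : ℝ) < d := by exact_mod_cast hd
  have h1 : |∫ y, greenKernel x y * g y ∂(hypVol d)| ≤ ∫ y, |greenKernel x y| * D ∂(hypVol d) := by
    rw [← Real.norm_eq_abs]
    refine norm_integral_le_of_norm_le ((integrable_greenKernel hd x).abs.mul_const D)
      (Filter.Eventually.of_forall fun y => ?_)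
    rw [norm_mul]
    exact mul_le_mul_of_nonneg_left (hD y) (abs_nonneg _)
  rw [integral_mul_const] at h1
  rw [greenPotential, abs_mul, abs_of_pos hd0]
  calc (d : ℝ) * _ ≤ d * (1 / d * D) := by
        refine mul_le_mul_of_nonneg_left (h1.trans ?_) hd0.le
        exact mul_le_mul_of_nonneg_right (integral_greenKernel_le hd x) hD0
    _ = D := by field_simp

lemma greenPotential_smul (γ : HypIsom d) (g : Hyp d → ℝ) (x : Hyp d) :
    greenPotential g (γ • x) = greenPotential (fun y => g (γ • y)) x := by
  rw [greenPotential, greenPotential, ← integral_hyp_smul γ]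
  simp only [greenKernel_smul]

lemma continuous_swap_smul (z : Hyp d) :
    Continuous fun x : Hyp d => hypSwap (hypOrigin d) x • z := by
  refine Continuous.subtype_mk (f := fun x : Hyp d =>
    ((hypSwap (hypOrigin d) x • z : Hyp d) : Mink d)) ?_ _
  have hq : Continuous fun x : Hyp d => (hypOrigin d : Mink d) + x :=
    continuous_const.add continuous_subtype_val
  simp only [hypSwap_coe]
  have h1 : Continuous fun x : Hyp d => 2 * mink (z : Mink d) ((hypOrigin d : Mink d) + (x : Mink d)) :=
    continuous_const.mul (continuous_mink.comp (continuous_const.prodMk hq))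
  have h2 : Continuous fun x : Hyp d =>
      mink ((hypOrigin d : Mink d) + (x : Mink d)) ((hypOrigin d : Mink d) + (x : Mink d)) :=
    continuous_mink.comp (hq.prodMk hq)
  exact continuous_const.add ((h1.div h2 fun x =>
    (Hyp.add_mem_cone (hypOrigin d) x).1.ne).smul hq)

/-- Moving the centre to the base point by an isometry puts the dependence on x into g, away from
the singular kernel, so dominated convergence applies. -/
lemma continuous_greenPotential (hd : 1 ≤ d) {g : Hyp d → ℝ} (hg : Continuous g) {D : ℝ}
    (hD : ∀ y, |g y| ≤ D) : Continuous (greenPotential g) := by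
  have h1 : ∀ x, greenPotential g x = d * ∫ y, greenKernel (hypOrigin d) y *
      g (hypSwap (hypOrigin d) x • y) ∂(hypVol d) := by
    intro x
    have := greenPotential_smul (hypSwap (hypOrigin d) x) g (hypOrigin d)
    rwa [hypSwap_smul_left] at this
  rw [show greenPotential g = _ from funext h1]
  refine continuous_const.mul (continuous_of_dominated
    (bound := fun y => |greenKernel (hypOrigin d) y| * D) (fun x => ?_) (fun x => ?_) ?_ ?_)
  · exact (integrable_greenKernel hd _).1.mul
      (hg.comp (continuous_hyp_smul _)).aestronglyMeasurable
  · refine Filter.Eventually.of_forall fun y => ?_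
    rw [norm_mul]
    exact mul_le_mul_of_nonneg_left (hD _) (abs_nonneg _)
  · exact (integrable_greenKernel hd _).abs.mul_const D
  · exact Filter.Eventually.of_forall fun y =>
      continuous_const.mul (hg.comp (continuous_swap_smul y))

/-- The Green potential of a bounded function is a weak solution. -/
lemma isWeakSol_greenPotential (hd : 1 ≤ d) {g : Hyp d → ℝ} (hg : Continuous g) {D : ℝ}
    (hD : ∀ y, |g y| ≤ D) : IsWeakSol (greenPotential g) g := by
  intro f hf
  set L : Hyp d → ℝ := fun x => 1 / (d : ℝ) * lap f x - f x with hLdef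
  have hL : Continuous L := (continuous_const.mul hf.1.lap.continuous).sub hf.1.continuous
  have hLs : HasCompactSupport L := hf.2.lap.mul_left.sub hf.2
  have hLi : Integrable L (hypVol d) := hL.integrable_of_hasCompactSupport hLs
  obtain ⟨C, hC⟩ := hf.2.exists_bound_of_continuous hf.1.continuous
  obtain ⟨C', hC'⟩ := hLs.exists_bound_of_continuous hL
  -- A test function is the Green potential of its own image under the operator. The claim then
  -- follows by Fubini and the symmetry of the kernel.
  have hfL : ∀ y, f y = greenPotential L y :=
    (isWeakSol_of_smooth hf.1).eq_green hd hf.1.continuous hL hC hC'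
  have hint : Integrable (fun p : Hyp d × Hyp d => greenKernel p.1 p.2 * g p.2 * L p.1)
      ((hypVol d).prod (hypVol d)) := by
    rw [integrable_prod_iff]
    · refine ⟨Filter.Eventually.of_forall fun x =>
        (integrable_greenKernel_mul hd hg hD x).mul_const (L x), ?_⟩
      refine Integrable.mono' (hLi.abs.const_mul (1 / d * D)) ?_
        (Filter.Eventually.of_forall fun x => ?_)
      · refine AEStronglyMeasurable.integral_prod_right' (f := fun p : Hyp d × Hyp d =>
          ‖greenKernel p.1 p.2 * g p.2 * L p.1‖) ?_
        exact (((measurable_greenKernel hd).mul (hg.measurable.comp measurable_snd)).mul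
          (hL.measurable.comp measurable_fst)).norm.aestronglyMeasurable
      · have hD0 : 0 ≤ D := (abs_nonneg _).trans (hD x)
        rw [Real.norm_of_nonneg (integral_nonneg fun y => norm_nonneg _)]
        calc ∫ y, ‖greenKernel x y * g y * L x‖ ∂(hypVol d)
            ≤ ∫ y, |greenKernel x y| * (D * |L x|) ∂(hypVol d) := by
              refine integral_mono ((integrable_greenKernel_mul hd hg hD x).mul_const _).norm
                ((integrable_greenKernel hd x).abs.mul_const _) fun y => ?_
              simp only [norm_mul, Real.norm_eq_abs, mul_assoc]
              exact mul_le_mul_of_nonneg_left (mul_le_mul_of_nonneg_right (hD y) (abs_nonneg _))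
                (abs_nonneg _)
          _ ≤ 1 / d * (D * |L x|) := by
              rw [integral_mul_const]
              exact mul_le_mul_of_nonneg_right (integral_greenKernel_le hd x) (by positivity)
          _ = _ := by ring
    · exact (((measurable_greenKernel hd).mul (hg.measurable.comp measurable_snd)).mul
          (hL.measurable.comp measurable_fst)).aestronglyMeasurable
  calc ∫ x, greenPotential g x * L x ∂(hypVol d)
      = d * ∫ x, ∫ y, greenKernel x y * g y * L x ∂(hypVol d) ∂(hypVol d) := by
        rw [← integral_const_mul]
        refine integral_congr_ae (Filter.Eventually.of_forall fun x => ?_)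
        simp only [greenPotential]
        rw [integral_mul_const]; ring
    _ = d * ∫ y, ∫ x, greenKernel x y * g y * L x ∂(hypVol d) ∂(hypVol d) := by
        rw [integral_integral_swap hint]
    _ = ∫ y, g y * f y ∂(hypVol d) := by
        rw [← integral_const_mul]
        refine integral_congr_ae (Filter.Eventually.of_forall fun y => ?_)
        simp only
        rw [hfL y, greenPotential]
        have : ∀ x, greenKernel x y * g y * L x = g y * (greenKernel y x * L x) := fun x => by
          rw [greenKernel_comm x y]; ring
        simp only [this]
        rw [integral_const_mul]; ring

/-! ## Regularity -/

/-- The integral is the value at 0 of the convolution of f with v ↦ g p (-v); smoothness in the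
parameter is that of such convolutions with uniformly compactly supported g. -/
lemma contDiffOn_integral_param {f : EuclideanSpace ℝ (Fin d) → ℝ}
    {g : Mink d → EuclideanSpace ℝ (Fin d) → ℝ} {s : Set (Mink d)} (hs : IsOpen s) (r : ℝ)
    (hgs : ∀ p v, p ∈ s → r < ‖v‖ → g p v = 0) (hf : LocallyIntegrable f volume)
    (hg : ContDiffOn ℝ ∞ (fun q : Mink d × EuclideanSpace ℝ (Fin d) => g q.1 q.2) (s ×ˢ univ)) :
    ContDiffOn ℝ ∞ (fun p => ∫ v, f v * g p v) s := by
  have h := contDiffOn_convolution_right_with_param (n := ⊤) (μ := volume)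
    (ContinuousLinearMap.mul ℝ ℝ) (g := fun p v => g p (-v)) hs
    (isCompact_closedBall (0 : EuclideanSpace ℝ (Fin d)) r) (fun p v hp hv => ?_) hf ?_
  · have h2 : ContDiffOn ℝ ∞ (fun p : Mink d => (p, (0 : EuclideanSpace ℝ (Fin d)))) s :=
      (contDiff_id.prodMk contDiff_const).contDiffOn
    refine (h.comp h2 fun p hp => ⟨hp, mem_univ _⟩).congr fun p _ => ?_
    simp [convolution]
  · refine hgs p _ hp ?_
    rw [norm_neg]
    simpa [mem_closedBall_zero_iff] using hv
  · exact hg.comp (contDiff_fst.prodMk contDiff_snd.neg).contDiffOn fun q hq => hq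

/-- The smoothness in the centre comes from the density, so continuity of u is enough. The argument
is local because the support is uniformly bounded only near a given centre. -/
lemma isSmoothHyp_stepMean (hd : 1 ≤ d) {f : ℝ → ℝ} {a b : ℝ} (hf : IsStep f a b) {u : Hyp d → ℝ}
    (hu : Continuous u) : IsSmoothHyp (stepMean f u) := by
  intro p₀ hp₀
  set δ : Mink d → ℝ := fun p => (hypProj p).1.2 - ‖(hypProj p).1.1‖ with hδ
  have hδ0 : ∀ p, 0 < δ p := fun p => sub_pos.2 (hypProj p).fst_lt
  have hδc : ContinuousOn δ (futureCone d) := by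
    have h := continuous_subtype_val.comp_continuousOn (continuousOn_hypProj (d := d))
    exact (continuous_snd.comp_continuousOn h).sub (continuous_fst.comp_continuousOn h).norm
  have ho : IsOpen (futureCone d ∩ δ ⁻¹' Ioi (δ p₀ / 2)) :=
    hδc.isOpen_inter_preimage (isOpen_futureCone d) isOpen_Ioi
  have hmem : p₀ ∈ futureCone d ∩ δ ⁻¹' Ioi (δ p₀ / 2) := ⟨hp₀, half_lt_self (hδ0 p₀)⟩
  have hfun : ∀ p, zeroExt (stepMean f u) p = ∫ v : EuclideanSpace ℝ (Fin d),
      (u (hypGraph v) * (1 / Real.sqrt (1 + ‖v‖ ^ 2))) *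
        (deriv f (-mink (hypProj p : Mink d) (hypGraph v)) *
          massDensity d (-mink (hypProj p : Mink d) (hypGraph v))) := by
    intro p
    rw [zeroExt, stepMean, integral_hypVol]
    congr 1
    funext v
    ring
  -- Where δ p > δ p₀ / 2, the condition -⟨·, ·⟩₋ ≤ b forces a height of at most 2 b / δ p₀.
  have := contDiffOn_integral_param (d := d) ho (2 * b / δ p₀)
    (f := fun v => u (hypGraph v) * (1 / Real.sqrt (1 + ‖v‖ ^ 2)))
    (g := fun p v => deriv f (-mink (hypProj p : Mink d) (hypGraph v)) *
          massDensity d (-mink (hypProj p : Mink d) (hypGraph v))) ?_ ?_ ?_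
  · exact ((this.congr fun p _ => hfun p).contDiffAt (ho.mem_nhds hmem)).contDiffWithinAt
  · intro p v hp hv
    have h1 : δ p₀ / 2 < δ p := hp.2
    have h2 := snd_le_of_mink (hypProj p).1 (hypGraph v).fst_lt.le
    have h3 : ‖v‖ < (hypGraph v).1.2 := (hypGraph v).fst_lt
    have h4 : 2 * b < ‖v‖ * δ p₀ := (div_lt_iff₀ (hδ0 p₀)).1 hv
    have h5 : ‖v‖ * (δ p₀ / 2) ≤ δ p * (hypGraph v).1.2 := by
      rw [mul_comm]
      exact mul_le_mul h1.le h3.le (norm_nonneg _) (hδ0 p).le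
    rw [hf.deriv_right (by linarith), zero_mul]
  · refine Continuous.locallyIntegrable ((hu.comp continuous_hypGraph).mul
      (continuous_const.div (by fun_prop) fun v => ?_))
    positivity
  · have h1 : ContDiffOn ℝ ∞ (fun q : Mink d × EuclideanSpace ℝ (Fin d) =>
        -mink (hypProj q.1 : Mink d) (hypGraph q.2))
        ((futureCone d ∩ δ ⁻¹' Ioi (δ p₀ / 2)) ×ˢ univ) := by
      refine (contDiff_mink.comp_contDiffOn (ContDiffOn.prodMk ?_ ?_)).neg
      · exact contDiffOn_hypProj.comp contDiffOn_fst fun q hq => hq.1.1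
      · exact (contDiff_hypGraph.comp contDiff_snd).contDiffOn
    exact (hf.smooth_density hd).comp_contDiffOn h1

/-- The kernel is singular on the diagonal and must not be differentiated. After an isometry it is a
fixed integrable function about the base point, and the parameter enters only through the smooth g.
-/
lemma isSmoothHyp_outerPotential (hd : 1 ≤ d) {m : ℝ} (hm : 1 < m) {g : Hyp d → ℝ}
    (hg : IsSmoothHyp g) : IsSmoothHyp fun x : Hyp d => ∫ y : Hyp d,
      g y * cutKernel d (fun s => 1 - outerStep m s) (-mink (x : Mink d) y) ∂(hypVol d) := by
  set R := cutKernel d (fun s => 1 - outerStep m s) with hR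
  have hm2 : 1 < 2 * m := by linarith
  have hstep := isStep_outerStep hm2
  -- A redundant cut-off, equal to 1 where the kernel does not vanish: it gives the smooth factor a
  -- compact support while the singular kernel stays in the other factor.
  have hone : ∀ s, (1 - outerStep (2 * m) s) * R s = R s := by
    intro s
    rcases le_or_gt s (2 * m) with hs | hs
    · rw [hstep.left s hs, sub_zero, one_mul]
    · rw [hR, outer_kernel_eq_zero hm hs, mul_zero]
  have hfun : ∀ p, zeroExt (fun x : Hyp d => ∫ y : Hyp d, g y * R (-mink (x : Mink d) y) ∂(hypVol d)) p =
      ∫ v : EuclideanSpace ℝ (Fin d), (R (hypGraph v).1.2 * (1 / Real.sqrt (1 + ‖v‖ ^ 2))) *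
        ((1 - outerStep (2 * m) (hypGraph v).1.2) *
          g (hypSwap (hypOrigin d) (hypProj p) • hypGraph v)) := by
    intro p
    rw [zeroExt, ← integral_hyp_smul (hypSwap (hypOrigin d) (hypProj p)), integral_hypVol]
    congr 1
    funext v
    rw [mink_swap]
    linear_combination (-(1 / Real.sqrt (1 + ‖v‖ ^ 2)) *
      g (hypSwap (hypOrigin d) (hypProj p) • hypGraph v)) * hone (hypGraph v).1.2
  have := contDiffOn_integral_param (d := d) (isOpen_futureCone d) (2 * (2 * m))
    (f := fun v => R (hypGraph v).1.2 * (1 / Real.sqrt (1 + ‖v‖ ^ 2)))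
    (g := fun p v => (1 - outerStep (2 * m) (hypGraph v).1.2) *
          g (hypSwap (hypOrigin d) (hypProj p) • hypGraph v)) ?_ ?_ ?_
  · exact this.congr fun p _ => hfun p
  · intro p v hp hv
    have h3 : ‖v‖ < (hypGraph v).1.2 := (hypGraph v).fst_lt
    rw [hstep.right _ (by linarith), sub_self, zero_mul]
  · refine Integrable.locallyIntegrable ?_
    have := (integrable_hypVol _).1 (integrable_outer hd hm (hypOrigin d))
    simp only [mink_hypOrigin] at this
    refine this.congr (Filter.Eventually.of_forall fun v => ?_)
    simp only [hR]
    ring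
  · refine ContDiffOn.mul (contDiff_const.sub (hstep.smooth.comp
      (contDiff_snd.comp (contDiff_hypGraph.comp contDiff_snd)))).contDiffOn ?_
    have h1 := ContDiffOn.comp (show ContDiffOn ℝ ∞ (zeroExt g) (futureCone d) from hg)
      (contDiffOn_swap (d := d)) fun q _ => Hyp.mem_cone _
    exact h1.congr fun q _ => by simp

/-- Continuous weak solutions with a smooth right hand side are smooth. -/
theorem IsWeakSol.isSmoothHyp (hd : 1 ≤ d) {u g : Hyp d → ℝ} (hu : Continuous u)
    (hg : IsSmoothHyp g) (h : IsWeakSol u g) : IsSmoothHyp u := by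
  have h1 := isSmoothHyp_stepMean hd (isStep_outerStep (show (1 : ℝ) < 2 by norm_num)) hu
  have h2 := isSmoothHyp_outerPotential hd (show (1 : ℝ) < 2 by norm_num) hg
  have h3 : ContDiffOn ℝ ∞ (fun x => zeroExt (stepMean (outerStep 2) u) x + d *
      zeroExt (fun x : Hyp d => ∫ y : Hyp d,
        g y * cutKernel d (fun s => 1 - outerStep 2 s) (-mink (x : Mink d) y) ∂(hypVol d)) x)
      (futureCone d) := ContDiffOn.add h1 (contDiffOn_const.mul h2)
  exact h3.congr fun x _ => h.repr hd hu hg.continuous le_rfl (hypProj x)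

/-- Both right-hand sides have the same integrals against test functions. The inner densities are
test functions shrinking to x, so the continuous functions agree at x. -/
lemma IsWeakSol.pointwise (hd : 1 ≤ d) {u g : Hyp d → ℝ} (hu : IsSmoothHyp u) (hg : Continuous g)
    (h : IsWeakSol u g) (x : Hyp d) : 1 / (d : ℝ) * lap u x - u x = g x := by
  have hL : Continuous fun x => 1 / (d : ℝ) * lap u x - u x :=
    (continuous_const.mul hu.lap.continuous).sub hu.continuous
  have hz := (isWeakSol_of_smooth hu).sub h hu.continuous hu.continuous hL hg
  have hlim := tendsto_stepMean_inner hd (hL.sub hg) x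
  have h0 : ∀ n : ℕ, stepMean (innerStep ((n : ℝ) + 2))
      (fun x => 1 / (d : ℝ) * lap u x - u x - g x) x = 0 := by
    intro n
    have hs : IsStep (innerStep ((n : ℝ) + 2)) _ _ := isStep_innerStep (by positivity)
    rw [stepMean, ← hz _ (hs.isTest hd x)]
    simp
  have := tendsto_nhds_unique hlim (tendsto_const_nhds.congr fun n => (h0 n).symm)
  exact sub_eq_zero.1 this

end Cocompact

/-! ### Existence and uniqueness on the quotient, and unfolding of the solution. -/

section Quotient

variable {d : ℕ} {Γ : Subgroup (HypIsom d)}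

/-! ## Measures on the quotient -/

/-- For each ball about the base point only finitely many elements move it to a set meeting it, and
every element does so for a large enough ball. -/
lemma IsCocompact.countable (hΓ : IsCocompact Γ) : Countable Γ := by
  have := hΓ.properlyDiscontinuous
  have hc : ∀ n : ℕ, {γ : Γ | ((γ • ·) '' {y : Hyp d | -mink (hypOrigin d : Mink d) y ≤ n} ∩
      {y : Hyp d | -mink (hypOrigin d : Mink d) y ≤ n}).Nonempty}.Countable := fun n =>
    (ProperlyDiscontinuousSMul.finite_disjoint_inter_image (isCompact_hyp_le _ _)
      (isCompact_hyp_le _ _)).countable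
  refine countable_univ_iff.1 ((countable_iUnion hc).mono fun γ _ => ?_)
  obtain ⟨n, hn⟩ := exists_nat_ge (max (-mink (hypOrigin d : Mink d) (hypOrigin d : Mink d))
    (-mink (hypOrigin d : Mink d) (γ • hypOrigin d : Hyp d)))
  exact mem_iUnion.2 ⟨n, γ • hypOrigin d, ⟨_, (le_max_left _ _).trans hn, rfl⟩,
    (le_max_right _ _).trans hn⟩

lemma measurableSet_quot {S : Set (HypQuot Γ)} :
    MeasurableSet S ↔ MeasurableSet (covProj Γ ⁻¹' S) := measurableSet_quotient

lemma IsCocompact.injOn_nhds (hΓ : IsCocompact Γ) (x : Hyp d) :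
    ∃ U, IsOpen U ∧ x ∈ U ∧ InjOn (covProj Γ) U := by
  have := hΓ.properlyDiscontinuous
  obtain ⟨U, hU, hd⟩ := ProperlyDiscontinuousSMul.exists_nhds_disjoint_image Γ x
  refine ⟨interior U, isOpen_interior, mem_interior_iff_mem_nhds.2 hU, fun y hy z hz hyz => ?_⟩
  obtain ⟨γ, rfl⟩ := covProj_eq_iff.1 hyz
  by_cases hγ : γ • x = x
  · rw [hΓ.free γ x hγ, one_smul]
  · exact absurd (interior_subset hy) (disjoint_left.1 (hd γ hγ) ⟨z, interior_subset hz, rfl⟩)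

/-- The covering projection has a measurable section. -/
lemma IsCocompact.exists_section (hΓ : IsCocompact Γ) :
    ∃ σ : HypQuot Γ → Hyp d, Measurable σ ∧ ∀ m, covProj Γ (σ m) = m := by
  classical
  have := hΓ.countable
  choose U hUo hxU hUi using hΓ.injOn_nhds
  obtain ⟨s, hs, hsU⟩ := TopologicalSpace.countable_cover_nhds fun x => (hUo x).mem_nhds (hxU x)
  have hsne : s.Nonempty := by
    obtain ⟨i, hi, -⟩ := mem_iUnion₂.1 (hsU.ge (mem_univ (hypOrigin d)))
    exact ⟨i, hi⟩
  obtain ⟨c, rfl⟩ := hs.exists_eq_range hsne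
  set B : ℕ → Set (Hyp d) := fun n => U (c n) with hB
  -- A strict Borel fundamental domain: from each fibre keep the point lying in the first set of the
  -- cover that meets the fibre. Injectivity on each member of the cover makes it unique.
  set D : Set (Hyp d) := ⋃ n, B n \ ⋃ j < n, covProj Γ ⁻¹' (covProj Γ '' B j) with hD
  have hDm : MeasurableSet D := by
    refine MeasurableSet.iUnion fun n => (hUo _).measurableSet.diff
      (MeasurableSet.iUnion fun j => MeasurableSet.iUnion fun _ => ?_)
    exact measurableSet_quot.1 (by
      rw [measurableSet_quot]
      exact (((isOpenMap_covProj _ (hUo _)).preimage continuous_quot_mk)).measurableSet)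
  have hDi : InjOn (covProj Γ) D := by
    intro x hx y hy hxy
    obtain ⟨n, hxn, hxn'⟩ := mem_iUnion.1 hx
    obtain ⟨k, hyk, hyk'⟩ := mem_iUnion.1 hy
    rcases lt_trichotomy n k with h | rfl | h
    · exact (hyk' (mem_iUnion₂.2 ⟨n, h, x, hxn, hxy⟩)).elim
    · exact hUi _ hxn hyk hxy
    · exact (hxn' (mem_iUnion₂.2 ⟨k, h, y, hyk, hxy.symm⟩)).elim
  have hDs : ∀ m, ∃ x ∈ D, covProj Γ x = m := by
    intro m
    have hex : ∃ n, m ∈ covProj Γ '' B n := by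
      induction m using Quotient.inductionOn with
      | h x =>
        obtain ⟨_, ⟨n, rfl⟩, hn⟩ := mem_iUnion₂.1 (hsU.ge (mem_univ x))
        exact ⟨n, x, hn, rfl⟩
    obtain ⟨x, hx, hxm⟩ := Nat.find_spec hex
    refine ⟨x, mem_iUnion.2 ⟨Nat.find hex, hx, fun h => ?_⟩, hxm⟩
    obtain ⟨j, hj, hxj⟩ := mem_iUnion₂.1 h
    refine Nat.find_min hex hj ?_
    rwa [mem_preimage, hxm] at hxj
  choose σ hσD hσ using hDs
  refine ⟨σ, fun A hA => ?_, hσ⟩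
  rw [measurableSet_quot]
  -- Measurability on the quotient is tested upstairs, where the set is the Γ-saturation of D ∩ A, a
  -- countable union of translates.
  have : covProj Γ ⁻¹' (σ ⁻¹' A) = ⋃ γ : Γ, (γ • ·) ⁻¹' (D ∩ A) := by
    ext x
    simp only [mem_preimage, mem_iUnion, mem_inter_iff]
    constructor
    · intro hx
      obtain ⟨γ, hγ⟩ := covProj_eq_iff.1 (hσ (covProj Γ x))
      exact ⟨γ, by rw [hγ]; exact ⟨hσD _, hx⟩⟩
    · rintro ⟨γ, h1, h2⟩
      rwa [hDi (hσD _) h1 ((hσ _).trans (covProj_smul γ x).symm)]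
  rw [this]
  exact MeasurableSet.iUnion fun γ => (continuous_const_smul γ).measurable (hDm.inter hA)

/-- The sum over `Γ` of the translates of the image of `μ'` under a section of the covering
projection. -/
noncomputable def liftMeasure (μ' : Measure (HypQuot Γ)) (σ : HypQuot Γ → Hyp d) :
    Measure (Hyp d) :=
  Measure.sum fun γ : Γ => μ'.map fun m => γ • σ m

/-- If the projection is injective on A, the sets {m | γ σ(m) ∈ A} partition the image of A: they
cover it because σ is a section, and they are disjoint because the action is free. -/
lemma isPullback_liftMeasure (hΓ : IsCocompact Γ) (μ' : Measure (HypQuot Γ))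
    {σ : HypQuot Γ → Hyp d} (hσm : Measurable σ) (hσ : ∀ m, covProj Γ (σ m) = m) :
    IsPullback μ' (liftMeasure μ' σ) := by
  intro A hA hinj
  have := hΓ.countable
  have hm : ∀ γ : Γ, Measurable fun m => γ • σ m := fun γ =>
    (continuous_const_smul γ).measurable.comp hσm
  rw [liftMeasure, Measure.sum_apply _ hA]
  have h1 : ∀ γ : Γ, μ'.map (fun m => γ • σ m) A = μ' ((fun m => γ • σ m) ⁻¹' A) :=
    fun γ => Measure.map_apply (hm γ) hA
  simp only [h1]
  rw [← measure_iUnion]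
  · congr 1
    ext m
    simp only [mem_iUnion, mem_preimage, mem_image]
    constructor
    · rintro ⟨γ, h⟩
      exact ⟨_, h, (covProj_smul γ _).trans (hσ m)⟩
    · rintro ⟨x, hx, rfl⟩
      obtain ⟨γ, hγ⟩ := covProj_eq_iff.1 (hσ (covProj Γ x)).symm
      exact ⟨γ, by rwa [hγ]⟩
  · intro γ δ hne
    refine disjoint_left.2 fun m h h' => hne ?_
    have h2 : γ • σ m = δ • σ m :=
      hinj h h' ((covProj_smul γ _).trans (covProj_smul δ _).symm)
    have h3 : (δ⁻¹ * γ) • σ m = σ m := by rw [mul_smul, h2, inv_smul_smul]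
    exact (inv_mul_eq_one.1 (hΓ.free _ _ h3)).symm
  · exact fun γ => hm γ hA

/-! ## The solution on the quotient -/

lemma SmoothQuot.continuous (f : SmoothQuot Γ) : Continuous (f.1 ∘ covProj Γ) :=
  IsSmoothHyp.continuous f.2

lemma SmoothQuot.apply_smul (f : SmoothQuot Γ) (γ : Γ) (x : Hyp d) :
    (f.1 ∘ covProj Γ) (γ • x) = (f.1 ∘ covProj Γ) x := congrArg f.1 (covProj_smul γ x)

lemma SmoothQuot.exists_bound (hΓ : IsCocompact Γ) (f : SmoothQuot Γ) :
    ∃ D, ∀ x, |(f.1 ∘ covProj Γ) x| ≤ D := hΓ.exists_bound (SmoothQuot.continuous f) (SmoothQuot.apply_smul f)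

/-- The Green potential of a function on the quotient. -/
noncomputable def quotPotential (f : SmoothQuot Γ) (m : HypQuot Γ) : ℝ :=
  greenPotential (f.1 ∘ covProj Γ) m.out

lemma greenPotential_invariant (f : SmoothQuot Γ) (γ : Γ) (x : Hyp d) :
    greenPotential (f.1 ∘ covProj Γ) (γ • x) = greenPotential (f.1 ∘ covProj Γ) x := by
  refine (greenPotential_smul γ.1 _ x).trans ?_
  congr 1
  funext y
  exact SmoothQuot.apply_smul f γ y

lemma quotPotential_covProj (f : SmoothQuot Γ) (x : Hyp d) :
    quotPotential f (covProj Γ x) = greenPotential (f.1 ∘ covProj Γ) x := by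
  obtain ⟨γ, hγ⟩ := covProj_eq_iff.1 (Quotient.out_eq (covProj Γ x) :
    covProj Γ (covProj Γ x).out = covProj Γ x)
  rw [quotPotential, ← hγ, greenPotential_invariant]

lemma abs_quotPotential_le (hd : 1 ≤ d) (f : SmoothQuot Γ) {D : ℝ}
    (hD : ∀ x, |(f.1 ∘ covProj Γ) x| ≤ D) (m : HypQuot Γ) : |quotPotential f m| ≤ D :=
  abs_greenPotential_le hd hD _

lemma measurable_quotPotential (hd : 1 ≤ d) (hΓ : IsCocompact Γ) (f : SmoothQuot Γ) :
    Measurable (quotPotential f) := by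
  obtain ⟨D, hD⟩ := SmoothQuot.exists_bound hΓ f
  refine measurable_from_quotient.2 ?_
  have : quotPotential f ∘ covProj Γ = greenPotential (f.1 ∘ covProj Γ) :=
    funext (quotPotential_covProj f)
  exact this ▸ (continuous_greenPotential hd (SmoothQuot.continuous f) hD).measurable

lemma integrable_quotPotential (hd : 1 ≤ d) (hΓ : IsCocompact Γ) (μ' : Measure (HypQuot Γ))
    [IsFiniteMeasure μ'] (f : SmoothQuot Γ) : Integrable (quotPotential f) μ' := by
  obtain ⟨D, hD⟩ := SmoothQuot.exists_bound hΓ f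
  exact Integrable.of_bound (measurable_quotPotential hd hΓ f).aestronglyMeasurable D
    (Filter.Eventually.of_forall (abs_quotPotential_le hd f hD))

/-- A smooth function on the quotient lifts to a bounded one, so it is the Green potential of its
image under the operator: the potential is a left inverse. -/
lemma quotPotential_lap (hd : 1 ≤ d) (hΓ : IsCocompact Γ) (f : SmoothQuot Γ) :
    quotPotential ((1 / (d : ℝ)) • lapQuot f - f) = f.1 := by
  funext m
  induction m using Quotient.inductionOn with
  | h x =>
    obtain ⟨C, hC⟩ := SmoothQuot.exists_bound hΓ f
    obtain ⟨D, hD⟩ := SmoothQuot.exists_bound hΓ ((1 / (d : ℝ)) • lapQuot f - f)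
    refine (quotPotential_covProj _ x).trans ?_
    exact ((isWeakSol_of_smooth f.2).eq_green hd (SmoothQuot.continuous f)
      (SmoothQuot.continuous ((1 / (d : ℝ)) • lapQuot f - f)) hC hD x).symm

/-- The potential is also a right inverse. Regularity of weak solutions is what keeps it inside the
space of smooth functions. -/
lemma exists_lap_eq (hd : 1 ≤ d) (hΓ : IsCocompact Γ) (f : SmoothQuot Γ) :
    ∃ F : SmoothQuot Γ, (1 / (d : ℝ)) • lapQuot F - F = f := by
  obtain ⟨D, hD⟩ := SmoothQuot.exists_bound hΓ f
  have hw := isWeakSol_greenPotential hd (SmoothQuot.continuous f) hD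
  have hc := continuous_greenPotential hd (SmoothQuot.continuous f) hD
  have hs := hw.isSmoothHyp hd hc f.2
  have he : quotPotential f ∘ covProj Γ = greenPotential (f.1 ∘ covProj Γ) :=
    funext (quotPotential_covProj f)
  refine ⟨⟨quotPotential f, by show IsSmoothHyp _; rwa [he]⟩, Subtype.ext (funext fun m => ?_)⟩
  induction m using Quotient.inductionOn with
  | h x =>
    have := hw.pointwise hd hs (SmoothQuot.continuous f) x
    rw [← he] at this
    exact this

lemma greenPotential_add (hd : 1 ≤ d) {f g : Hyp d → ℝ} (hf : Continuous f) (hg : Continuous g)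
    {C D : ℝ} (hC : ∀ y, |f y| ≤ C) (hD : ∀ y, |g y| ≤ D) (x : Hyp d) :
    greenPotential (fun y => f y + g y) x = greenPotential f x + greenPotential g x := by
  simp only [greenPotential, mul_add]
  rw [integral_add (integrable_greenKernel_mul hd hf hC x) (integrable_greenKernel_mul hd hg hD x),
    mul_add]

lemma greenPotential_const_mul (c : ℝ) (f : Hyp d → ℝ) (x : Hyp d) :
    greenPotential (fun y => c * f y) x = c * greenPotential f x := by
  simp only [greenPotential, mul_left_comm _ c]
  rw [integral_const_mul]
  ring

/-- The distribution `f ↦ ∫ h_f dμ'`. -/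
noncomputable def greenDistribution (hd : 1 ≤ d) (hΓ : IsCocompact Γ) (μ' : Measure (HypQuot Γ))
    [IsFiniteMeasure μ'] : QuotDistribution Γ where
  toLin :=
    { toFun := fun f => ∫ m, quotPotential f m ∂μ'
      map_add' := fun f g => by
        rw [← integral_add (integrable_quotPotential hd hΓ μ' f) (integrable_quotPotential hd hΓ μ' g)]
        congr 1
        funext m
        obtain ⟨C, hC⟩ := SmoothQuot.exists_bound hΓ f
        obtain ⟨D, hD⟩ := SmoothQuot.exists_bound hΓ g
        exact greenPotential_add hd (SmoothQuot.continuous f) (SmoothQuot.continuous g) hC hD _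
      map_smul' := fun c f => by
        rw [RingHom.id_apply, smul_eq_mul, ← integral_const_mul]
        congr 1
        funext m
        exact greenPotential_const_mul c _ _ }
  bound := by
    obtain ⟨K, hK, hcov⟩ := hΓ.exists_compact
    -- The distribution has order 0: a bound on a compact set meeting every orbit bounds f
    -- everywhere, and the potential does not increase the sup norm.
    refine ⟨K, 0, μ'.real univ, hK, fun f b hb => ?_⟩
    have hb' : ∀ x, |(f.1 ∘ covProj Γ) x| ≤ b := by
      intro x
      obtain ⟨γ, hγ⟩ := hcov x
      rw [← SmoothQuot.apply_smul f γ x]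
      have := hb _ hγ 0 le_rfl
      rwa [norm_iteratedFDeriv_zero, zeroExt_hyp, Real.norm_eq_abs] at this
    have := norm_integral_le_of_norm_le_const (μ := μ') (f := quotPotential f)
      (Filter.Eventually.of_forall (abs_quotPotential_le hd f hb'))
    rw [mul_comm]
    exact this

lemma isSolution_greenDistribution (hd : 1 ≤ d) (hΓ : IsCocompact Γ) (μ' : Measure (HypQuot Γ))
    [IsFiniteMeasure μ'] : IsSolution μ' (greenDistribution hd hΓ μ') := by
  intro f
  show ∫ m, quotPotential _ m ∂μ' = _
  rw [quotPotential_lap hd hΓ]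

lemma QuotDistribution.ext_toLin {T T' : QuotDistribution Γ} (h : T.toLin = T'.toLin) : T = T' := by
  cases T; cases T'; cases h; rfl

/-- The equation prescribes a solution on the image of the operator, which is all of C^∞ of the
quotient. -/
lemma IsSolution.unique (hd : 1 ≤ d) (hΓ : IsCocompact Γ) {μ' : Measure (HypQuot Γ)}
    {T T' : QuotDistribution Γ} (hT : IsSolution μ' T) (hT' : IsSolution μ' T') : T = T' := by
  refine QuotDistribution.ext_toLin (LinearMap.ext fun f => ?_)
  obtain ⟨F, rfl⟩ := exists_lap_eq hd hΓ f
  rw [hT, hT']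

/-! ## Sums over the fibres -/

/-- Translating x into a compact set only reindexes the sum over Γ, and from that set only a fixed
finite set of elements reaches the support of f. -/
lemma IsCocompact.exists_sum_bound (hΓ : IsCocompact Γ) {f : Hyp d → ℝ} (hf : Continuous f)
    (hs : HasCompactSupport f) :
    (∀ x, (Function.support fun γ : Γ => f (γ • x)).Finite) ∧
      ∃ C : ℝ≥0∞, C ≠ ⊤ ∧ ∀ x, ∑' γ : Γ, ‖f (γ • x)‖ₑ ≤ C := by
  classical
  have := hΓ.properlyDiscontinuous
  obtain ⟨K, hK, hcov⟩ := hΓ.exists_compact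
  obtain ⟨B, hB⟩ := hs.exists_bound_of_continuous hf
  have hF := ProperlyDiscontinuousSMul.finite_disjoint_inter_image (Γ := Γ) hK hs.isCompact
  have hmem : ∀ k ∈ K, ∀ γ : Γ, f (γ • k) ≠ 0 → γ ∈ hF.toFinset := fun k hk γ h =>
    hF.mem_toFinset.2 ⟨γ • k, ⟨k, hk, rfl⟩, subset_tsupport f h⟩
  have hshift : ∀ (δ : Γ) (γ : Γ) (x : Hyp d), f (γ • x) = f ((γ * δ⁻¹) • (δ • x)) := by
    intro δ γ x
    rw [smul_smul, inv_mul_cancel_right]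
  refine ⟨fun x => ?_, (hF.toFinset.card : ℝ≥0∞) * ENNReal.ofReal B, ?_, fun x => ?_⟩
  · obtain ⟨δ, hδ⟩ := hcov x
    refine (hF.toFinset.finite_toSet.preimage ((mul_left_injective δ⁻¹).injOn)).subset
      fun γ hγ => ?_
    rw [Function.mem_support, hshift δ] at hγ
    exact hmem _ hδ _ hγ
  · exact ENNReal.mul_ne_top (ENNReal.natCast_ne_top _) ENNReal.ofReal_ne_top
  · obtain ⟨δ, hδ⟩ := hcov x
    have h1 : ∑' γ : Γ, ‖f (γ • x)‖ₑ = ∑' γ : Γ, ‖f (γ • (δ • x))‖ₑ :=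
      (tsum_congr fun γ => congrArg enorm (hshift δ γ x)).trans
        ((Equiv.mulRight δ⁻¹).tsum_eq (fun γ : Γ => ‖f (γ • (δ • x))‖ₑ))
    rw [h1, tsum_eq_sum (s := hF.toFinset) fun γ hγ => by
        rw [not_not.1 (mt (hmem _ hδ γ) hγ), enorm_zero]]
    refine (Finset.sum_le_card_nsmul _ _ (ENNReal.ofReal B) fun γ _ => ?_).trans_eq
      (nsmul_eq_mul _ _)
    rw [← ofReal_norm]
    exact ENNReal.ofReal_le_ofReal (hB _)

/-- Unfolding: the integral against the lifted measure is ∫ ∑_γ h_f(γ σ(m)) dμ'(m), and ∑_γ h_f(γ x)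
is the potential at x of the orbit sum of f, by invariance of the kernel. -/
lemma isGreenPushforward_greenDistribution (hd : 1 ≤ d) (hΓ : IsCocompact Γ)
    (μ' : Measure (HypQuot Γ)) [IsFiniteMeasure μ'] {σ : HypQuot Γ → Hyp d} (hσm : Measurable σ)
    (hσ : ∀ m, covProj Γ (σ m) = m) :
    IsGreenPushforward (liftMeasure μ' σ) (greenDistribution hd hΓ μ') := by
  have := hΓ.countable
  intro f hf
  have hfc := hf.1.continuous
  obtain ⟨B, hB⟩ := hf.2.exists_bound_of_continuous hfc
  obtain ⟨hfin, C, hC, hsum⟩ := hΓ.exists_sum_bound hfc hf.2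
  have hfγ : ∀ γ : Γ, Continuous fun y => f (γ • y) := fun γ =>
    hfc.comp (continuous_const_smul γ)
  have hm : ∀ γ : Γ, Measurable fun m => γ • σ m := fun γ =>
    (continuous_const_smul γ).measurable.comp hσm
  have hGm : Measurable (greenPotential f) := (continuous_greenPotential hd hfc hB).measurable
  have hker : ∀ x, ∫⁻ y, ‖greenKernel x y‖ₑ ∂(hypVol d) ≤ ENNReal.ofReal (1 / d) := by
    intro x
    simp only [greenKernel_eq hd]
    exact lintegral_green_le hd x
  have hI : ∀ (x : Hyp d) (γ : Γ), Integrable (fun y => greenKernel x y * f (γ • y)) (hypVol d) :=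
    fun x γ => integrable_greenKernel_mul hd (hfγ γ) (fun y => hB _) x
  -- A bound uniform in x. It justifies exchanging the orbit sum both with the integral against the
  -- kernel and with the one against the finite measure μ'.
  have hA : ∀ x, ∑' γ : Γ, ∫⁻ y, ‖greenKernel x y * f (γ • y)‖ₑ ∂(hypVol d) ≤
      ENNReal.ofReal (1 / d) * C := by
    intro x
    rw [← lintegral_tsum fun γ => (hI x γ).1.enorm]
    calc ∫⁻ y, ∑' γ : Γ, ‖greenKernel x y * f (γ • y)‖ₑ ∂(hypVol d)
        ≤ ∫⁻ y, ‖greenKernel x y‖ₑ * C ∂(hypVol d) := by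
          refine lintegral_mono fun y => ?_
          simp only [enorm_mul]
          rw [ENNReal.tsum_mul_left]
          exact mul_le_mul_right (hsum y) _
      _ ≤ _ := by
          rw [lintegral_mul_const' _ _ hC]
          exact mul_le_mul_left (hker x) _
  have hfinA : ENNReal.ofReal (1 / d) * C ≠ ⊤ := ENNReal.mul_ne_top ENNReal.ofReal_ne_top hC
  have hpot : ∀ (γ : Γ) x, greenPotential f (γ • x) =
      d * ∫ y, greenKernel x y * f (γ • y) ∂(hypVol d) := fun γ x => greenPotential_smul γ.1 f x
  have hE : ∀ x, ∑' γ : Γ, ‖greenPotential f (γ • x)‖ₑ ≤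
      ‖(d : ℝ)‖ₑ * (ENNReal.ofReal (1 / d) * C) := by
    intro x
    refine le_trans ?_ (mul_le_mul_right (hA x) _)
    rw [← ENNReal.tsum_mul_left]
    refine ENNReal.tsum_le_tsum fun γ => ?_
    rw [hpot, enorm_mul]
    exact mul_le_mul_right (enorm_integral_le_lintegral_enorm _) _
  have hG : ∀ γ : Γ, Measurable fun m => greenPotential f (γ • σ m) := fun γ => hGm.comp (hm γ)
  have hT : ∑' γ : Γ, ∫⁻ m, ‖greenPotential f (γ • σ m)‖ₑ ∂μ' ≠ ⊤ := by
    rw [← lintegral_tsum fun γ => (hG γ).enorm.aemeasurable]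
    refine ne_top_of_le_ne_top ?_ (lintegral_mono fun m => hE (σ m))
    rw [lintegral_const]
    exact ENNReal.mul_ne_top (ENNReal.mul_ne_top enorm_ne_top hfinA) (measure_ne_top _ _)
  have hint : Integrable (greenPotential f) (liftMeasure μ' σ) := by
    refine ⟨hGm.aestronglyMeasurable, ?_⟩
    rw [HasFiniteIntegral, liftMeasure, lintegral_sum_measure]
    simp only [lintegral_map hGm.enorm (hm _)]
    exact hT.lt_top
  refine ⟨fun x => integrable_greenKernel_mul hd hfc hB x, hint, fun f' hf' => ?_⟩
  show ∫ m, quotPotential f' m ∂μ' = _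
  rw [liftMeasure, integral_sum_measure hint]
  simp only [integral_map (hm _).aemeasurable hGm.aestronglyMeasurable]
  rw [← integral_tsum (fun γ => (hG γ).aestronglyMeasurable) hT]
  congr 1
  funext m
  conv_lhs => rw [← hσ m]
  rw [quotPotential_covProj]
  simp only [hpot]
  rw [tsum_mul_left, ← integral_tsum (fun γ => (hI (σ m) γ).1)
    (ne_top_of_le_ne_top hfinA (hA (σ m))), greenPotential]
  congr 2
  funext y
  rw [tsum_mul_left, tsum_eq_finsum (hfin y), ← hf' y, Function.comp_apply]

end Quotient

/-! ### F-convex sets: support function, minimizers, orthogonal projection. -/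

section Convex

variable {d : ℕ}

/-! ## Support functions of F-convex sets -/

/-- The support function of `K`. -/
noncomputable def suppFun (K : Set (Mink d)) (η : Mink d) : ℝ := sSup ((fun k => mink η k) '' K)

/-- The support function of `K` on `ℍ^d`. -/
noncomputable def suppHyp (K : Set (Mink d)) (η : Hyp d) : ℝ := suppFun K η

namespace IsFConvex

variable {K : Set (Mink d)} (hK : IsFConvex K)
include hK

lemma isGreatest {η : Mink d} (hη : η ∈ futureCone d) :
    IsGreatest ((fun k => mink η k) '' K) (suppFun K η) := by
  obtain ⟨α, h1, k, hk, h2⟩ := hK.support η hη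
  have : IsGreatest ((fun k => mink η k) '' K) α :=
    ⟨⟨k, hk, h2⟩, by rintro _ ⟨k', hk', rfl⟩; exact h1 k' hk'⟩
  rwa [suppFun, this.csSup_eq]

lemma le_suppFun {η : Mink d} (hη : η ∈ futureCone d) {k : Mink d} (hk : k ∈ K) :
    mink η k ≤ suppFun K η := (hK.isGreatest hη).2 ⟨k, hk, rfl⟩

lemma exists_mem {η : Mink d} (hη : η ∈ futureCone d) : ∃ k ∈ K, mink η k = suppFun K η :=
  (hK.isGreatest hη).1

lemma suppFun_smul {η : Mink d} (hη : η ∈ futureCone d) {t : ℝ} (ht : 0 < t) :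
    suppFun K (t • η) = t * suppFun K η := by
  have hη' := smul_mem_futureCone hη ht
  obtain ⟨k, hk, h⟩ := hK.exists_mem hη
  obtain ⟨k', hk', h'⟩ := hK.exists_mem hη'
  refine le_antisymm ?_ ?_
  · rw [← h', mink_smul_left]
    exact mul_le_mul_of_nonneg_left (hK.le_suppFun hη hk') ht.le
  · rw [← h, ← mink_smul_left]
    exact hK.le_suppFun hη' hk

lemma suppFun_add_le {η ξ : Mink d} (hη : η ∈ futureCone d) (hξ : ξ ∈ futureCone d) :
    suppFun K (η + ξ) ≤ suppFun K η + suppFun K ξ := by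
  obtain ⟨k, hk, h⟩ := hK.exists_mem (add_mem_futureCone hη (mem_futureCone.1 hξ).le)
  rw [← h, mink_add_left]
  exact add_le_add (hK.le_suppFun hη hk) (hK.le_suppFun hξ hk)

/-- Each defining half-space has a normal in the cone, and its constant is at least the support
function there, so the support function alone recovers K. -/
lemma mem_of_forall {x : Mink d} (hx : ∀ η ∈ futureCone d, mink η x ≤ suppFun K η) : x ∈ K := by
  obtain ⟨S, hS, hKS⟩ := hK.inter
  rw [hKS]
  intro p hp
  obtain ⟨k, hk, h⟩ := hK.exists_mem (hS p hp)
  have h1 := hx p.1 (hS p hp)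
  rw [hKS] at hk
  have h2 := hk p hp
  rw [mink_comm x]
  rw [mink_comm k] at h2
  linarith

lemma suppFun_eq {η : Mink d} (hη : η ∈ futureCone d) :
    suppFun K η = oneExt (suppHyp K) η := by
  rw [oneExt, suppHyp, ← hK.suppFun_smul (Hyp.mem_cone _) (mnorm_pos hη), mnorm_smul_hypProj hη]

/-- K is future complete: adding a future causal vector decreases every product ⟨η, ·⟩₋ with η in
the cone. -/
lemma add_mem {k v : Mink d} (hk : k ∈ K) (hv : ‖v.1‖ ≤ v.2) : k + v ∈ K := by
  refine hK.mem_of_forall fun η hη => ?_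
  have h1 : mnorm η * mnorm v ≤ -mink η v := mnorm_mul_le (mem_futureCone.1 hη).le hv
  have h2 : 0 ≤ mnorm η * mnorm v := mul_nonneg (Real.sqrt_nonneg _) (Real.sqrt_nonneg _)
  rw [mink_add_right]
  linarith [hK.le_suppFun hη hk]

/-- Positive homogeneity and subadditivity make the function convex, and finite convex functions on
open sets in finite dimension are continuous. -/
lemma continuousOn_suppFun : ContinuousOn (suppFun K) (futureCone d) := by
  refine ConvexOn.continuousOn (isOpen_futureCone d) ⟨convex_futureCone, ?_⟩
  intro x hx y hy a b ha hb hab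
  rcases ha.eq_or_lt with rfl | ha
  · have : b = 1 := by linarith
    simp [this]
  rcases hb.eq_or_lt with rfl | hb
  · have : a = 1 := by linarith
    simp [this]
  rw [smul_eq_mul, smul_eq_mul, ← hK.suppFun_smul hx ha, ← hK.suppFun_smul hy hb]
  exact hK.suppFun_add_le (smul_mem_futureCone hx ha) (smul_mem_futureCone hy hb)

lemma continuous_suppHyp : Continuous (suppHyp K) :=
  hK.continuousOn_suppFun.comp_continuous continuous_subtype_val fun η => η.mem_cone

/-- Comparison with the linear function of a single point of K; on ℍ^d the norm is the height. -/
lemma exists_lower_bound : ∃ B : ℝ, 0 ≤ B ∧ ∀ η : Hyp d, -(B * η.1.2) ≤ suppHyp K η := by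
  obtain ⟨k, hk, -⟩ := hK.exists_mem (hypOrigin d).mem_cone
  refine ⟨2 * ‖k‖, by positivity, fun η => ?_⟩
  have h1 := hK.le_suppFun η.mem_cone hk
  have h2 := abs_mink_le (η : Mink d) k
  rw [η.norm_eq] at h2
  have h3 := neg_abs_le (mink (η : Mink d) k)
  rw [suppHyp]
  linarith

/-- The support points over a compact set of directions are bounded. -/
lemma exists_bound_support {Z : Set (Hyp d)} (hZ : IsCompact Z) :
    ∃ R : ℝ, ∀ n ∈ Z, ∀ r ∈ K, mink (n : Mink d) r = suppHyp K n → ‖r‖ ≤ R := by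
  have hZc : IsCompact ((↑) '' Z : Set (Mink d)) := hZ.image continuous_subtype_val
  obtain ⟨δ, hδ, hδF⟩ := hZc.exists_cthickening_subset_open (isOpen_futureCone d) (by
    rintro _ ⟨n, -, rfl⟩; exact n.mem_cone)
  obtain ⟨M, hM⟩ := (hZc.cthickening (r := δ)).exists_bound_of_continuousOn
    (hK.continuousOn_suppFun.mono hδF)
  refine ⟨2 * M / δ, fun n hn r hr hnr => ?_⟩
  rcases eq_or_ne r 0 with rfl | hr0
  · have := (norm_nonneg _).trans (hM n (Metric.self_subset_cthickening _ ⟨n, hn, rfl⟩))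
    rw [norm_zero]
    positivity
  have hr0 : 0 < ‖r‖ := norm_pos_iff.2 hr0
  -- Time reflection makes ⟨w, r⟩₋ the Euclidean square of r. Shifting n by a multiple of w of
  -- length δ stays where the support function is bounded by M, and the support inequality there
  -- gives δ ‖r‖ ≤ 2 M.
  set w : Mink d := (r.1, -r.2) with hw
  have hwn : ‖w‖ = ‖r‖ := by simp [hw, Prod.norm_def]
  have hwr : ‖r‖ ^ 2 ≤ mink w r := by
    have h1 : mink w r = ‖r.1‖ ^ 2 + r.2 ^ 2 := by
      simp only [mink, hw, real_inner_self_eq_norm_sq]; ring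
    rw [h1, Prod.norm_def]
    rcases max_cases ‖r.1‖ ‖r.2‖ with ⟨h, -⟩ | ⟨h, -⟩
    · rw [h]; nlinarith [sq_nonneg r.2]
    · rw [h, Real.norm_eq_abs, sq_abs]; nlinarith [sq_nonneg ‖r.1‖]
  have hn1 : (n : Mink d) + (δ / ‖r‖) • w ∈ Metric.cthickening δ ((↑) '' Z : Set (Mink d)) := by
    refine Metric.mem_cthickening_of_dist_le _ (n : Mink d) _ _ ⟨n, hn, rfl⟩ ?_
    rw [dist_eq_norm, add_sub_cancel_left, norm_smul, hwn, Real.norm_of_nonneg (by positivity),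
      div_mul_cancel₀ _ hr0.ne']
  have h1 := hK.le_suppFun (hδF hn1) hr
  rw [mink_add_left, mink_smul_left, hnr] at h1
  have h2 := (abs_le.1 (hM _ hn1)).2
  have h3 := (abs_le.1 (hM n (Metric.self_subset_cthickening _ ⟨n, hn, rfl⟩))).1
  have h4 : δ / ‖r‖ * ‖r‖ ^ 2 ≤ δ / ‖r‖ * mink w r := by gcongr
  have h5 : δ / ‖r‖ * ‖r‖ ^ 2 = ‖r‖ * δ := by field_simp
  rw [le_div_iff₀ hδ]
  rw [suppHyp] at h1
  linarith

end IsFConvex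

lemma IsFConvex.ext_suppHyp {K K' : Set (Mink d)} (hK : IsFConvex K) (hK' : IsFConvex K')
    (h : suppHyp K = suppHyp K') : K = K' := by
  have key : ∀ {K K' : Set (Mink d)}, IsFConvex K → IsFConvex K' → suppHyp K = suppHyp K' →
      K ⊆ K' := fun hK hK' h x hx => hK'.mem_of_forall fun η hη => by
    rw [hK'.suppFun_eq hη, ← h, ← hK.suppFun_eq hη]
    exact hK.le_suppFun hη hx
  exact (key hK hK' h).antisymm (key hK' hK h.symm)

/-- ⟨γη, γk + τ_γ⟩₋ = ⟨η, k⟩₋ + ⟨γ⁻¹τ_γ, η⟩₋, and k ↦ γk + τ_γ maps K onto itself. -/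
lemma IsTauFConvex.isEquivariant {Γ : Subgroup (HypIsom d)} {τ : Γ → Mink d} {K : Set (Mink d)}
    (hK : IsTauFConvex τ K) : IsEquivariant τ (suppHyp K) := by
  refine ⟨fun η hη t ht => ?_, fun γ η hη => ?_⟩
  · rw [← hK.1.suppFun_eq hη, ← hK.1.suppFun_eq (smul_mem_futureCone hη ht),
      hK.1.suppFun_smul hη ht]
  · have hγη : isomLin γ.1 η ∈ futureCone d := (γ.1.2.2 η).2 hη
    have hmink : ∀ k, mink (isomLin γ.1 η) (isomLin γ.1 k + τ γ) =
        mink η k + mink ((isomLin γ.1).symm (τ γ)) η := by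
      intro k
      have h1 : mink (isomLin γ.1 η) (isomLin γ.1 k) = mink η k := γ.1.2.1 _ _
      have h2 : mink (isomLin γ.1 η) (isomLin γ.1 ((isomLin γ.1).symm (τ γ))) =
        mink η ((isomLin γ.1).symm (τ γ)) := γ.1.2.1 _ _
      rw [ContinuousLinearEquiv.apply_symm_apply] at h2
      rw [mink_add_right, h1, h2, mink_comm _ η]
    rw [← hK.1.suppFun_eq hη, ← hK.1.suppFun_eq hγη]
    refine le_antisymm ?_ ?_
    · obtain ⟨k, hk, h⟩ := hK.1.exists_mem hγη
      rw [← hK.2 γ] at hk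
      obtain ⟨k', hk', rfl⟩ := hk
      rw [← h, hmink]
      exact add_le_add_left (hK.1.le_suppFun hη hk') _
    · obtain ⟨k, hk, h⟩ := hK.1.exists_mem hη
      rw [← h, ← hmink]
      refine hK.1.le_suppFun hγη ?_
      rw [← hK.2 γ]
      exact ⟨k, hk, rfl⟩

/-! ## Minimizers of `s h - ⟨x, ·⟩` -/

/-- `n` minimizes `η ↦ s h(η) - ⟨x, η⟩` on `ℍ^d`. -/
def IsMinAt (h : Hyp d → ℝ) (s : ℝ) (x : Mink d) (n : Hyp d) : Prop :=
  ∀ η : Hyp d, s * h n - mink x n ≤ s * h η - mink x η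

/-- For x at depth c in the cone, -⟨x, η⟩₋ grows at least like c times the height, and half of this
absorbs the possible linear decay of s h. -/
lemma coercive {h : Hyp d → ℝ} {B : ℝ} (hB : ∀ η : Hyp d, -(B * η.1.2) ≤ h η) {s c : ℝ}
    (hs : 0 ≤ s) (hsB : s * B ≤ c / 2) {x : Mink d} (hx : ‖x.1‖ + c ≤ x.2)
    (η : Hyp d) : c / 2 * η.1.2 ≤ s * h η - mink x η := by
  have h1 := snd_le_of_mink x η.fst_lt.le
  have h2 := mul_le_mul_of_nonneg_left (hB η) hs
  have h3 := η.2.2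
  nlinarith

lemma exists_isMinAt {h : Hyp d → ℝ} (hc : Continuous h) {B : ℝ}
    (hB : ∀ η : Hyp d, -(B * η.1.2) ≤ h η) {s c : ℝ} (hs : 0 ≤ s) (hc0 : 0 < c)
    (hsB : s * B ≤ c / 2) {x : Mink d} (hx : ‖x.1‖ + c ≤ x.2) :
    ∃ n, IsMinAt h s x n := by
  have hcont : Continuous fun η : Hyp d => s * h η - mink x η :=
    (continuous_const.mul hc).sub (continuous_mink.comp
      (continuous_const.prodMk continuous_subtype_val))
  set v := s * h (hypOrigin d) - mink x (hypOrigin d) with hv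
  set C := max (2 / c * v) 1 with hC
  have hCo : ∀ η : Hyp d, s * h η - mink x η ≤ v → -mink (hypOrigin d : Mink d) η ≤ C := by
    intro η hη
    rw [mink_hypOrigin]
    refine le_max_of_le_left ?_
    have := coercive hB hs hsB hx η
    rw [div_mul_eq_mul_div, le_div_iff₀ hc0]
    linarith
  obtain ⟨n, hn, hmin⟩ := (isCompact_hyp_le (hypOrigin d) C).exists_isMinOn
    ⟨hypOrigin d, hCo _ le_rfl⟩ hcont.continuousOn
  refine ⟨n, fun η => ?_⟩
  by_cases hη : -mink (hypOrigin d : Mink d) η ≤ C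
  · exact hmin hη
  · have h1 : s * h n - mink x n ≤ v := hmin (hCo _ le_rfl)
    have h2 : ¬ (s * h η - mink x η ≤ v) := fun h => hη (hCo η h)
    linarith [not_le.1 h2]

/-! ## The orthogonal projection -/

/-- `k - t n` is a support point of `K` in the direction `n`. -/
def Touch (K : Set (Mink d)) (k : Mink d) (t : ℝ) (n : Hyp d) : Prop :=
  k - t • (n : Mink d) ∈ K ∧ mink (n : Mink d) (k - t • (n : Mink d)) = suppHyp K n

/-- The support inequality in the direction n, evaluated at the other contact point. -/
lemma Touch.mul_le {K : Set (Mink d)} {k : Mink d} {t t' : ℝ} {n n' : Hyp d}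
    (hK : IsFConvex K) (h : Touch K k t n) (h' : Touch K k t' n') :
    t' * -mink (n : Mink d) n' ≤ t := by
  have h1 := hK.le_suppFun n.mem_cone h'.1
  have h2 := h.2
  rw [suppHyp] at h2
  rw [← h2] at h1
  simp only [mink_sub_right, mink_smul_right, n.2.1] at h1
  linarith

/-- With σ = -⟨n, n'⟩₋ ≥ 1, both t'σ ≤ t and tσ ≤ t' hold, which forces t = t' and then σ = 1. -/
lemma Touch.unique {K : Set (Mink d)} {k : Mink d} {t t' : ℝ} {n n' : Hyp d}
    (hK : IsFConvex K) (h : Touch K k t n) (h' : Touch K k t' n') (ht : 0 < t) (ht' : 0 < t') :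
    t = t' ∧ n = n' := by
  have h1 := h.mul_le hK h'
  have h2 := h'.mul_le hK h
  rw [mink_comm] at h2
  have h3 := n.one_le n'
  have h4 : t' ≤ t := by nlinarith
  have h5 : t ≤ t' := by nlinarith
  have h6 : t = t' := le_antisymm h5 h4
  refine ⟨h6, Hyp.eq_of_mink ?_⟩
  rw [← h6] at h1
  exact le_of_mul_le_mul_left (by linarith) ht

/-- For a competitor r' of K in the past of k, the reverse Cauchy-Schwarz inequality and the support
inequality give ‖k - r'‖₋ ≤ -⟨n, k - r'⟩₋ ≤ t. The contact point is on the boundary because moving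
it along -n leaves K. -/
lemma Touch.isOrthProj {K : Set (Mink d)} (hK : IsFConvex K) {k : Mink d} {t : ℝ} {n : Hyp d}
    (h : Touch K k t n) (ht : 0 < t) :
    IsOrthProj K k (k - t • (n : Mink d)) := by
  have hF : t • (n : Mink d) ∈ futureCone d := smul_mem_futureCone n.mem_cone ht
  refine ⟨⟨?_, ?_⟩, fun r' hr' hkr' => ?_⟩
  · rw [hK.closed.frontier_eq]
    refine ⟨h.1, fun hint => ?_⟩
    have hc : Filter.Tendsto (fun δ : ℝ => k - t • (n : Mink d) - δ • (n : Mink d)) (𝓝[>] 0)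
        (𝓝 (k - t • (n : Mink d) - (0 : ℝ) • (n : Mink d))) :=
      ((continuous_const.sub (continuous_id.smul continuous_const)).tendsto 0).mono_left
        nhdsWithin_le_nhds
    rw [zero_smul, sub_zero] at hc
    obtain ⟨δ, hδ, hδ0⟩ := ((hc.eventually (mem_interior_iff_mem_nhds.1 hint)).and
      self_mem_nhdsWithin).exists
    have h1 := hK.le_suppFun n.mem_cone hδ
    have h2 := h.2
    rw [mink_sub_right, mink_smul_right, n.2.1, h2, suppHyp] at h1
    have : (0 : ℝ) < δ := hδ0
    linarith
  · rw [sub_sub_cancel]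
    exact subset_closure hF
  · rw [sub_sub_cancel, mnorm_smul _ ht.le, n.mnorm_eq, mul_one]
    rw [closure_futureCone] at hkr'
    have h1 := mnorm_mul_le n.fst_lt.le hkr'
    rw [n.mnorm_eq, one_mul] at h1
    have h2 := hK.le_suppFun n.mem_cone (hK.closed.frontier_subset hr')
    have h3 := h.2
    rw [suppHyp] at h3
    rw [← h3, mink_sub_right, mink_smul_right, n.2.1] at h2
    rw [mink_sub_right] at h1
    linarith

/-- If the hyperplane through r orthogonal to n did not support K, moving r slightly towards a point
of K with a larger product with n would increase the distance to k; sliding that point down along -n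
to the boundary does not decrease it. This contradicts maximality. -/
lemma touch_of_isOrthProj {K : Set (Mink d)} (hK : IsFConvex K) {k r : Mink d}
    (h : IsOrthProj K k r) {n : Hyp d} {t : ℝ} (ht : 0 < t) (htn : k - r = t • (n : Mink d)) :
    Touch K k t n := by
  have hr : k - t • (n : Mink d) = r := by rw [← htn, sub_sub_cancel]
  have hrK : r ∈ K := hK.closed.frontier_subset h.1.1
  have hmn : mnorm (k - r) = t := by rw [htn, mnorm_smul _ ht.le, n.mnorm_eq, mul_one]
  rw [Touch, hr]
  refine ⟨hrK, le_antisymm (hK.le_suppFun n.mem_cone hrK) ?_⟩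
  by_contra hlt
  obtain ⟨k', hk', hk'h⟩ := hK.exists_mem n.mem_cone
  rw [suppHyp, ← hk'h, not_le, ← sub_pos, ← mink_sub_right] at hlt
  set w := k' - r with hw
  -- a point of `K` at a greater distance
  obtain ⟨p, hpK, hpF, hpt⟩ : ∃ p ∈ K, k - p ∈ futureCone d ∧ t < mnorm (k - p) := by
    have hc : Continuous fun l : ℝ => t • (n : Mink d) - l • w := by fun_prop
    have hF : ∀ᶠ l in 𝓝[>] (0 : ℝ), t • (n : Mink d) - l • w ∈ futureCone d := by
      refine ((hc.tendsto 0).mono_left nhdsWithin_le_nhds).eventually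
        ((isOpen_futureCone d).mem_nhds ?_)
      simpa using smul_mem_futureCone n.mem_cone ht
    have hq : ∀ᶠ l in 𝓝[>] (0 : ℝ), 0 < 2 * t * mink (n : Mink d) w - l * mink w w := by
      have hc' : Continuous fun l : ℝ => 2 * t * mink (n : Mink d) w - l * mink w w := by fun_prop
      refine ((hc'.tendsto 0).mono_left nhdsWithin_le_nhds).eventually (lt_mem_nhds ?_)
      rw [zero_mul, sub_zero]; positivity
    obtain ⟨l, ⟨⟨h1, h2⟩, hl1⟩, hl0⟩ := (((hF.and hq).and
      ((gt_mem_nhds one_pos).filter_mono nhdsWithin_le_nhds)).and self_mem_nhdsWithin).exists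
    have hl0 : (0 : ℝ) < l := hl0
    have e1 : k - (r + l • w) = t • (n : Mink d) - l • w := by rw [← htn]; abel
    refine ⟨r + l • w, hK.convex.add_smul_sub_mem hrK hk' ⟨hl0.le, hl1.le⟩, by rwa [e1], ?_⟩
    rw [e1]
    refine Real.lt_sqrt_of_sq_lt ?_
    simp only [mink_sub_left, mink_sub_right, mink_smul_left, mink_smul_right, n.2.1,
      mink_comm w (n : Mink d)]
    nlinarith
  -- push it to the boundary
  set S : Set ℝ := {σ | 0 ≤ σ ∧ p - σ • (n : Mink d) ∈ K} with hS
  have hSc : IsCompact S := by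
    refine Metric.isCompact_of_isClosed_isBounded ?_ ?_
    · exact isClosed_Ici.inter (hK.closed.preimage (by fun_prop))
    · refine (Metric.isBounded_Icc 0 (suppFun K n - mink (n : Mink d) p)).subset fun σ hσ =>
        ⟨hσ.1, ?_⟩
      have := hK.le_suppFun n.mem_cone hσ.2
      rw [mink_sub_right, mink_smul_right, n.2.1] at this
      linarith
  obtain ⟨σ, hσ, hmax⟩ := hSc.exists_isGreatest ⟨0, le_rfl, by simpa using hpK⟩
  have hfr : p - σ • (n : Mink d) ∈ frontier K := by
    rw [hK.closed.frontier_eq]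
    refine ⟨hσ.2, fun hint => ?_⟩
    have hc : Filter.Tendsto (fun δ : ℝ => p - δ • (n : Mink d)) (𝓝[>] σ)
        (𝓝 (p - σ • (n : Mink d))) :=
      ((continuous_const.sub (continuous_id.smul continuous_const)).tendsto σ).mono_left
        nhdsWithin_le_nhds
    obtain ⟨δ, hδ, hδ0⟩ := ((hc.eventually (mem_interior_iff_mem_nhds.1 hint)).and
      self_mem_nhdsWithin).exists
    have hδ0 : σ < δ := hδ0
    exact absurd (hmax ⟨hσ.1.trans hδ0.le, hδ⟩) (not_le.2 hδ0)
  have e2 : k - (p - σ • (n : Mink d)) = (k - p) + σ • (n : Mink d) := by abel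
  have hcausal : ‖(σ • (n : Mink d)).1‖ ≤ (σ • (n : Mink d)).2 := by
    simp only [Prod.smul_fst, Prod.smul_snd, norm_smul, Real.norm_of_nonneg hσ.1, smul_eq_mul]
    exact mul_le_mul_of_nonneg_left n.fst_lt.le hσ.1
  have h1 := h.2 _ hfr (by rw [e2]; exact subset_closure (add_mem_futureCone hpF hcausal))
  rw [hmn, e2] at h1
  have h2 : mnorm (k - p) ≤ mnorm (k - p + σ • (n : Mink d)) := by
    refine Real.sqrt_le_sqrt ?_
    have h3 := mnorm_mul_le (mem_futureCone.1 hpF).le n.fst_lt.le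
    have h4 : 0 ≤ -mink (k - p) n := le_trans (mul_nonneg (Real.sqrt_nonneg _)
      (Real.sqrt_nonneg _)) h3
    rw [mink_add_left, mink_add_right, mink_add_right, mink_smul_left, mink_smul_left,
      mink_smul_right, mink_smul_right, n.2.1, mink_comm (n : Mink d) (k - p)]
    nlinarith [hσ.1, mul_nonneg hσ.1 h4, mul_nonneg hσ.1 hσ.1]
  linarith

lemma mem_brush_iff {K : Set (Mink d)} (hK : IsFConvex K) {ε : ℝ} {A : Set (Hyp d)} {k : Mink d} :
    k ∈ brush K ε A ↔ ∃ t n, 0 < t ∧ t ≤ ε ∧ n ∈ A ∧ Touch K k t n := by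
  constructor
  · rintro ⟨-, r, hr, hpos, hle, η, hη, hηe⟩
    refine ⟨mnorm (k - r), η, hpos, hle, hη, touch_of_isOrthProj hK hr hpos ?_⟩
    rw [hηe, smul_smul, mul_inv_cancel₀ hpos.ne', one_smul]
  · rintro ⟨t, n, ht, htε, hn, h⟩
    have hmn : mnorm (k - (k - t • (n : Mink d))) = t := by
      rw [sub_sub_cancel, mnorm_smul _ ht.le, n.mnorm_eq, mul_one]
    refine ⟨?_, _, h.isOrthProj hK ht, by rwa [hmn], by rwa [hmn], n, hn, ?_⟩
    · have := hK.add_mem h.1 (v := t • (n : Mink d)) ?_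
      · rwa [sub_add_cancel] at this
      · exact (mem_futureCone.1 (smul_mem_futureCone n.mem_cone ht)).le
    · rw [hmn, sub_sub_cancel, smul_smul, inv_mul_cancel₀ ht.ne', one_smul]

/-- First-order condition for the minimum. By homogeneity the sublinear function P(ξ) = s H(ξ) - ⟨x,
ξ⟩₋ is at least T‖ξ‖₋ on the cone, with equality at n, and -⟨n, η⟩₋ is the derivative of the norm at
n in the direction η. -/
lemma IsMinAt.mul_le {K : Set (Mink d)} (hK : IsFConvex K) {s : ℝ} (hs : 0 < s) {x : Mink d}
    {n : Hyp d} (h : IsMinAt (suppHyp K) s x n) (hT : 0 < s * suppHyp K n - mink x n)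
    {η : Mink d} (hη : η ∈ futureCone d) :
    (s * suppHyp K n - mink x n) * -mink (n : Mink d) η ≤ s * suppFun K η - mink x η := by
  set T := s * suppHyp K n - mink x n with hTdef
  set P := s * suppFun K η - mink x η with hP
  have hlow : ∀ ξ ∈ futureCone d, T * mnorm ξ ≤ s * suppFun K ξ - mink x ξ := by
    intro ξ hξ
    have h1 := mul_le_mul_of_nonneg_right (h (hypProj ξ)) (mnorm_pos hξ).le
    refine h1.trans_eq ?_
    have h2 : mink x ξ = mnorm ξ * mink x (hypProj ξ) := by
      rw [← mink_smul_right, mnorm_smul_hypProj hξ]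
    rw [hK.suppFun_eq hξ, oneExt, h2]
    ring
  have hP0 : 0 ≤ P := (mul_nonneg hT.le (Real.sqrt_nonneg _)).trans (hlow η hη)
  -- Comparison at n + lη, squared so that the norm need not be differentiated. Dividing by l and
  -- letting l → 0 gives the claim.
  have key : ∀ l : ℝ, 0 < l → 2 * T * (T * -mink (n : Mink d) η) ≤ 2 * T * P + l * P ^ 2 := by
    intro l hl
    have hlη := smul_mem_futureCone hη hl
    have hsum := add_mem_futureCone n.mem_cone (mem_futureCone.1 hlη).le
    have h1 := hlow _ hsum
    have h2 := hK.suppFun_add_le n.mem_cone hlη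
    rw [hK.suppFun_smul hη hl] at h2
    have h3 : T * mnorm ((n : Mink d) + l • η) ≤ T + l * P := by
      rw [mink_add_right, mink_smul_right] at h1
      have h4 := mul_le_mul_of_nonneg_left h2 hs.le
      have : suppHyp K n = suppFun K n := rfl
      rw [hTdef, hP, this]
      rw [hTdef, this] at h1
      linarith
    have h5 : mnorm ((n : Mink d) + l • η) ^ 2 = 1 + 2 * l * -mink (n : Mink d) η +
        l ^ 2 * -mink η η := by
      rw [mnorm_sq hsum]
      simp only [mink_add_left, mink_add_right, mink_smul_left, mink_smul_right, n.2.1,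
        mink_comm η (n : Mink d)]
      ring
    have h6 : (T * mnorm ((n : Mink d) + l • η)) ^ 2 ≤ (T + l * P) ^ 2 :=
      pow_le_pow_left₀ (mul_nonneg hT.le (Real.sqrt_nonneg _)) h3 2
    rw [mul_pow, h5] at h6
    have h7 : 0 ≤ T ^ 2 * (l ^ 2 * -mink η η) := by
      have := hη.1
      have : 0 ≤ -mink η η := by linarith
      positivity
    have h8 : l * (2 * T * (T * -mink (n : Mink d) η)) ≤ l * (2 * T * P + l * P ^ 2) := by
      nlinarith
    exact le_of_mul_le_mul_left h8 hl
  have hlim : Filter.Tendsto (fun l : ℝ => 2 * T * P + l * P ^ 2) (𝓝[>] 0)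
      (𝓝 (2 * T * P + 0 * P ^ 2)) :=
    ((continuous_const.add (continuous_id.mul continuous_const)).tendsto 0).mono_left
      nhdsWithin_le_nhds
  have h9 := ge_of_tendsto hlim (by
    filter_upwards [self_mem_nhdsWithin] with l hl using key l hl)
  rw [zero_mul, add_zero] at h9
  exact le_of_mul_le_mul_left h9 (by positivity)

/-- The inequalities of `IsMinAt.mul_le` over all η say that (x - T n)/s lies in K; the definition
of T says that it lies on the support hyperplane of normal n. So minimizers are contact normals at
x/s, and T/s is the cosmological time. -/
lemma IsMinAt.touch {K : Set (Mink d)} (hK : IsFConvex K) {s : ℝ} (hs : 0 < s) {x : Mink d}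
    {n : Hyp d} (h : IsMinAt (suppHyp K) s x n) (hT : 0 < s * suppHyp K n - mink x n) :
    Touch K (s⁻¹ • x) (s⁻¹ * (s * suppHyp K n - mink x n)) n := by
  refine ⟨hK.mem_of_forall fun η hη => ?_, ?_⟩
  · have h1 := h.mul_le hK hs hT hη
    simp only [mink_sub_right, mink_smul_right]
    rw [mink_comm η x, mink_comm η n, mul_assoc, ← mul_sub, inv_mul_le_iff₀ hs]
    linarith
  · simp only [mink_sub_right, mink_smul_right, n.2.1, mink_comm (n : Mink d) x]
    field_simp
    ring

/-- The minimizers depend on the point in a Lipschitz way. -/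
lemma IsMinAt.norm_sub_le {K : Set (Mink d)} (hK : IsFConvex K) {s : ℝ} (hs : 0 < s) {x y : Mink d}
    {n p : Hyp d} (h : IsMinAt (suppHyp K) s x n) (h' : IsMinAt (suppHyp K) s y p) {c B : ℝ}
    (hc : 0 < c) (hT : c ≤ s * suppHyp K n - mink x n) (hT' : c ≤ s * suppHyp K p - mink y p)
    (hn : n.1.2 ≤ B) (hp : p.1.2 ≤ B) :
    ‖(n : Mink d) - p‖ ≤ 2 * B ^ 2 / c * ‖x - y‖ := by
  have h1 := h.mul_le hK hs (hc.trans_le hT) p.mem_cone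
  have h2 := h'.mul_le hK hs (hc.trans_le hT') n.mem_cone
  rw [mink_comm (p : Mink d) n] at h2
  set σ := -mink (n : Mink d) p with hσ
  have hσ1 : 1 ≤ σ := n.one_le p
  have h3 := n.norm_sub_sq_le p
  rw [← hσ] at h3
  have h4 := abs_mink_le (x - y) ((n : Mink d) - p)
  have h5 := le_abs_self (mink (x - y) ((n : Mink d) - p))
  have e : mink (x - y) ((n : Mink d) - p) = mink x n - mink x p - (mink y n - mink y p) := by
    simp only [mink_sub_left, mink_sub_right]; ring
  have e1 : suppFun K n = suppHyp K n := rfl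
  have e2 : suppFun K p = suppHyp K p := rfl
  rw [e2] at h1
  rw [e1] at h2
  -- Adding the two first-order conditions gives 2c(σ - 1) ≤ ⟨x - y, n - p⟩₋. Since σ - 1 bounds ‖n
  -- - p‖² from above, one factor ‖n - p‖ cancels.
  have h6 : 2 * c * (σ - 1) ≤ 2 * ‖x - y‖ * ‖(n : Mink d) - p‖ := by nlinarith
  rcases (norm_nonneg ((n : Mink d) - p)).eq_or_lt with h0 | h0
  · rw [← h0]; positivity
  have h7 : ‖(n : Mink d) - p‖ ^ 2 ≤ 2 * B ^ 2 * (σ - 1) := by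
    refine h3.trans (mul_le_mul_of_nonneg_right ?_ (by linarith))
    have := n.2.2
    have := p.2.2
    nlinarith
  have h8 : c * ‖(n : Mink d) - p‖ * ‖(n : Mink d) - p‖ ≤
      (2 * B ^ 2 * ‖x - y‖) * ‖(n : Mink d) - p‖ := by
    nlinarith [sq_nonneg B, mul_le_mul_of_nonneg_left h6 (sq_nonneg B)]
  have h9 := le_of_mul_le_mul_right h8 h0
  rw [div_mul_eq_mul_div, le_div_iff₀ hc]
  linarith

end Convex

/-! ### First variation of the weighted integral as the convex set is shrunk to the cone. -/

section Asymptotics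

variable {d : ℕ}

/-! ## A Taylor estimate -/

lemma exists_taylor_bound {E : Type*} [NormedAddCommGroup E] [NormedSpace ℝ E] {g : E → ℝ}
    {Ω D : Set E} (hΩ : IsOpen Ω) (hg : ContDiffOn ℝ 2 g Ω) (hD : IsCompact D) (hDc : Convex ℝ D)
    (hDΩ : D ⊆ Ω) :
    ∃ C, 0 ≤ C ∧ ∀ p ∈ D, ∀ q ∈ D, |g q - g p - fderiv ℝ g p (q - p)| ≤ C * ‖q - p‖ ^ 2 := by
  have h1 : ContDiffOn ℝ 1 (fderiv ℝ g) Ω := hg.fderiv_of_isOpen hΩ (by norm_num)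
  have h2 : ContinuousOn (fderiv ℝ (fderiv ℝ g)) Ω := h1.continuousOn_fderiv_of_isOpen hΩ (by norm_num)
  obtain ⟨L, hL⟩ := hD.exists_bound_of_continuousOn (f := fderiv ℝ (fderiv ℝ g)) (h2.mono hDΩ)
  have hd1 : ∀ x ∈ D, DifferentiableAt ℝ g x := fun x hx =>
    (hg.differentiableOn (by norm_num)).differentiableAt (hΩ.mem_nhds (hDΩ hx))
  have hd2 : ∀ x ∈ D, DifferentiableAt ℝ (fderiv ℝ g) x := fun x hx =>
    (h1.differentiableOn (by norm_num)).differentiableAt (hΩ.mem_nhds (hDΩ hx))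
  refine ⟨max L 0, le_max_right _ _, fun p hp q hq => ?_⟩
  have hseg : segment ℝ p q ⊆ D := hDc.segment_subset hp hq
  have h3 := (convex_segment p q).norm_image_sub_le_of_norm_fderiv_le' (𝕜 := ℝ) (f := g)
    (φ := fderiv ℝ g p) (C := max L 0 * ‖q - p‖) (fun z hz => hd1 z (hseg hz)) (fun z hz => ?_)
    (left_mem_segment ℝ p q) (right_mem_segment ℝ p q)
  · rw [← Real.norm_eq_abs]
    refine h3.trans_eq ?_
    ring
  · refine (hDc.norm_image_sub_le_of_norm_fderiv_le hd2
      (fun x hx => (hL x hx).trans (le_max_left L 0)) hp (hseg hz)).trans ?_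
    refine mul_le_mul_of_nonneg_left ?_ (le_max_right _ _)
    obtain ⟨t, ⟨ht0, ht1⟩, rfl⟩ := (segment_eq_image' ℝ p q ▸ hz :
      z ∈ (fun θ : ℝ => p + θ • (q - p)) '' Icc 0 1)
    rw [add_sub_cancel_left, norm_smul, Real.norm_of_nonneg ht0]
    exact mul_le_of_le_one_left (norm_nonneg _) ht1

/-- A compact convex part of the cone containing `{y ∈ ℍ^d | y_{d+1} ≤ B}`. -/
def hypSlab (d : ℕ) (B : ℝ) : Set (Mink d) := {v | ‖v.1‖ + 1 / (2 * B) ≤ v.2 ∧ v.2 ≤ B}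

lemma isCompact_hypSlab {B : ℝ} (hB : 0 < B) : IsCompact (hypSlab d B) := by
  refine Metric.isCompact_of_isClosed_isBounded ?_ ?_
  · have h1 : IsClosed {v : Mink d | ‖v.1‖ + 1 / (2 * B) ≤ v.2} :=
      isClosed_le (by fun_prop) (by fun_prop)
    have h2 : IsClosed {v : Mink d | v.2 ≤ B} := isClosed_le (by fun_prop) (by fun_prop)
    exact h1.inter h2
  · refine (Metric.isBounded_closedBall (x := (0 : Mink d)) (r := B)).subset fun v hv => ?_
    have h0 : 0 < 1 / (2 * B) := by positivity
    have h1 := hv.1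
    have h2 := hv.2
    have h3 := norm_nonneg v.1
    rw [mem_closedBall_zero_iff, Prod.norm_def, Real.norm_eq_abs]
    exact max_le (by linarith) (abs_le.2 ⟨by linarith, h2⟩)

lemma convex_hypSlab (B : ℝ) : Convex ℝ (hypSlab d B) := by
  intro x hx y hy a b ha hb hab
  refine ⟨?_, ?_⟩
  · have h1 : ‖(a • x + b • y).1‖ ≤ a * ‖x.1‖ + b * ‖y.1‖ := by
      refine (norm_add_le _ _).trans_eq ?_
      simp [norm_smul, abs_of_nonneg ha, abs_of_nonneg hb]
    have h2 := mul_le_mul_of_nonneg_left hx.1 ha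
    have h3 := mul_le_mul_of_nonneg_left hy.1 hb
    have h4 : (a • x + b • y).2 = a * x.2 + b * y.2 := rfl
    have h5 : 1 / (2 * B) = a * (1 / (2 * B)) + b * (1 / (2 * B)) := by rw [← add_mul, hab, one_mul]
    rw [h4]
    linarith
  · have h2 := mul_le_mul_of_nonneg_left hx.2 ha
    have h3 := mul_le_mul_of_nonneg_left hy.2 hb
    have h4 : (a • x + b • y).2 = a * x.2 + b * y.2 := rfl
    have h5 : B = a * B + b * B := by rw [← add_mul, hab, one_mul]
    rw [h4]
    linarith

lemma hypSlab_subset {B : ℝ} (hB : 0 < B) : hypSlab d B ⊆ futureCone d := fun v hv =>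
  mem_futureCone.2 (by
    have h0 : 0 < 1 / (2 * B) := by positivity
    linarith [hv.1])

lemma mem_hypSlab {B : ℝ} (y : Hyp d) (hy : y.1.2 ≤ B) : (y : Mink d) ∈ hypSlab d B := by
  refine ⟨?_, hy⟩
  have h1 := y.sq_eq
  have h2 := y.fst_lt
  have h3 := norm_nonneg y.1.1
  have hB : 0 < B := y.2.2.trans_le hy
  -- On ℍ^d the distance to the light cone is y.2 - ‖y.1‖ = 1/(y.2 + ‖y.1‖), which is the source of
  -- the constant 1/(2B).
  have h4 : 1 / (2 * B) ≤ y.1.2 - ‖y.1.1‖ := by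
    rw [div_le_iff₀ (by positivity)]
    nlinarith
  linarith

/-! ## The functions `T_s` and `N_s` -/

/-- Minimizers `N s x` of `s h - ⟨x, ·⟩`, for `x` in a relatively compact open part of the cone. -/
structure MinField (h : Hyp d → ℝ) (U Q : Set (Mink d)) (s₀ B c : ℝ) (N : ℝ → Mink d → Hyp d) :
    Prop where
  isOpen : IsOpen U
  isCompact : IsCompact Q
  subset : U ⊆ Q
  subset_cone : Q ⊆ futureCone d
  s₀_pos : 0 < s₀
  c_pos : 0 < c
  le_mnorm : ∀ x ∈ U, c ≤ mnorm x
  isMin : ∀ s ∈ Ioo 0 s₀, ∀ x ∈ U, IsMinAt h s x (N s x)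
  cont : ∀ s ∈ Ioo 0 s₀, ContinuousOn (N s) U
  bound : ∀ s ∈ Ioo 0 s₀, ∀ x ∈ U, (N s x).1.2 ≤ B
  bound_proj : ∀ x ∈ U, (hypProj x).1.2 ≤ B

/-- The minimum of `s h - ⟨x, ·⟩`. -/
noncomputable def minVal (h : Hyp d → ℝ) (N : ℝ → Mink d → Hyp d) (s : ℝ) (x : Mink d) : ℝ :=
  s * h (N s x) - mink x (N s x)

namespace MinField

variable {h : Hyp d → ℝ} {U Q : Set (Mink d)} {s₀ B c : ℝ} {N : ℝ → Mink d → Hyp d}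
  (H : MinField h U Q s₀ B c N)
include H

lemma cone {x : Mink d} (hx : x ∈ U) : x ∈ futureCone d := H.subset_cone (H.subset hx)

/-- Envelope theorem. The two minimality inequalities at x and y confine the error of the linear
approximation by |⟨y - x, N(y) - N(x)⟩₋|, which is o(‖y - x‖) by continuity of the minimizer alone.
-/
lemma hasFDerivAt {s : ℝ} (hs : s ∈ Ioo 0 s₀) {x : Mink d} (hx : x ∈ U) :
    HasFDerivAt (minVal h N s) (minkL d (-(N s x : Mink d))) x := by
  rw [hasFDerivAt_iff_isLittleO, Asymptotics.isLittleO_iff]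
  intro e he
  have hUn := H.isOpen.mem_nhds hx
  have hc : ContinuousAt (fun y => (N s y : Mink d)) x :=
    continuous_subtype_val.continuousAt.comp ((H.cont s hs).continuousAt hUn)
  filter_upwards [hUn, hc.eventually (Metric.ball_mem_nhds _ (show 0 < e / 2 by positivity))]
    with y hy hyN
  have h1 := H.isMin s hs y hy (N s x)
  have h2 := H.isMin s hs x hx (N s y)
  have h3 := abs_mink_le (y - x) ((N s y : Mink d) - N s x)
  have h4 : ‖(N s y : Mink d) - N s x‖ < e / 2 := by
    rw [← dist_eq_norm]; exact hyN
  have h5 : 2 * ‖y - x‖ * ‖(N s y : Mink d) - N s x‖ ≤ e * ‖y - x‖ := by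
    nlinarith [norm_nonneg (y - x)]
  have h6 := abs_le.1 (h3.trans h5)
  have e1 : mink (y - x) ((N s y : Mink d) - N s x) =
      mink y (N s y) - mink y (N s x) - (mink x (N s y) - mink x (N s x)) := by
    simp only [mink_sub_left, mink_sub_right]; ring
  rw [e1] at h6
  have e2 : minkL d (-(N s x : Mink d)) (y - x) = -(mink y (N s x) - mink x (N s x)) := by
    rw [minkL_apply, mink_neg_left, mink_sub_right, mink_comm _ y, mink_comm _ x]
  have h7 : 0 ≤ e * ‖y - x‖ := by positivity
  rw [e2, Real.norm_eq_abs, minVal, minVal, abs_le]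
  constructor <;> linarith [h6.1, h6.2]

lemma continuousOn_minVal {s : ℝ} (hs : s ∈ Ioo 0 s₀) : ContinuousOn (minVal h N s) U :=
  fun _ hx => (H.hasFDerivAt hs hx).continuousAt.continuousWithinAt

lemma contDiffOn {s : ℝ} (hs : s ∈ Ioo 0 s₀) :
    ContDiffOn ℝ 1 (fun x => minVal h N s x - mnorm x) U := by
  refine ContDiffOn.sub ?_ ((contDiffOn_mnorm.mono fun x hx => H.cone hx).of_le
    (by exact_mod_cast le_top))
  rw [show (1 : WithTop ℕ∞) = 0 + 1 by norm_num, contDiffOn_succ_iff_fderiv_of_isOpen H.isOpen]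
  refine ⟨fun x hx => (H.hasFDerivAt hs hx).differentiableAt.differentiableWithinAt, by simp, ?_⟩
  rw [contDiffOn_zero]
  have : ContinuousOn (fun x => minkL d (-(N s x : Mink d))) U :=
    (minkL d).continuous.comp_continuousOn
      (continuous_subtype_val.comp_continuousOn (H.cont s hs)).neg
  exact this.congr fun x hx => (H.hasFDerivAt hs hx).fderiv

/-- The gradient of T_s - ‖x‖₋ is -N_s + x/‖x‖₋ and its radial part does not see f. This identity
turns the first-order change of f along N_s into a product of gradients, to which Green's formula
applies. -/
lemma mdot_eq {s : ℝ} (hs : s ∈ Ioo 0 s₀) {f : Hyp d → ℝ} (hf : IsSmoothHyp f) {x : Mink d}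
    (hx : x ∈ U) : mdot (fun x => minVal h N s x - mnorm x) (zeroExt f) x =
      -fderiv ℝ (zeroExt f) x (N s x) := by
  have hxF := H.cone hx
  have h1 : fderiv ℝ (fun x => minVal h N s x - mnorm x) x =
      minkL d (-(N s x : Mink d) + (mnorm x)⁻¹ • x) := by
    rw [fderiv_fun_sub (H.hasFDerivAt hs hx).differentiableAt (differentiableAt_mnorm hxF),
      (H.hasFDerivAt hs hx).fderiv, fderiv_mnorm hxF, ← map_sub, neg_smul, sub_neg_eq_add]
  rw [mdot_of_fderiv_left h1, map_add, map_smul,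
    fderiv_zeroExt_self ((hf.contDiffAt hxF).differentiableAt (by simp)), smul_zero, add_zero,
    map_neg]

/-- `s h(N_s) ≤ T_s - ‖x‖₋ ≤ s h(x / ‖x‖₋)` and `N_s` is close to `x / ‖x‖₋`. -/
lemma estimates {s : ℝ} (hs : s ∈ Ioo 0 s₀) {x : Mink d} (hx : x ∈ U) :
    s * h (N s x) ≤ minVal h N s x - mnorm x ∧ minVal h N s x - mnorm x ≤ s * h (hypProj x) ∧
      ‖(N s x : Mink d) - hypProj x‖ ^ 2 ≤
        2 * B ^ 2 / c * (s * (h (hypProj x) - h (N s x))) := by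
  have hxF := H.cone hx
  set y := hypProj x with hy
  have hm : ∀ v, mink x v = mnorm x * mink (y : Mink d) v := fun v => by
    rw [← mink_smul_left, hy, mnorm_smul_hypProj hxF]
  have hρ := H.le_mnorm x hx
  have hc := H.c_pos
  have h1 := H.isMin s hs x hx y
  have h2 := (N s x).one_le y
  rw [mink_comm] at h2
  rw [hm, hm y, y.2.1] at h1
  have h3 : minVal h N s x = s * h (N s x) - mnorm x * mink (y : Mink d) (N s x) := by
    rw [minVal, hm]
  have h4 : mnorm x * (-mink (y : Mink d) (N s x) - 1) ≤ s * (h y - h (N s x)) := by linarith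
  refine ⟨by rw [h3]; nlinarith, by rw [h3]; linarith, ?_⟩
  have h5 := (N s x).norm_sub_sq_le y
  rw [mink_comm] at h5
  have h6 : c * (-mink (y : Mink d) (N s x) - 1) ≤ s * (h y - h (N s x)) :=
    (mul_le_mul_of_nonneg_right hρ (by linarith)).trans h4
  have h7 : -mink (y : Mink d) (N s x) - 1 ≤ s * (h y - h (N s x)) / c := by
    rw [le_div_iff₀ hc, mul_comm]; exact h6
  have hB1 := H.bound s hs x hx
  have hB2 := H.bound_proj x hx
  have hp1 := (N s x).2.2
  have hp2 := y.2.2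
  calc ‖(N s x : Mink d) - y‖ ^ 2
      ≤ ((N s x).1.2 + y.1.2) ^ 2 / 2 * (-mink (y : Mink d) (N s x) - 1) := h5
    _ ≤ 2 * B ^ 2 * (s * (h y - h (N s x)) / c) := by
        refine mul_le_mul ?_ h7 (by linarith) (by positivity)
        nlinarith
    _ = _ := by ring

end MinField

/-! ## The first variation -/

lemma fderiv_zeroExt_eq_zero {f : Hyp d → ℝ} {x : Mink d} (hx : x ∈ futureCone d)
    (hn : hypProj x ∉ tsupport f) : fderiv ℝ (zeroExt f) x = 0 := by
  rw [(zeroExt_eventually_zero hx hn).fderiv_eq]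
  exact (hasFDerivAt_const (0 : ℝ) x).fderiv

lemma fderiv_weight {φ : ℝ → ℝ} (hφ : Differentiable ℝ φ) {f : Hyp d → ℝ} (hf : IsSmoothHyp f)
    {t : ℝ} {v : Mink d} (hv : v ∈ futureCone d) (w : ℝ × Mink d) :
    fderiv ℝ (fun p : ℝ × Mink d => φ p.1 * zeroExt f p.2) (t, v) w =
      deriv φ t * w.1 * zeroExt f v + φ t * fderiv ℝ (zeroExt f) v w.2 := by
  have h1 : HasFDerivAt (fun p : ℝ × Mink d => φ p.1)
      (deriv φ t • ContinuousLinearMap.fst ℝ ℝ (Mink d)) (t, v) :=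
    (hφ t).hasDerivAt.comp_hasFDerivAt (t, v) hasFDerivAt_fst
  have h0 : HasFDerivAt (zeroExt f) (fderiv ℝ (zeroExt f) v) ((t, v) : ℝ × Mink d).2 :=
    ((hf.contDiffAt hv).differentiableAt (by simp)).hasFDerivAt
  have h2 : HasFDerivAt (fun p : ℝ × Mink d => zeroExt f p.2)
      ((fderiv ℝ (zeroExt f) v).comp (ContinuousLinearMap.snd ℝ ℝ (Mink d))) (t, v) :=
    h0.comp (t, v) hasFDerivAt_snd
  rw [(h1.fun_mul h2).fderiv]
  simp
  ring

/-- First variation of the integral of `φ(T_s) f(N_s)`, with `φ(t) = t ψ(t)`. -/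
theorem MinField.tendsto_integral (hd : 1 ≤ d) {h : Hyp d → ℝ} {U Q : Set (Mink d)} {s₀ B c : ℝ}
    {N : ℝ → Mink d → Hyp d} (H : MinField h U Q s₀ B c N) (hc : Continuous h) {f : Hyp d → ℝ}
    (hf : IsTest f) {ψ : ℝ → ℝ} (hψ : ContDiff ℝ ∞ ψ) {a b : ℝ} (hab : ∀ t ∉ Icc a b, ψ t = 0)
    (ha : 0 < a) (hcone : coneOver a b (tsupport f) ⊆ U) :
    Filter.Tendsto (fun s => s⁻¹ * ((∫ x in U, minVal h N s x * ψ (minVal h N s x) * f (N s x)) -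
        ∫ x in U, mnorm x * ψ (mnorm x) * zeroExt f x)) (𝓝[>] 0)
      (𝓝 ((∫ t in Ioi (0 : ℝ), t ^ d * ψ t) *
        ∫ x, h x * (lap f x - d * f x) ∂(hypVol d))) := by
  set φ : ℝ → ℝ := fun t => t * ψ t with hφdef
  have hφ : ContDiff ℝ ∞ φ := contDiff_id.mul hψ
  have hφd : Differentiable ℝ φ := hφ.differentiable (by simp)
  -- Derivatives of f at y = x/‖x‖₋ are ‖x‖₋ times those at x, so the weight φ of the Taylor
  -- expansion on ℍ^d becomes χ in the cone.
  set χ : ℝ → ℝ := fun t => t * φ t with hχdef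
  have hχ : ContDiff ℝ ∞ χ := contDiff_id.mul hφ
  have hφab : ∀ t ∉ Icc a b, φ t = 0 := fun t ht => by simp [hφdef, hab t ht]
  have hdφab : ∀ t ∉ Icc a b, deriv φ t = 0 := by
    intro t ht
    have : φ =ᶠ[𝓝 t] fun _ => 0 := by
      filter_upwards [isClosed_Icc.isOpen_compl.mem_nhds ht] with τ hτ using hφab τ hτ
    rw [this.deriv_eq, deriv_const]
  have hFo := isOpen_futureCone d
  have hUQ := H.subset
  have hQF := H.subset_cone
  have hUF : U ⊆ futureCone d := hUQ.trans hQF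
  have hUm : MeasurableSet U := H.isOpen.measurableSet
  have hfc := hf.1.continuous
  have hvol : volume U ≠ ⊤ := ne_top_of_le_ne_top H.isCompact.measure_lt_top.ne (measure_mono hUQ)
  have : IsFiniteMeasure (volume.restrict U) := ⟨by rw [Measure.restrict_apply_univ]; exact hvol.lt_top⟩
  -- the limit integrand
  set W : Mink d → ℝ := fun x => deriv φ (mnorm x) * zeroExt f x +
    χ (mnorm x) * wave (zeroExt f) x with hW
  have hdφ : Continuous (deriv φ) := hφ.continuous_deriv (by simp)
  have hWc : ContinuousOn W (futureCone d) := by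
    refine ContinuousOn.add ?_ ?_
    · exact (hdφ.comp_continuousOn continuous_mnorm.continuousOn).mul (continuousOn_zeroExt hfc)
    · exact (hχ.continuous.comp_continuousOn continuous_mnorm.continuousOn).mul
        (contDiffOn_wave hf.1).continuousOn
  have hoff : ∀ x ∈ futureCone d, x ∉ coneOver a b (tsupport f) →
      mnorm x ∉ Icc a b ∨ hypProj x ∉ tsupport f := by
    intro x hx hxK
    by_contra! hcon
    exact hxK (mem_coneOver hx hcon.1 hcon.2)
  have hwave0 : ∀ x ∈ futureCone d, hypProj x ∉ tsupport f → wave (zeroExt f) x = 0 := by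
    intro x hx hn
    rw [wave_zeroExt f hx, zeroExt, lap_eq_zero_of_eventually (notMem_tsupport_iff_eventuallyEq.1 hn),
      mul_zero]
  have hW0 : ∀ x ∈ futureCone d, x ∉ U → W x = 0 := by
    intro x hx hxU
    rcases hoff x hx fun hxK => hxU (hcone hxK) with h1 | h1
    · simp only [hW, hχdef, hdφab _ h1, hφab _ h1]; ring
    · simp only [hW, hwave0 x hx h1, (zeroExt_eventually_zero hx h1).eq_of_nhds]; simp
  -- bounds
  rcases U.eq_empty_or_nonempty with hUe | ⟨x₀, hx₀⟩
  -- If U is empty, so is the cone over the support: then f or ψ vanishes identically and both sides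
  -- are 0. The other case provides a point from which positivity of the constants is read.
  · have hi : ∫ x, h x * (lap f x - d * f x) ∂(hypVol d) = 0 ∨ ∀ t, ψ t = 0 := by
      by_cases hz : ∃ t, ψ t ≠ 0
      · left
        obtain ⟨t, ht⟩ := hz
        have ht' : t ∈ Icc a b := by by_contra hcon; exact ht (hab t hcon)
        have : ∀ x, hypProj (x : Mink d) ∉ tsupport f := by
          intro x hx
          have := hcone ⟨(t, hypProj x), ⟨ht', hx⟩, rfl⟩
          rw [hUe] at this
          exact this
        refine integral_eq_zero_of_ae (Filter.Eventually.of_forall fun x => ?_)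
        have hx := this x
        rw [hypProj_hyp] at hx
        simp [lap_eq_zero_of_eventually (notMem_tsupport_iff_eventuallyEq.1 hx),
          image_eq_zero_of_notMem_tsupport hx]
      · right; simpa using hz
    have hz : (∫ t in Ioi (0 : ℝ), t ^ d * ψ t) *
        ∫ x, h x * (lap f x - d * f x) ∂(hypVol d) = 0 := by
      rcases hi with hi | hi
      · rw [hi, mul_zero]
      · simp [hi]
    rw [hz, hUe]
    simp
  have hs0 := H.s₀_pos
  have hB : 0 < B := (hypProj x₀).2.2.trans_le (H.bound_proj x₀ hx₀)
  have hc0 := H.c_pos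
  obtain ⟨M, hM⟩ := (isCompact_hyp_le (hypOrigin d) B).exists_bound_of_continuousOn hc.continuousOn
  have hM' : ∀ y : Hyp d, y.1.2 ≤ B → |h y| ≤ M := fun y hy => hM y (by
    rw [mem_ofPred_eq, mink_hypOrigin]; exact hy)
  have hM0 : 0 ≤ M := (abs_nonneg _).trans (hM' _ (H.bound_proj x₀ hx₀))
  obtain ⟨ρ₁, hρ₁⟩ := H.isCompact.exists_bound_of_continuousOn (continuous_mnorm (d := d)).continuousOn
  -- Taylor's formula
  obtain ⟨C, hC0, hC⟩ := exists_taylor_bound (g := fun p : ℝ × Mink d => φ p.1 * zeroExt f p.2)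
    (Ω := univ ×ˢ futureCone d)
    (D := Icc (-(s₀ * M)) (ρ₁ + s₀ * M) ×ˢ hypSlab d B)
    (isOpen_univ.prod hFo)
    (((hφ.comp contDiff_fst).contDiffOn.mul
      (ContDiffOn.comp (show ContDiffOn ℝ ∞ (zeroExt f) (futureCone d) from hf.1)
        contDiffOn_snd fun p hp => hp.2)).of_le two_le_contDiff_infty)
    (isCompact_Icc.prod (isCompact_hypSlab hB)) ((convex_Icc _ _).prod (convex_hypSlab B))
    (prod_mono (subset_univ _) (hypSlab_subset hB))
  -- Its integral is 0 by Green's formula. Adding it cancels the Taylor term linear in N_s - y,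
  -- whose size divided by s is not controlled, and leaves terms in T_s - ‖x‖₋ only.
  set I : ℝ → Mink d → ℝ := fun s x => χ (mnorm x) *
    (mdot (fun x => minVal h N s x - mnorm x) (zeroExt f) x +
      (minVal h N s x - mnorm x) * wave (zeroExt f) x) with hI
  set e : ℝ → Mink d → ℝ := fun s x =>
    φ (minVal h N s x) * f (N s x) - φ (mnorm x) * zeroExt f x + I s x with he
  -- Divided by s, the error bound is C (s M² + (2B²/c)(h(y) - h(N_s))). It tends to 0 because N_s →
  -- y and h is continuous.
  have key : ∀ s ∈ Ioo 0 s₀, ∀ x ∈ U, |minVal h N s x - mnorm x| ≤ s * M ∧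
      |e s x - (minVal h N s x - mnorm x) * W x| ≤
        C * ((s * M) ^ 2 + 2 * B ^ 2 / c * (s * (h (hypProj x) - h (N s x)))) := by
    intro s hs x hx
    have hxF := hUF hx
    obtain ⟨h1, h2, h3⟩ := H.estimates hs hx
    have hn := abs_le.1 (hM' _ (H.bound s hs x hx))
    have hy := abs_le.1 (hM' _ (H.bound_proj x hx))
    have hs1 := hs.1
    have hu : |minVal h N s x - mnorm x| ≤ s * M := abs_le.2 ⟨by nlinarith, by nlinarith⟩
    refine ⟨hu, ?_⟩
    have hsM : s * M ≤ s₀ * M := mul_le_mul_of_nonneg_right hs.2.le hM0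
    have hρ0 := Real.sqrt_nonneg (-mink x x)
    have hρ1 := (abs_le.1 (hρ₁ x (hUQ hx))).2
    have hu' := abs_le.1 hu
    have hρpos := mnorm_pos hxF
    have hmn : mnorm x = Real.sqrt (-mink x x) := rfl
    have hp : (mnorm x, (hypProj x : Mink d)) ∈
        Icc (-(s₀ * M)) (ρ₁ + s₀ * M) ×ˢ hypSlab d B :=
      ⟨⟨by nlinarith, by nlinarith⟩, mem_hypSlab _ (H.bound_proj x hx)⟩
    have hq : (minVal h N s x, (N s x : Mink d)) ∈
        Icc (-(s₀ * M)) (ρ₁ + s₀ * M) ×ˢ hypSlab d B :=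
      ⟨⟨by linarith [hu'.1], by linarith [hu'.2]⟩, mem_hypSlab _ (H.bound s hs x hx)⟩
    have hT := hC _ hp _ hq
    rw [fderiv_weight hφd hf.1 (Hyp.mem_cone _)] at hT
    simp only [zeroExt_hyp, Prod.mk_sub_mk] at hT
    have hg : fderiv ℝ (zeroExt f) (hypProj x : Mink d) =
        mnorm x • fderiv ℝ (zeroExt f) x := by
      rw [fderiv_zeroExt_smul f hρpos, mnorm_smul_hypProj hxF]
    have hg0 : fderiv ℝ (zeroExt f) (hypProj x : Mink d) (hypProj x) = 0 :=
      fderiv_zeroExt_self ((hf.1.contDiffAt (Hyp.mem_cone _)).differentiableAt (by simp))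
    rw [map_sub, hg0, hg] at hT
    have heq : e s x - (minVal h N s x - mnorm x) * W x =
        φ (minVal h N s x) * f (N s x) - φ (mnorm x) * f (hypProj x) -
          (deriv φ (mnorm x) * (minVal h N s x - mnorm x) * f (hypProj x) +
            φ (mnorm x) * ((mnorm x • fderiv ℝ (zeroExt f) x) (N s x : Mink d) - 0)) := by
      simp only [he, hI, hW, H.mdot_eq hs hf.1 hx, hχdef, zeroExt, smul_apply,
        smul_eq_mul]
      ring
    rw [heq]
    refine hT.trans (mul_le_mul_of_nonneg_left ?_ hC0)
    have h4 : ‖((minVal h N s x - mnorm x, (N s x : Mink d) - hypProj x) : ℝ × Mink d)‖ ^ 2 ≤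
        (minVal h N s x - mnorm x) ^ 2 + ‖(N s x : Mink d) - hypProj x‖ ^ 2 := by
      rw [Prod.norm_def]
      rcases max_cases ‖minVal h N s x - mnorm x‖ ‖(N s x : Mink d) - hypProj x‖ with ⟨hh, -⟩ | ⟨hh, -⟩
      · simp only [hh]
        rw [Real.norm_eq_abs, sq_abs]
        nlinarith [sq_nonneg ‖(N s x : Mink d) - hypProj x‖]
      · simp only [hh]
        nlinarith [sq_nonneg (minVal h N s x - mnorm x)]
    refine h4.trans (add_le_add ?_ h3)
    rw [← sq_abs]
    exact pow_le_pow_left₀ (abs_nonneg _) hu 2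
  have hIoo : Ioo 0 s₀ ∈ 𝓝[>] (0 : ℝ) := Ioo_mem_nhdsGT hs0
  -- integrals of the parts
  have hi1 : ∀ s ∈ Ioo 0 s₀, IntegrableOn (fun x => φ (minVal h N s x) * f (N s x)) U := by
    intro s hs
    obtain ⟨C₁, hC₁⟩ := hf.2.exists_bound_of_continuous hfc
    obtain ⟨C₂, hC₂⟩ := (isCompact_Icc (a := a) (b := b)).exists_bound_of_continuousOn
      hφ.continuous.continuousOn
    refine Integrable.of_bound (C := max C₂ 0 * C₁) ?_ (Filter.Eventually.of_forall fun x => ?_)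
    · exact ((hφ.continuous.comp_continuousOn (H.continuousOn_minVal hs)).mul
        (hfc.comp_continuousOn (H.cont s hs))).aestronglyMeasurable hUm
    · rw [norm_mul]
      refine mul_le_mul ?_ (hC₁ _) (norm_nonneg _) (le_max_right _ _)
      by_cases ht : minVal h N s x ∈ Icc a b
      · exact (hC₂ _ ht).trans (le_max_left _ _)
      · rw [hφab _ ht, norm_zero]; exact le_max_right _ _
  have hi2 : IntegrableOn (fun x => φ (mnorm x) * zeroExt f x) U :=
    (((hφ.continuous.comp_continuousOn continuous_mnorm.continuousOn).mul
      ((continuousOn_zeroExt hfc).mono hQF)).integrableOn_compact H.isCompact).mono_set hUQ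
  have hi3 : ∀ s ∈ Ioo 0 s₀, IntegrableOn (I s) U ∧ ∫ x in U, I s x = 0 := by
    intro s hs
    refine integral_mdot_add_wave H.isOpen hUF (isCompact_coneOver a b hf.2) hcone hχ
      (H.contDiffOn hs) hf.1 fun x hx hxK v => ?_
    rcases hoff x (hUF hx) hxK with h1 | h1
    · simp only [hχdef, hφab _ h1]; ring
    · rw [fderiv_zeroExt_eq_zero (hUF hx) h1]; simp
  have hsplit : ∀ s ∈ Ioo 0 s₀, s⁻¹ * ((∫ x in U, φ (minVal h N s x) * f (N s x)) -
        ∫ x in U, φ (mnorm x) * zeroExt f x) = ∫ x in U, s⁻¹ * e s x := by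
    intro s hs
    have h2 := integral_add ((hi1 s hs).sub hi2) (hi3 s hs).1
    have h3 := integral_sub (hi1 s hs) hi2
    rw [integral_const_mul]
    simp only [Pi.sub_apply] at h2
    simp only [he]
    rw [h2, (hi3 s hs).2, add_zero, ← h3]
  have hWi : IntegrableOn W U := ((hWc.mono hQF).integrableOn_compact H.isCompact).mono_set hUQ
  have hlim : Filter.Tendsto (fun s => ∫ x in U, s⁻¹ * e s x) (𝓝[>] 0)
      (𝓝 (∫ x in U, zeroExt h x * W x)) := by
    refine tendsto_integral_filter_of_dominated_convergence
      (fun x => M * |W x| + C * (s₀ * M ^ 2 + 2 * B ^ 2 / c * (2 * M))) ?_ ?_ ?_ ?_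
    · filter_upwards [hIoo] with s hs
      exact (((hi1 s hs).1.sub hi2.1).add (hi3 s hs).1.1).const_mul _
    · filter_upwards [hIoo] with s hs
      filter_upwards [ae_restrict_mem hUm] with x hx
      obtain ⟨h1, h2⟩ := key s hs x hx
      have hs1 := hs.1
      have hn := abs_le.1 (hM' _ (H.bound s hs x hx))
      have hy := abs_le.1 (hM' _ (H.bound_proj x hx))
      rw [norm_mul, norm_inv, Real.norm_of_nonneg hs1.le, Real.norm_eq_abs, inv_mul_le_iff₀ hs1]
      have h3 : |e s x| ≤ s * M * |W x| +
          C * ((s * M) ^ 2 + 2 * B ^ 2 / c * (s * (h (hypProj x) - h (N s x)))) := by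
        have := abs_sub_abs_le_abs_sub (e s x) ((minVal h N s x - mnorm x) * W x)
        rw [abs_mul (minVal h N s x - mnorm x)] at this
        have := mul_le_mul_of_nonneg_right h1 (abs_nonneg (W x))
        linarith
      refine h3.trans ?_
      have h4 : (s * M) ^ 2 ≤ s * (s₀ * M ^ 2) := by
        have := mul_le_mul_of_nonneg_right hs.2.le (mul_nonneg hs1.le (sq_nonneg M))
        nlinarith
      have h5 : 2 * B ^ 2 / c * (s * (h (hypProj x) - h (N s x))) ≤
          2 * B ^ 2 / c * (s * (2 * M)) := by
        refine mul_le_mul_of_nonneg_left (mul_le_mul_of_nonneg_left ?_ hs1.le) (by positivity)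
        linarith [hn.1, hy.2]
      have h6 := mul_le_mul_of_nonneg_left (add_le_add h4 h5) hC0
      refine (add_le_add_right h6 _).trans_eq ?_
      ring
    · exact (hWi.abs.const_mul M).add (integrable_const _)
    · filter_upwards [ae_restrict_mem hUm] with x hx
      set y := hypProj x with hy
      have hNlim : Filter.Tendsto (fun s => h (N s x)) (𝓝[>] 0) (𝓝 (h y)) := by
        refine (hc.tendsto y).comp ?_
        rw [tendsto_subtype_rng, tendsto_iff_norm_sub_tendsto_zero]
        have hsq : Filter.Tendsto (fun s => Real.sqrt (2 * B ^ 2 / c * (s * (2 * M)))) (𝓝[>] 0)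
            (𝓝 0) := by
          have : Continuous fun s : ℝ => Real.sqrt (2 * B ^ 2 / c * (s * (2 * M))) := by fun_prop
          have h1 := (this.tendsto 0).mono_left (nhdsWithin_le_nhds (s := Ioi 0))
          simpa using h1
        refine squeeze_zero' (Filter.Eventually.of_forall fun s => norm_nonneg _) ?_ hsq
        filter_upwards [hIoo] with s hs
        refine Real.le_sqrt_of_sq_le ((H.estimates hs hx).2.2.trans ?_)
        have hn := abs_le.1 (hM' _ (H.bound s hs x hx))
        have hy := abs_le.1 (hM' _ (H.bound_proj x hx))
        refine mul_le_mul_of_nonneg_left (mul_le_mul_of_nonneg_left ?_ hs.1.le) (by positivity)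
        linarith [hn.1, hy.2]
      have hulim : Filter.Tendsto (fun s => s⁻¹ * (minVal h N s x - mnorm x)) (𝓝[>] 0)
          (𝓝 (h y)) := by
        refine tendsto_of_tendsto_of_tendsto_of_le_of_le' hNlim tendsto_const_nhds ?_ ?_
        · filter_upwards [hIoo] with s hs
          rw [le_inv_mul_iff₀ hs.1]
          exact (H.estimates hs hx).1
        · filter_upwards [hIoo] with s hs
          rw [inv_mul_le_iff₀ hs.1]
          exact (H.estimates hs hx).2.1
      have hRlim : Filter.Tendsto (fun s => s⁻¹ * (e s x - (minVal h N s x - mnorm x) * W x))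
          (𝓝[>] 0) (𝓝 0) := by
        have hb : Filter.Tendsto (fun s : ℝ => C * (s * M ^ 2 + 2 * B ^ 2 / c * (h y - h (N s x))))
            (𝓝[>] 0) (𝓝 (C * (0 * M ^ 2 + 2 * B ^ 2 / c * (h y - h y)))) := by
          refine Filter.Tendsto.const_mul _ (Filter.Tendsto.add ?_ ?_)
          · exact (Filter.tendsto_id.mono_left nhdsWithin_le_nhds).mul_const _
          · exact (hNlim.const_sub _).const_mul _
        rw [zero_mul, sub_self, mul_zero, add_zero, mul_zero] at hb
        refine squeeze_zero_norm' ?_ hb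
        filter_upwards [hIoo] with s hs
        rw [norm_mul, norm_inv, Real.norm_of_nonneg hs.1.le, Real.norm_eq_abs,
          inv_mul_le_iff₀ hs.1]
        refine ((key s hs x hx).2).trans_eq ?_
        ring
      have := hRlim.add (hulim.mul_const (W x))
      rw [zero_add] at this
      refine this.congr fun s => ?_
      ring
  have hval : ∫ x in U, zeroExt h x * W x = (∫ t in Ioi (0 : ℝ), t ^ d * ψ t) *
        ∫ x, h x * (lap f x - d * f x) ∂(hypVol d) := by
    rw [← setIntegral_eq_of_subset_of_forall_sdiff_eq_zero (measurableSet_futureCone d) hUF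
      (fun x hx => by rw [hW0 x hx.1 hx.2, mul_zero])]
    have hlapc := hf.1.lap.continuous
    have e1 : ∀ x ∈ futureCone d, zeroExt h x * W x =
        deriv φ (mnorm x) * zeroExt (fun y => h y * f y) x +
          ψ (mnorm x) * zeroExt (fun y => h y * lap f y) x := by
      intro x hx
      have hρ := mnorm_pos hx
      simp only [hW, hχdef, hφdef, wave_zeroExt f hx, zeroExt]
      field_simp
    have hφcs : HasCompactSupport φ := HasCompactSupport.intro isCompact_Icc hφab
    have hint : ∀ {η : ℝ → ℝ} {g : Hyp d → ℝ}, Continuous η → (∀ t ∉ Icc a b, η t = 0) →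
        Continuous g → HasCompactSupport g →
        IntegrableOn (fun x => η (mnorm x) * zeroExt g x) (futureCone d) := by
      intro η g hη hη0 hg hgs
      have hK := isCompact_coneOver a b hgs
      have hKF : coneOver a b (tsupport g) ⊆ futureCone d := coneOver_subset ha _
      refine IntegrableOn.of_forall_sdiff_eq_zero
        (((hη.comp_continuousOn continuous_mnorm.continuousOn).mul
        ((continuousOn_zeroExt hg).mono hKF)).integrableOn_compact hK)
        (measurableSet_futureCone d) fun x hx => ?_
      by_cases h1 : mnorm x ∈ Icc a b
      · by_cases h2 : hypProj x ∈ tsupport g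
        · exact absurd (mem_coneOver hx.1 h1 h2) hx.2
        · simp only [zeroExt]
          rw [image_eq_zero_of_notMem_tsupport h2, mul_zero]
      · rw [hη0 _ h1, zero_mul]
    rw [setIntegral_congr_fun (measurableSet_futureCone d) e1,
      integral_add (hint (g := fun y => h y * f y) hdφ hdφab (hc.mul hfc) hf.2.mul_left)
        (hint (g := fun y => h y * lap f y) hψ.continuous hab (hc.mul hlapc) hf.2.lap.mul_left),
      integral_polar (f := fun y => h y * f y) hdφ (hc.mul hfc),
      integral_polar (f := fun y => h y * lap f y) hψ.continuous (hc.mul hlapc)]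
    -- Since φ = t ψ, integration by parts gives -d ∫ t^(d-1) φ = -d ∫ t^d ψ. This is where the term
    -- -d f next to Δf comes from.
    have hparts : ∫ t in Ioi (0 : ℝ), t ^ d * deriv φ t =
        -(d * ∫ t in Ioi (0 : ℝ), t ^ d * ψ t) := by
      have hprod : ContDiff ℝ 1 fun t : ℝ => t ^ d * φ t :=
        ((contDiff_id.pow d).mul hφ).of_le (by exact_mod_cast le_top)
      have h1 := HasCompactSupport.integral_Ioi_deriv_eq hprod hφcs.mul_left 0
      have h2 : ∀ t : ℝ, deriv (fun t : ℝ => t ^ d * φ t) t =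
          d * (t ^ d * ψ t) + t ^ d * deriv φ t := by
        intro t
        rw [((hasDerivAt_pow d t).fun_mul (hφd t).hasDerivAt).deriv]
        obtain ⟨k, rfl⟩ : ∃ k, d = k + 1 := ⟨d - 1, by omega⟩
        simp only [hφdef, Nat.add_sub_cancel]
        ring
      simp only [h2] at h1
      have hψcs : HasCompactSupport ψ := HasCompactSupport.intro isCompact_Icc hab
      rw [integral_add, integral_const_mul] at h1
      · have h0 : (0 : ℝ) ∉ Icc a b := fun h => absurd h.1 (not_le.2 ha)
        rw [hφab 0 h0, mul_zero, neg_zero] at h1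
        linarith
      · exact ((((continuous_pow d).mul hψ.continuous).integrable_of_hasCompactSupport
          hψcs.mul_left).const_mul _).integrableOn
      · exact (((continuous_pow d).mul hdφ).integrable_of_hasCompactSupport
          (hφcs.deriv.mul_left)).integrableOn
    have hi4 : Integrable (fun x => h x * f x) (hypVol d) :=
      (hc.mul hfc).integrable_of_hasCompactSupport hf.2.mul_left
    have hi5 : Integrable (fun x => h x * lap f x) (hypVol d) :=
      (hc.mul hlapc).integrable_of_hasCompactSupport hf.2.lap.mul_left
    have e2 : ∫ x, h x * (lap f x - d * f x) ∂(hypVol d) =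
        ∫ x, h x * lap f x ∂(hypVol d) - d * ∫ x, h x * f x ∂(hypVol d) := by
      rw [← integral_const_mul, ← integral_sub hi5 (hi4.const_mul _)]
      congr 1
      funext x
      ring
    rw [hparts, e2]
    ring
  rw [hval] at hlim
  refine hlim.congr' ?_
  filter_upwards [hIoo] with s hs
  exact (hsplit s hs).symm

end Asymptotics

/-! ### The Steiner polynomial and determination of a set by its first area measure. -/

section Steiner

variable {d : ℕ}

/-! ## Minimizers for F-convex sets -/

/-- Near a compact part of the cone, and for small `s`, the minimizers for the support function of
an F-convex set exist, and they describe all the points with the given normals and times. -/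
theorem IsFConvex.exists_minField {K : Set (Mink d)} (hK : IsFConvex K) {Z : Set (Hyp d)}
    (hZ : IsCompact Z) {a b : ℝ} (ha : 0 < a) :
    ∃ (U Q : Set (Mink d)) (s₀ B c : ℝ) (N : ℝ → Mink d → Hyp d),
      MinField (suppHyp K) U Q s₀ B c N ∧ coneOver a b Z ⊆ U ∧
      (∀ s ∈ Ioo 0 s₀, ∀ x ∈ U, 0 < minVal (suppHyp K) N s x) ∧
      ∀ s ∈ Ioo 0 s₀, ∀ (x : Mink d) (t : ℝ) (n : Hyp d), n ∈ Z → s * t ∈ Icc a b →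
        Touch K (s⁻¹ • x) t n → x ∈ U := by
  obtain ⟨δ, hδ, hQF⟩ := (isCompact_coneOver a b hZ).exists_cthickening_subset_open
    (isOpen_futureCone d) (coneOver_subset ha Z)
  set U := Metric.thickening δ (coneOver a b Z) with hU
  set Q := Metric.cthickening δ (coneOver a b Z) with hQ
  have hQc : IsCompact Q := (isCompact_coneOver a b hZ).cthickening
  have hUQ : U ⊆ Q := Metric.thickening_subset_cthickening _ _
  have hc := hK.continuous_suppHyp
  obtain ⟨c, hc0, hcQ⟩ := hQc.exists_forall_le' (f := fun x : Mink d => x.2 - ‖x.1‖)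
    (by fun_prop) (a := 0) fun x hx => sub_pos.2 (mem_futureCone.1 (hQF hx))
  obtain ⟨c', hc'0, hc'Q⟩ := hQc.exists_forall_le' (f := fun x : Mink d => mnorm x)
    continuous_mnorm.continuousOn (a := 0) fun x hx => mnorm_pos (hQF hx)
  obtain ⟨B₀, hB₀, hlow⟩ := hK.exists_lower_bound
  obtain ⟨R, hR⟩ := hK.exists_bound_support hZ
  have hproj : ContinuousOn (hypProj : Mink d → Hyp d) Q := continuousOn_hypProj.mono hQF
  obtain ⟨C₁, hC₁⟩ := hQc.exists_bound_of_continuousOn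
    (f := fun x => |suppHyp K (hypProj x)| + mnorm x)
    ((hc.comp_continuousOn hproj).abs.add continuous_mnorm.continuousOn)
  obtain ⟨C₂, hC₂⟩ := hQc.exists_bound_of_continuousOn (f := fun x => (hypProj x).1.2)
    (continuous_snd.comp_continuousOn (continuous_subtype_val.comp_continuousOn hproj))
  -- The three constraints on s: s < 1 bounds the values used to confine the minimizers, s B₀ ≤ c/2
  -- gives coercivity, and s R < δ keeps the points with the prescribed contact data inside the
  -- δ-neighbourhood U.
  set s₀ := min 1 (min (c / (2 * (B₀ + 1))) (δ / (|R| + 1))) with hs₀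
  have hs₀0 : 0 < s₀ := by
    refine lt_min one_pos (lt_min ?_ ?_) <;> positivity
  have hs1 : ∀ s ∈ Ioo 0 s₀, s < 1 := fun s hs => hs.2.trans_le (min_le_left _ _)
  have hs2 : ∀ s ∈ Ioo 0 s₀, s * B₀ ≤ c / 2 := by
    intro s hs
    have h1 : s < c / (2 * (B₀ + 1)) :=
      hs.2.trans_le ((min_le_right _ _).trans (min_le_left _ _))
    rw [lt_div_iff₀ (by positivity)] at h1
    nlinarith [hs.1]
  have hs3 : ∀ s ∈ Ioo 0 s₀, s * R < δ := by
    intro s hs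
    have h1 : s < δ / (|R| + 1) := hs.2.trans_le ((min_le_right _ _).trans (min_le_right _ _))
    rw [lt_div_iff₀ (by positivity)] at h1
    nlinarith [hs.1, le_abs_self R]
  have hex : ∀ s x, ∃ n, s ∈ Ioo 0 s₀ → x ∈ U → IsMinAt (suppHyp K) s x n := by
    intro s x
    by_cases h : s ∈ Ioo 0 s₀ ∧ x ∈ U
    · obtain ⟨n, hn⟩ := exists_isMinAt hc hlow h.1.1.le hc0 (hs2 s h.1)
        (by linarith [hcQ x (hUQ h.2)])
      exact ⟨n, fun _ _ => hn⟩
    · exact ⟨hypOrigin d, fun h1 h2 => absurd ⟨h1, h2⟩ h⟩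
  choose N hN using hex
  have hco : ∀ s ∈ Ioo 0 s₀, ∀ x ∈ U, c / 2 * (N s x).1.2 ≤ minVal (suppHyp K) N s x :=
    fun s hs x hx => coercive hlow hs.1.le (hs2 s hs)
      (by linarith [hcQ x (hUQ hx)]) _
  have hlb : ∀ s ∈ Ioo 0 s₀, ∀ x ∈ U, c / 2 ≤ minVal (suppHyp K) N s x := by
    intro s hs x hx
    have := hco s hs x hx
    nlinarith [(N s x).one_le_snd]
  have hbd : ∀ s ∈ Ioo 0 s₀, ∀ x ∈ U, (N s x).1.2 ≤ max (2 * C₁ / c) C₂ := by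
    intro s hs x hx
    have hxF := hQF (hUQ hx)
    refine le_max_of_le_left ?_
    have h1 := hco s hs x hx
    have h2 := hN s x hs hx (hypProj x)
    have h3 : mink x (hypProj x) = -mnorm x := by
      have h := mink_smul_left (mnorm x) (hypProj x : Mink d) (hypProj x)
      rw [mnorm_smul_hypProj hxF, (hypProj x).2.1] at h
      linarith
    have h4 := (abs_le.1 (hC₁ x (hUQ hx))).2
    have h5 : s * suppHyp K (hypProj x) ≤ |suppHyp K (hypProj x)| := by
      have := le_abs_self (suppHyp K (hypProj x))
      have := abs_nonneg (suppHyp K (hypProj x))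
      nlinarith [hs.1, hs1 s hs]
    rw [minVal] at h1
    rw [le_div_iff₀ hc0]
    linarith
  refine ⟨U, Q, s₀, max (2 * C₁ / c) C₂, c', N, ?_, ?_, ?_, ?_⟩
  · refine ⟨Metric.isOpen_thickening, hQc, hUQ, hQF, hs₀0, hc'0, fun x hx => hc'Q x (hUQ hx),
      fun s hs x hx => hN s x hs hx, fun s hs => ?_, hbd, fun x hx => ?_⟩
    · refine LipschitzOnWith.continuousOn (K := Real.toNNReal
        (2 * max (2 * C₁ / c) C₂ ^ 2 / (c / 2))) (LipschitzOnWith.of_dist_le_mul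
        fun x hx y hy => ?_)
      rw [Subtype.dist_eq, dist_eq_norm, dist_eq_norm, Real.coe_toNNReal _ (by positivity)]
      exact (hN s x hs hx).norm_sub_le hK hs.1 (hN s y hs hy) (half_pos hc0) (hlb s hs x hx)
        (hlb s hs y hy) (hbd s hs x hx) (hbd s hs y hy)
    · exact le_max_of_le_right ((le_abs_self _).trans (hC₂ x (hUQ hx)))
  · exact Metric.self_subset_thickening hδ _
  · exact fun s hs x hx => (half_pos hc0).trans_le (hlb s hs x hx)
  · intro s hs x t n hn ht h
    have hr := hR n hn _ h.1 h.2
    refine Metric.mem_thickening_iff.2 ⟨(s * t) • (n : Mink d), ⟨(s * t, n), ⟨ht, hn⟩, rfl⟩, ?_⟩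
    -- The difference is s times a support point, of norm at most R, so x is within δ of the cone
    -- over Z.
    have e : x - (s * t) • (n : Mink d) = s • (s⁻¹ • x - t • (n : Mink d)) := by
      rw [smul_sub, smul_smul, smul_smul, mul_inv_cancel₀ hs.1.ne', one_smul]
    rw [dist_eq_norm, e, norm_smul, Real.norm_of_nonneg hs.1.le]
    exact (mul_le_mul_of_nonneg_left hr hs.1.le).trans_lt (hs3 s hs)

/-! ## Level sets and area measures -/

/-- The coefficients of the Steiner polynomial. -/
noncomputable def steinerWeight (d i : ℕ) : ℝ := ((d + 1).choose i : ℝ) / ((d : ℝ) + 1)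

/-- Scaling multiplies the volume by s^(d+1), and (ε/s)^(d+1-i) takes all but s^i away. Each area
measure thus becomes the coefficient of a power of s. -/
lemma volume_preimage_brush {K : Set (Mink d)} {S : Fin (d + 1) → Measure (Hyp d)}
    (hS : IsAreaMeasures K S) {A : Set (Hyp d)} (hA : MeasurableSet A) {s ε : ℝ} (hs : 0 < s)
    (hε : 0 < ε) :
    volume ((fun x : Mink d => s⁻¹ • x) ⁻¹' brush K (ε / s) A) =
      ∑ i : Fin (d + 1), ENNReal.ofReal (steinerWeight d i * s ^ (i : ℕ) * ε ^ (d + 1 - (i : ℕ))) *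
        S i A := by
  have hfin : Module.finrank ℝ (Mink d) = d + 1 := by simp
  rw [Measure.addHaar_preimage_smul volume (inv_ne_zero hs.ne'), hS.2 A hA _ (div_pos hε hs), hfin,
    ← mul_assoc, Finset.mul_sum]
  refine Finset.sum_congr rfl fun i _ => ?_
  rw [← mul_assoc]
  congr 1
  have h1 : ((d : ℝ≥0∞) + 1)⁻¹ = ENNReal.ofReal (((d : ℝ) + 1)⁻¹) := by
    rw [ENNReal.ofReal_inv_of_pos (by positivity), ENNReal.ofReal_add (by positivity) (by norm_num),
      ENNReal.ofReal_natCast, ENNReal.ofReal_one]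
  rw [h1, ← ENNReal.ofReal_natCast, ← ENNReal.ofReal_pow (by positivity), ← ENNReal.ofReal_mul (by positivity),
    ← ENNReal.ofReal_mul (by positivity), ← ENNReal.ofReal_mul (by positivity)]
  congr 1
  have hi : (i : ℕ) ≤ d + 1 := i.2.le
  have h2 : s ^ (d + 1) = s ^ (i : ℕ) * s ^ (d + 1 - (i : ℕ)) := by
    rw [← pow_add, Nat.add_sub_cancel' hi]
  rw [abs_of_pos (by positivity), inv_pow, inv_inv, div_pow, h2, steinerWeight]
  field_simp

section LevelSets

variable {K : Set (Mink d)} (hK : IsFConvex K) {S : Fin (d + 1) → Measure (Hyp d)}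
  (hS : IsAreaMeasures K S) {U Q : Set (Mink d)} {s₀ B c : ℝ} {N : ℝ → Mink d → Hyp d}
  (H : MinField (suppHyp K) U Q s₀ B c N)
  (hpos : ∀ s ∈ Ioo 0 s₀, ∀ x ∈ U, 0 < minVal (suppHyp K) N s x)
  {Z : Set (Hyp d)} {a b : ℝ} (hcov : ∀ s ∈ Ioo 0 s₀, ∀ (x : Mink d) (t : ℝ) (n : Hyp d), n ∈ Z →
    s * t ∈ Icc a b → Touch K (s⁻¹ • x) t n → x ∈ U)
  {s : ℝ} (hs : s ∈ Ioo 0 s₀)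
include H hs

lemma measurableSet_level (ε : ℝ) :
    MeasurableSet (U ∩ minVal (suppHyp K) N s ⁻¹' Ioc a ε) := by
  have h := H.continuousOn_minVal hs
  have e : U ∩ minVal (suppHyp K) N s ⁻¹' Ioc a ε = (U ∩ minVal (suppHyp K) N s ⁻¹' Ioi a) \
      (U ∩ minVal (suppHyp K) N s ⁻¹' Ioi ε) := by
    ext x
    simp only [mem_inter_iff, mem_preimage, mem_Ioc, mem_Ioi, Set.mem_sdiff, not_and, not_lt]
    tauto
  rw [e]
  exact (h.isOpen_inter_preimage H.isOpen isOpen_Ioi).measurableSet.diff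
    (h.isOpen_inter_preimage H.isOpen isOpen_Ioi).measurableSet

lemma aemeasurable_normal (ε : ℝ) :
    AEMeasurable (N s) (volume.restrict (U ∩ minVal (suppHyp K) N s ⁻¹' Ioc a ε)) :=
  ((H.cont s hs).mono inter_subset_left).aemeasurable (measurableSet_level H hs ε)

include hK hpos hcov in
-- Contact data at a point are unique, and times between a and b are described by the minimizers on
-- U. Smaller times lie outside this description, so they are kept apart as a brush of their own.
lemma preimage_brush_eq {A : Set (Hyp d)} (hA : A ⊆ Z) {ε : ℝ} (haε : a ≤ ε) (hεb : ε ≤ b) :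
    (fun x : Mink d => s⁻¹ • x) ⁻¹' brush K (ε / s) A =
      (fun x : Mink d => s⁻¹ • x) ⁻¹' brush K (a / s) A ∪
        (N s ⁻¹' A ∩ (U ∩ minVal (suppHyp K) N s ⁻¹' Ioc a ε)) ∧
    Disjoint ((fun x : Mink d => s⁻¹ • x) ⁻¹' brush K (a / s) A)
        (N s ⁻¹' A ∩ (U ∩ minVal (suppHyp K) N s ⁻¹' Ioc a ε)) := by
  have hs0 := hs.1
  have htouch : ∀ x ∈ U, Touch K (s⁻¹ • x) (s⁻¹ * minVal (suppHyp K) N s x) (N s x) :=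
    fun x hx => (H.isMin s hs x hx).touch hK hs0 (hpos s hs x hx)
  have hpos' : ∀ x ∈ U, 0 < s⁻¹ * minVal (suppHyp K) N s x := fun x hx =>
    mul_pos (inv_pos.2 hs0) (hpos s hs x hx)
  refine ⟨?_, ?_⟩
  · ext x
    simp only [mem_union, mem_preimage, mem_brush_iff hK, mem_inter_iff, mem_Ioc]
    constructor
    · rintro ⟨t, n, ht, htε, hn, h⟩
      rw [le_div_iff₀ hs0, mul_comm] at htε
      rcases le_or_gt (s * t) a with hta | hta
      · left
        exact ⟨t, n, ht, by rwa [le_div_iff₀ hs0, mul_comm], hn, h⟩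
      · right
        have hxU := hcov s hs x t n (hA hn) ⟨hta.le, htε.trans hεb⟩ h
        obtain ⟨h1, h2⟩ := h.unique hK (htouch x hxU) ht (hpos' x hxU)
        have h3 : minVal (suppHyp K) N s x = s * t := by
          rw [h1, mul_inv_cancel_left₀ hs0.ne']
        rw [h3, ← h2]
        exact ⟨hn, hxU, hta, htε⟩
    · rintro (⟨t, n, ht, hta, hn, h⟩ | ⟨hn, hxU, -, hε⟩)
      · exact ⟨t, n, ht, hta.trans (div_le_div_of_nonneg_right haε hs0.le), hn, h⟩
      · refine ⟨_, _, hpos' x hxU, ?_, hn, htouch x hxU⟩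
        rw [le_div_iff₀ hs0, mul_comm, mul_inv_cancel_left₀ hs0.ne']
        exact hε
  · refine disjoint_left.2 fun x hx hx' => ?_
    obtain ⟨t, n, ht, hta, hn, h⟩ := (mem_brush_iff hK).1 hx
    obtain ⟨-, hxU, hax, -⟩ := hx'
    obtain ⟨h1, -⟩ := h.unique hK (htouch x hxU) ht (hpos' x hxU)
    rw [h1, le_div_iff₀ hs0, mul_comm, mul_inv_cancel_left₀ hs0.ne'] at hta
    exact absurd hax (not_lt.2 hta)

include hK hpos hcov hS in
-- The layer is a difference of two brushes. Subtraction is legitimate because the area measures are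
-- finite on the compact set Z.
lemma volume_level (ha : 0 < a) (hZ : IsCompact Z) {A : Set (Hyp d)} (hA : MeasurableSet A)
    (hAZ : A ⊆ Z) {ε : ℝ} (haε : a ≤ ε) (hεb : ε ≤ b) :
    volume (N s ⁻¹' A ∩ (U ∩ minVal (suppHyp K) N s ⁻¹' Ioc a ε)) =
      ∑ i : Fin (d + 1), ENNReal.ofReal (steinerWeight d i * s ^ (i : ℕ) *
        (ε ^ (d + 1 - (i : ℕ)) - a ^ (d + 1 - (i : ℕ)))) * S i A := by
  obtain ⟨h1, h2⟩ := preimage_brush_eq hK H hpos hcov hs hAZ haε hεb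
  have hs0 := hs.1
  have hnull : NullMeasurableSet (N s ⁻¹' A ∩ (U ∩ minVal (suppHyp K) N s ⁻¹' Ioc a ε)) volume :=
    (nullMeasurableSet_restrict (measurableSet_level H hs ε).nullMeasurableSet).1
      ((aemeasurable_normal H hs ε).nullMeasurable hA)
  have h3 := measure_union₀ hnull h2.aedisjoint
  rw [← h1, volume_preimage_brush hS hA hs0 (ha.trans_le haε),
    volume_preimage_brush hS hA hs0 ha] at h3
  have hw : ∀ i : ℕ, 0 ≤ steinerWeight d i := fun i => by unfold steinerWeight; positivity
  have hfin : ∑ i : Fin (d + 1), ENNReal.ofReal (steinerWeight d i * s ^ (i : ℕ) *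
      a ^ (d + 1 - (i : ℕ))) * S i A ≠ ⊤ := by
    refine ENNReal.sum_ne_top.2 fun i _ => ENNReal.mul_ne_top ENNReal.ofReal_ne_top ?_
    have := hS.1 i
    exact ne_top_of_le_ne_top hZ.measure_lt_top.ne (measure_mono hAZ)
  refine (ENNReal.add_right_inj hfin).1 (h3.symm.trans ?_)
  rw [← Finset.sum_add_distrib]
  refine Finset.sum_congr rfl fun i _ => ?_
  have hle : a ^ (d + 1 - (i : ℕ)) ≤ ε ^ (d + 1 - (i : ℕ)) := pow_le_pow_left₀ ha.le haε _
  have hwi := hw i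
  rw [← add_mul, ← ENNReal.ofReal_add (by positivity)
    (mul_nonneg (by positivity) (sub_nonneg.2 hle))]
  congr 2
  ring

include hK hpos hcov hS in
-- The volumes over all Borel subsets of Z say that the image of the layer under the normal map,
-- restricted to Z, is a combination of the area measures; a function supported in Z can be
-- integrated against both.
lemma integral_level (ha : 0 < a) {f : Hyp d → ℝ} (hf : Continuous f) (hfs : HasCompactSupport f)
    (hfZ : tsupport f = Z) {ε : ℝ} (haε : a ≤ ε) (hεb : ε ≤ b) :
    ∫ x in U ∩ minVal (suppHyp K) N s ⁻¹' Ioc a ε, f (N s x) =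
      ∑ i : Fin (d + 1), steinerWeight d i * s ^ (i : ℕ) *
        (ε ^ (d + 1 - (i : ℕ)) - a ^ (d + 1 - (i : ℕ))) * ∫ y, f y ∂(S i) := by
  have hZ : IsCompact Z := hfZ ▸ hfs
  have hZm : MeasurableSet Z := hZ.isClosed.measurableSet
  have hs0 := hs.1
  have hN := aemeasurable_normal (a := a) H hs ε
  have hwt : ∀ i : Fin (d + 1), 0 ≤ steinerWeight d i * s ^ (i : ℕ) *
      (ε ^ (d + 1 - (i : ℕ)) - a ^ (d + 1 - (i : ℕ))) := by
    intro i
    have hle : a ^ (d + 1 - (i : ℕ)) ≤ ε ^ (d + 1 - (i : ℕ)) := pow_le_pow_left₀ ha.le haε _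
    refine mul_nonneg (mul_nonneg ?_ (by positivity)) (sub_nonneg.2 hle)
    unfold steinerWeight; positivity
  have hmeas : ((volume.restrict (U ∩ minVal (suppHyp K) N s ⁻¹' Ioc a ε)).map (N s)).restrict Z =
      ∑ i : Fin (d + 1), ENNReal.ofReal (steinerWeight d i * s ^ (i : ℕ) *
        (ε ^ (d + 1 - (i : ℕ)) - a ^ (d + 1 - (i : ℕ)))) • (S i).restrict Z := by
    ext A hA
    rw [Measure.restrict_apply hA, Measure.map_apply_of_aemeasurable hN (hA.inter hZm),
      Measure.restrict_apply' (measurableSet_level H hs ε),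
      volume_level hK hS H hpos hcov hs ha hZ (hA.inter hZm) inter_subset_right haε hεb,
      Measure.finsetSum_apply]
    refine Finset.sum_congr rfl fun i _ => ?_
    rw [Measure.smul_apply, smul_eq_mul, Measure.restrict_apply hA]
  have hoff : ∀ y ∉ Z, f y = 0 := fun y hy => image_eq_zero_of_notMem_tsupport (hfZ ▸ hy)
  rw [← integral_map hN hf.aestronglyMeasurable,
    ← setIntegral_eq_integral_of_forall_compl_eq_zero hoff, hmeas, integral_finsetSum_measure]
  · refine Finset.sum_congr rfl fun i _ => ?_
    rw [integral_smul_measure, ENNReal.toReal_ofReal (hwt i), smul_eq_mul,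
      setIntegral_eq_integral_of_forall_compl_eq_zero hoff]
  · intro i _
    have := hS.1 i
    exact (hf.integrable_of_hasCompactSupport hfs).restrict.smul_measure ENNReal.ofReal_ne_top

end LevelSets

/-! ## The Steiner polynomial -/

/-- Layer-cake formula: φ(T) is minus the integral of φ' from T to b. It reduces a smooth weight of
T to indicators of the layers (a, ε]. -/
lemma eq_neg_integral_deriv {φ : ℝ → ℝ} (hφ : ContDiff ℝ ∞ φ) {a b : ℝ}
    (h0 : ∀ t ∉ Ioo a b, φ t = 0) (T : ℝ) :
    φ T = -∫ ε in Ioc a b, deriv φ ε * (Ioc a ε).indicator (fun _ => (1 : ℝ)) T := by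
  have hd : Continuous (deriv φ) := hφ.continuous_deriv (by simp)
  by_cases hT : T ∈ Ioo a b
  · have h1 : ∫ ε in Ioc a b, deriv φ ε * (Ioc a ε).indicator (fun _ => (1 : ℝ)) T =
        ∫ ε in Icc T b, deriv φ ε := by
      rw [← integral_indicator measurableSet_Ioc, ← integral_indicator measurableSet_Icc]
      congr 1
      funext ε
      by_cases h : T ≤ ε
      · by_cases h' : ε ≤ b
        · rw [indicator_of_mem (show ε ∈ Ioc a b from ⟨hT.1.trans_le h, h'⟩),
            indicator_of_mem (show ε ∈ Icc T b from ⟨h, h'⟩),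
            indicator_of_mem (show T ∈ Ioc a ε from ⟨hT.1, h⟩), mul_one]
        · rw [indicator_of_notMem (fun hm => h' hm.2), indicator_of_notMem (fun hm => h' hm.2)]
      · rw [indicator_of_notMem (s := Icc T b) (fun hm => h hm.1)]
        refine indicator_apply_eq_zero.2 fun _ => ?_
        rw [indicator_of_notMem (fun hm => h hm.2), mul_zero]
    rw [h1, integral_Icc_eq_integral_Ioc, ← intervalIntegral.integral_of_le hT.2.le,
      intervalIntegral.integral_deriv_eq_sub (fun x _ => hφ.differentiable (by simp) x)
        (hd.intervalIntegrable _ _), h0 b (fun h => lt_irrefl _ h.2)]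
    ring
  · rw [h0 T hT, setIntegral_eq_zero_of_forall_eq_zero, neg_zero]
    intro ε hε
    -- Off the open interval the indicator can be nonzero only for T = ε = b, where φ' vanishes by
    -- continuity from the right.
    by_cases h : T ∈ Ioc a ε
    · have h1 : T = b := by
        by_contra hne
        exact hT ⟨h.1, lt_of_le_of_ne (h.2.trans hε.2) hne⟩
      have h2 : ε = b := le_antisymm hε.2 (h1 ▸ h.2)
      have h3 : deriv φ b = 0 := by
        have hcl : b ∈ closure (Ioi b) := by rw [closure_Ioi]; exact self_mem_Ici
        have hz : Ioi b ⊆ {t | deriv φ t = 0} := by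
          intro t ht
          have hev : φ =ᶠ[𝓝 t] fun _ => 0 := by
            filter_upwards [isOpen_Ioi.mem_nhds ht] with τ hτ
            exact h0 τ fun h => lt_asymm h.2 hτ
          show deriv φ t = 0
          rw [hev.deriv_eq, deriv_const]
        exact closure_minimal hz (isClosed_eq hd continuous_const) hcl
      rw [h2, h3, zero_mul]
    · rw [indicator_of_notMem h, mul_zero]

/-- The moments of a weight in the Steiner formula. -/
noncomputable def steinerMoment (d : ℕ) (φ : ℝ → ℝ) (a b : ℝ) (i : ℕ) : ℝ :=
  -(steinerWeight d i * ∫ ε in Ioc a b, deriv φ ε * (ε ^ (d + 1 - i) - a ^ (d + 1 - i)))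

/-- Layer-cake formula in T_s, Fubini, and the level identity for each ε. The result is polynomial
in s, and its moments depend on φ, a, b and d but not on K. -/
theorem integral_steiner {K : Set (Mink d)} (hK : IsFConvex K)
    {S : Fin (d + 1) → Measure (Hyp d)} (hS : IsAreaMeasures K S) {U Q : Set (Mink d)}
    {s₀ B c : ℝ} {N : ℝ → Mink d → Hyp d} (H : MinField (suppHyp K) U Q s₀ B c N)
    (hpos : ∀ s ∈ Ioo 0 s₀, ∀ x ∈ U, 0 < minVal (suppHyp K) N s x)
    {f : Hyp d → ℝ} (hf : IsTest f) {a b : ℝ} (ha : 0 < a)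
    (hcov : ∀ s ∈ Ioo 0 s₀, ∀ (x : Mink d) (t : ℝ) (n : Hyp d), n ∈ tsupport f →
      s * t ∈ Icc a b → Touch K (s⁻¹ • x) t n → x ∈ U)
    {φ : ℝ → ℝ} (hφ : ContDiff ℝ ∞ φ) (h0 : ∀ t ∉ Ioo a b, φ t = 0) {s : ℝ} (hs : s ∈ Ioo 0 s₀) :
    ∫ x in U, φ (minVal (suppHyp K) N s x) * f (N s x) =
      ∑ i : Fin (d + 1), steinerMoment d φ a b i * (∫ y, f y ∂(S i)) * s ^ (i : ℕ) := by
  have hfc := hf.1.continuous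
  have hUm : MeasurableSet U := H.isOpen.measurableSet
  have hd' : Continuous (deriv φ) := hφ.continuous_deriv (by simp)
  have : IsFiniteMeasure (volume.restrict U) := ⟨by
    rw [Measure.restrict_apply_univ]
    exact (measure_mono H.subset).trans_lt H.isCompact.measure_lt_top⟩
  have hTm : AEStronglyMeasurable (minVal (suppHyp K) N s) (volume.restrict U) :=
    (H.continuousOn_minVal hs).aestronglyMeasurable hUm
  have hNm : AEStronglyMeasurable (fun x => f (N s x)) (volume.restrict U) :=
    (hfc.comp_continuousOn (H.cont s hs)).aestronglyMeasurable hUm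
  obtain ⟨C₁, hC₁⟩ := hf.2.exists_bound_of_continuous hfc
  obtain ⟨C₂, hC₂⟩ := (isCompact_Icc (a := a) (b := b)).exists_bound_of_continuousOn
    hd'.continuousOn
  have hind : Measurable fun p : ℝ × ℝ => (Ioc a p.2).indicator (fun _ => (1 : ℝ)) p.1 := by
    have h1 : MeasurableSet {p : ℝ × ℝ | a < p.1 ∧ p.1 ≤ p.2} :=
      (measurableSet_lt measurable_const measurable_fst).inter
        (measurableSet_le measurable_fst measurable_snd)
    exact (measurable_const (a := (1 : ℝ))).indicator h1
  have hint : Integrable (Function.uncurry fun (x : Mink d) (ε : ℝ) =>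
      deriv φ ε * (Ioc a ε).indicator (fun _ => (1 : ℝ)) (minVal (suppHyp K) N s x) * f (N s x))
      ((volume.restrict U).prod (volume.restrict (Ioc a b))) := by
    refine Integrable.of_bound (C := |C₂| * 1 * C₁) ?_ ?_
    · refine AEStronglyMeasurable.mul (AEStronglyMeasurable.mul ?_ ?_) ?_
      · exact (hd'.comp continuous_snd).aestronglyMeasurable
      · exact (hind.comp_aemeasurable
          (hTm.comp_fst.aemeasurable.prodMk measurable_snd.aemeasurable)).aestronglyMeasurable
      · exact hNm.comp_fst
    · have hsnd : ∀ᵐ p ∂((volume.restrict U).prod (volume.restrict (Ioc a b))),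
          (p : Mink d × ℝ).2 ∈ Ioc a b :=
        Measure.quasiMeasurePreserving_snd.ae (ae_restrict_mem measurableSet_Ioc)
      filter_upwards [hsnd] with p hp
      simp only [Function.uncurry, norm_mul]
      have h1 : ‖(Ioc a p.2).indicator (fun _ => (1 : ℝ)) (minVal (suppHyp K) N s p.1)‖ ≤ 1 :=
        (norm_indicator_le_norm_self _ _).trans (by simp)
      have h2 : ‖deriv φ p.2‖ ≤ |C₂| := (hC₂ _ ⟨hp.1.le, hp.2⟩).trans (le_abs_self _)
      gcongr
      exact hC₁ _
  have hlevel : ∀ ε ∈ Ioc a b, ∫ x in U, deriv φ ε * (Ioc a ε).indicator (fun _ => (1 : ℝ))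
      (minVal (suppHyp K) N s x) * f (N s x) = ∑ i : Fin (d + 1), steinerWeight d i * s ^ (i : ℕ) *
        (∫ y, f y ∂(S i)) * (deriv φ ε * (ε ^ (d + 1 - (i : ℕ)) - a ^ (d + 1 - (i : ℕ)))) := by
    intro ε hε
    have h1 : ∫ x in U, (Ioc a ε).indicator (fun _ => (1 : ℝ)) (minVal (suppHyp K) N s x) *
        f (N s x) = ∫ x in U ∩ minVal (suppHyp K) N s ⁻¹' Ioc a ε, f (N s x) := by
      rw [← integral_indicator hUm, ← integral_indicator (measurableSet_level H hs ε)]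
      congr 1
      funext x
      by_cases hx : x ∈ U
      · by_cases hT : minVal (suppHyp K) N s x ∈ Ioc a ε
        · rw [indicator_of_mem hx, indicator_of_mem hT, 
            indicator_of_mem (show x ∈ U ∩ minVal (suppHyp K) N s ⁻¹' Ioc a ε from ⟨hx, hT⟩), one_mul]
        · rw [indicator_of_mem hx, indicator_of_notMem hT,
            indicator_of_notMem (fun h => hT h.2), zero_mul]
      · rw [indicator_of_notMem hx, indicator_of_notMem (fun h => hx h.1)]
    simp only [mul_assoc]
    rw [integral_const_mul, h1,
      integral_level hK hS H hpos hcov hs ha hfc hf.2 rfl hε.1.le hε.2, Finset.mul_sum]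
    refine Finset.sum_congr rfl fun i _ => ?_
    ring
  calc ∫ x in U, φ (minVal (suppHyp K) N s x) * f (N s x)
      = -∫ x in U, ∫ ε in Ioc a b, deriv φ ε * (Ioc a ε).indicator (fun _ => (1 : ℝ))
          (minVal (suppHyp K) N s x) * f (N s x) := by
        rw [← integral_neg]
        congr 1
        funext x
        rw [eq_neg_integral_deriv hφ h0, integral_mul_const, neg_mul]
    _ = -∫ ε in Ioc a b, ∑ i : Fin (d + 1), steinerWeight d i * s ^ (i : ℕ) *
        (∫ y, f y ∂(S i)) * (deriv φ ε * (ε ^ (d + 1 - (i : ℕ)) - a ^ (d + 1 - (i : ℕ)))) := by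
        rw [integral_integral_swap hint, setIntegral_congr_fun measurableSet_Ioc hlevel]
    _ = _ := by
        rw [integral_finsetSum]
        · rw [← Finset.sum_neg_distrib]
          refine Finset.sum_congr rfl fun i _ => ?_
          rw [integral_const_mul, steinerMoment]
          ring
        · intro i _
          exact (Continuous.integrableOn_Ioc (by fun_prop))

/-- Convergence of the quotient forces J₀ to be the value of the polynomial at 0; the quotient is
then its difference quotient there. -/
lemma coeff_one_of_tendsto {β : Fin (d + 1) → ℝ} {J₀ L : ℝ} (i : Fin (d + 1)) (hi : (i : ℕ) = 1)
    (h : Filter.Tendsto (fun s : ℝ => s⁻¹ * ((∑ j : Fin (d + 1), β j * s ^ (j : ℕ)) - J₀)) (𝓝[>] 0)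
      (𝓝 L)) : β i = L := by
  set p : ℝ → ℝ := fun s => ∑ j : Fin (d + 1), β j * s ^ (j : ℕ) with hp
  have hid : Filter.Tendsto (fun s : ℝ => s) (𝓝[>] 0) (𝓝 0) :=
    Filter.tendsto_id.mono_left nhdsWithin_le_nhds
  have h1 : Filter.Tendsto (fun s => p s - J₀) (𝓝[>] 0) (𝓝 0) := by
    have := hid.mul h
    rw [zero_mul] at this
    refine this.congr' ?_
    filter_upwards [self_mem_nhdsWithin] with s hs
    exact mul_inv_cancel_left₀ (ne_of_gt hs) _
  have hpc : Continuous p := by fun_prop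
  have h2 : Filter.Tendsto (fun s => p s - J₀) (𝓝[>] 0) (𝓝 (p 0 - J₀)) :=
    ((hpc.tendsto 0).mono_left nhdsWithin_le_nhds).sub_const _
  have hJ : p 0 = J₀ := sub_eq_zero.1 (tendsto_nhds_unique h2 h1)
  have hder : HasDerivAt p (β i) 0 := by
    have h3 : HasDerivAt p (∑ j : Fin (d + 1), β j * ((j : ℕ) * (0 : ℝ) ^ ((j : ℕ) - 1))) 0 :=
      HasDerivAt.fun_sum fun j _ => (hasDerivAt_pow (j : ℕ) (0 : ℝ)).const_mul (β j)
    convert h3 using 1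
    rw [Finset.sum_eq_single i]
    · simp [hi]
    · intro j _ hj
      rcases Nat.eq_zero_or_pos (j : ℕ) with h0 | h0
      · simp [h0]
      · have : (j : ℕ) ≠ 1 := fun h => hj (Fin.ext (h.trans hi.symm))
        rw [zero_pow (by omega)]
        simp
    · simp
  have h4 := (hasDerivAt_iff_tendsto_slope_zero.1 hder).mono_left
    (nhdsWithin_mono 0 (show Ioi (0 : ℝ) ⊆ {0}ᶜ from fun s hs => ne_of_gt hs))
  refine tendsto_nhds_unique (h4.congr fun s => ?_) h
  rw [zero_add, hJ, smul_eq_mul]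

/-- The first area measure is determined by the support function, through `S₁`. -/
theorem exists_S1_suppHyp_eq (hd : 1 ≤ d) : ∃ C : ℝ, ∀ (K : Set (Mink d)) (μ : Measure (Hyp d)),
    IsFConvex K → IsFirstAreaMeasure K μ → ∀ f : TestFun d,
      S1 (suppHyp K) f = C * ∫ y, f.1 y ∂μ := by
  obtain ⟨ψ, hψ, hψ0, hψs, hψp⟩ := exists_bump (show (1 : ℝ) < 2 by norm_num)
  set φ : ℝ → ℝ := fun t => t * ψ t with hφdef
  have hφ : ContDiff ℝ ∞ φ := contDiff_id.mul hψ
  have hcψ := integral_bump_pos hψ.continuous hψ0 one_pos (show (1 : ℝ) < 2 by norm_num) hψs hψp d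
  set κ := ∫ t in Ioi (0 : ℝ), t ^ d * ψ t with hκ
  have hd0 : (0 : ℝ) < d := by exact_mod_cast hd
  -- The support interval [1, 2] is enlarged to (1/2, 3), since the layer formula needs the weight
  -- to vanish at the endpoints as well.
  have hψs' : ∀ t ∉ Ioo (1 / 2 : ℝ) 3, ψ t = 0 := fun t ht => hψs t fun h =>
    ht ⟨by linarith [h.1], by linarith [h.2]⟩
  -- The constant comes from equating the two expressions for the derivative at s = 0. It depends
  -- only on d and the chosen bump, and uniqueness requires nothing more of it: in particular not
  -- that it be nonzero.
  refine ⟨steinerMoment d φ (1 / 2) 3 1 / (d * κ), fun K μ hK hμ f => ?_⟩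
  obtain ⟨S, hS, i, hi, rfl⟩ := hμ
  obtain ⟨U, Q, s₀, B, c, N, H, hcone, hpos, hcov⟩ :=
    hK.exists_minField f.2.2.isCompact (a := 1 / 2) (b := 3) (by norm_num)
  have hc := hK.continuous_suppHyp
  have h1 := H.tendsto_integral hd hc f.2 hψ (fun t ht => hψs' t fun h => ht ⟨h.1.le, h.2.le⟩)
    (by norm_num) hcone
  have h2 := coeff_one_of_tendsto i hi (h1.congr' (by
    filter_upwards [Ioo_mem_nhdsGT H.s₀_pos] with s hs
    rw [← integral_steiner hK hS H hpos f.2 (by norm_num) hcov hφ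
      (fun t ht => by simp [hφdef, hψs' t ht]) hs]))
  rw [hi] at h2
  have h3 : S1 (suppHyp K) f =
      1 / d * ∫ x, suppHyp K x * (lap f.1 x - d * f.1 x) ∂(hypVol d) := by
    rw [S1, ← integral_const_mul]
    congr 1
    funext x
    field_simp
  rw [h3, div_mul_eq_mul_div (steinerMoment d φ (1 / 2) 3 1), h2, ← hκ]
  field_simp

/-- Equivariant F-convex sets are determined by their first area measure. -/
theorem IsTauFConvex.eq_of_firstAreaMeasure (hd : 1 ≤ d) {Γ : Subgroup (HypIsom d)}
    (hΓ : IsCocompact Γ) {τ : Γ → Mink d} {μ : Measure (Hyp d)} {K K' : Set (Mink d)}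
    (hK : IsTauFConvex τ K) (hK' : IsTauFConvex τ K') (hμ : IsFirstAreaMeasure K μ)
    (hμ' : IsFirstAreaMeasure K' μ) : K = K' := by
  obtain ⟨C, hC⟩ := exists_S1_suppHyp_eq hd
  refine hK.1.ext_suppHyp hK'.1 (hK.isEquivariant.eq_of_S1 hd hΓ hK.1.continuous_suppHyp
    hK'.1.continuous_suppHyp hK'.isEquivariant (funext fun f => ?_))
  rw [hC K μ hK.1 hμ, hC K' μ hK'.1 hμ']

end Steiner

theorem mainTheorem9 (d : ℕ) (hd : 1 ≤ d) (Γ : Subgroup (HypIsom d)) (hΓ : IsCocompact Γ) :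
    (∀ μ' : Measure (HypQuot Γ), IsFiniteMeasure μ' →
      ∃ T : QuotDistribution Γ,
        IsSolution μ' T ∧
        (∀ T' : QuotDistribution Γ, IsSolution μ' T' → T' = T) ∧
        ∃ μ : Measure (Hyp d), IsPullback μ' μ ∧ IsGreenPushforward μ T) ∧
    (∀ τ : Γ → Mink d, IsCocycle τ →
      (∀ h h' : Hyp d → ℝ, Continuous h → Continuous h' →
        IsEquivariant τ h → IsEquivariant τ h' → S1 h = S1 h' → h = h') ∧
      (∀ (μ : Measure (Hyp d)) (K K' : Set (Mink d)),
        IsTauFConvex τ K → IsTauFConvex τ K' →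
        IsFirstAreaMeasure K μ → IsFirstAreaMeasure K' μ → K = K')) := by
  refine ⟨fun μ' hμ' => ?_, fun τ hτ => ⟨fun h h' hc hc' he he' hS =>
    he.eq_of_S1 hd hΓ hc hc' he' hS, fun μ K K' hK hK' hμ hμ' => ?_⟩⟩
  · obtain ⟨σ, hσm, hσ⟩ := hΓ.exists_section
    exact ⟨greenDistribution hd hΓ μ', isSolution_greenDistribution hd hΓ μ',
      fun T' hT' => hT'.unique hd hΓ (isSolution_greenDistribution hd hΓ μ'),
      liftMeasure μ' σ, isPullback_liftMeasure hΓ μ' hσm hσ,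
      isGreenPushforward_greenDistribution hd hΓ μ' hσm hσ⟩
  · exact hK.eq_of_firstAreaMeasure hd hΓ hK' hμ hμ'
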